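/- Let $n\ge 2$ be an integer, $m$ a divisor of $n$, $G$ a subgroup of $S_n$, and $X$ a $G$-set with $n$ elements. Let $J=\ker(\mathbb Z[X]\to\mathbb Z/m\mathbb Z)$, where every $x\in X$ is mapped to $1$, with the induced action of $G$. Let $F$ be a field with $\operatorname{char}(F)\nmid n$, $F_{sep}$ a separable closure of $F$, and let $T=\operatorname{Spec}F[J]$ be the split torus with character group $J$, so that $T(R)=\operatorname{Hom}(J,R^\times)$ and $G$ acts on $T$ by $(gt)(j)=t(g^{-1}j)$. Write $H^1(F,T\rtimes G)=H^1(\operatorname{Gal}(F_{sep}/F),(T\rtimes G)(F_{sep}))$ for the set of classes of continuous $1$-cocycles, $G$ being a constant group. A Galois $G$-algebra over $F$ is an étale $F$-algebra $E$ of dimension $|G|$ with an action of $G$ by $F$-algebra automorphisms such that $E^G=F$. For such an $E$ let $E_X=\operatorname{Map}_G(X,E)=(E\otimes_F F^X)^G$ be the étale $F$-algebra of degree $n$ obtained by twisting $F^X$ by the $G$-torsor $\operatorname{Spec}E$. For a nonzero étale $F$-algebra $K$ let $\operatorname{Br}_m(K/F)=\ker(\operatorname{Br}_m(F)\to\operatorname{Br}(K))$,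 where $\operatorname{Br}_m(F)$ is the $m$-torsion subgroup of $\operatorname{Br}(F)$. Then there is a bijection \[H^{1}(F,T\rtimes G)\;\simeq\;\coprod_{E}\operatorname{Br}_{m}(E_X/F),\] where the disjoint union is taken over all isomorphism classes of Galois $G$-algebras $E$ over $F$. It sends the class of a cocycle $c=(t_\sigma,\gamma_\sigma)_\sigma$ to the Brauer class of the central simple $F$-algebra \[\{M\in M_X(F_{sep}) : t_\sigma(x-y)\,\sigma(M_{\gamma_\sigma^{-1}x,\,\gamma_\sigma^{-1}y})=M_{x,y}\ \text{for all }\sigma,x,y\}\] in the component of the Galois $G$-algebra $\{f\colon G\to F_{sep} : f(\gamma_\sigma h)=\sigma(f(h))\ \text{for all }\sigma,h\}$, on which $G$ acts by $(gf)(h)=f(hg)$. If $G$ acts simply transitively on $X$, then $\operatorname{Br}_m(E_X/F)=\operatorname{Br}_m(E/F)$ for every Galois $G$-algebra $E$ over $F$, so that $H^{1}(F,T\rtimes G)\simeq\coprod_{E}\operatorname{Br}_{m}(E/F)$. -/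

import Mathlib

universe u v w

open scoped TensorProduct

noncomputable section

namespace TorusBrauer

/-! ### Non-abelian Galois cohomology in degree one -/

section Cohomology

variable (Γ : Type u) [Group Γ] [TopologicalSpace Γ] (A : Type v) [Group A]
  [MulDistribMulAction Γ A]

/-- Continuous 1-cocycles of the topological group `Γ` with values in the discrete `Γ`-group `A`.
Continuity for the discrete topology on `A` is local constancy. -/
structure Cocycle where
  toFun : Γ → A
  map_mul' : ∀ σ τ, toFun (σ * τ) = toFun σ * σ • toFun τ
  locConst : IsLocallyConstant toFun

instance : CoeFun (Cocycle Γ A) (fun _ => Γ → A) := ⟨Cocycle.toFun⟩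

/-- Two cocycles are cohomologous if `c' σ = a⁻¹ * c σ * σ(a)` for some `a`. -/
def cohomologous : Setoid (Cocycle Γ A) where
  r c c' := ∃ a : A, ∀ σ : Γ, c' σ = a⁻¹ * c σ * σ • a
  iseqv :=
    { refl := fun c => ⟨1, fun σ => by simp⟩
      symm := by
        rintro c c' ⟨a, h⟩
        exact ⟨a⁻¹, fun σ => by rw [h]; simp [mul_assoc]⟩
      trans := by
        rintro c c' c'' ⟨a, h⟩ ⟨b, h'⟩
        exact ⟨a * b, fun σ => by rw [h', h]; simp [mul_assoc]⟩ }

/-- The pointed set `H¹(Γ, A)`. -/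
def H1 : Type (max u v) := Quotient (cohomologous Γ A)

/-- The cohomology class of a cocycle. -/
def H1.mk {Γ : Type u} [Group Γ] [TopologicalSpace Γ] {A : Type v} [Group A]
    [MulDistribMulAction Γ A] (c : Cocycle Γ A) : H1 Γ A := Quotient.mk (cohomologous Γ A) c

end Cohomology

/-- The absolute Galois group `Gal(F_sep/F)`, with its Krull topology. -/
abbrev AbsGal (F : Type u) [Field F] : Type u := Gal(SeparableClosure F/F)

/-! ### The lattice `J`, the split torus with character group `J`, and `T ⋊ G` -/

section Torus

variable (X : Type v) (m : ℕ)

/-- The map `ℤ[X] → ℤ/m` sending every `x ∈ X` to `1`. -/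
def augMod : (X →₀ ℤ) →+ ZMod m := Finsupp.liftAddHom fun _ => Int.castAddHom (ZMod m)

/-- `J = ker (ℤ[X] → ℤ/m)`. -/
def J : AddSubgroup (X →₀ ℤ) := (augMod X m).ker

/-- The element `x - y` of `J`. -/
def J.diff (x y : X) : J X m :=
  ⟨Finsupp.single x 1 - Finsupp.single y 1, by
    rw [J, AddMonoidHom.mem_ker, map_sub]; simp [augMod]⟩

variable {X} in
theorem J.diff_add (x y z : X) : J.diff X m x y + J.diff X m y z = J.diff X m x z := by
  ext1; simp [J.diff]

variable {X} in
theorem J.diff_self (x : X) : J.diff X m x x = 0 := by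
  ext1; simp [J.diff]

/-- The `R`-points of the split torus `T = Spec F[J]` with character group `J`, that is the group
`Hom(J, Rˣ)`; see `torusPointsEquiv`. -/
abbrev TorusPoints (R : Type w) [CommRing R] : Type (max v w) := Multiplicative (J X m) →* Rˣ

/-- The `F`-algebra homomorphisms `F[J] → R` are the homomorphisms `J → Rˣ`. -/
def torusPointsEquiv (F : Type u) [Field F] (R : Type w) [CommRing R] [Algebra F R] :
    (MonoidAlgebra F (Multiplicative (J X m)) →ₐ[F] R) ≃ TorusPoints X m R :=
  (MonoidAlgebra.lift F R (Multiplicative (J X m))).symm.trans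
    { toFun := fun f => f.toHomUnits
      invFun := fun f => (Units.coeHom R).comp f
      left_inv := fun f => by ext; rfl
      right_inv := fun f => by ext; rfl }

variable (G : Type w) [Group G] [MulAction G X]

variable {X G} in
/-- The action of `g ∈ G` on `J ⊆ ℤ[X]` induced by the action on `X`. -/
def J.act (g : G) : J X m →+ J X m :=
  ((Finsupp.mapDomain.addMonoidHom (g • · : X → X)).comp (J X m).subtype).codRestrict (J X m) (by
    rintro ⟨f, hf⟩
    have hf' : augMod X m f = 0 := hf
    change augMod X m _ = 0
    rw [← hf']
    simp only [augMod, AddMonoidHom.comp_apply, AddSubgroup.subtype_apply,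
      Finsupp.mapDomain.addMonoidHom_apply, Finsupp.liftAddHom_apply]
    rw [Finsupp.sum_mapDomain_index] <;> simp)

variable {X G} in
theorem J.coe_act (g : G) (j : J X m) :
    (J.act m g j : X →₀ ℤ) = Finsupp.mapDomain (g • ·) (j : X →₀ ℤ) := rfl

variable {X G} in
theorem J.act_one (j : J X m) : J.act m (1 : G) j = j := by
  ext1
  rw [J.coe_act, show ((1 : G) • · : X → X) = id from funext (one_smul G), Finsupp.mapDomain_id]

variable {X G} in
theorem J.act_mul (g h : G) (j : J X m) : J.act m (g * h) j = J.act m g (J.act m h j) := by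
  ext1
  simp only [J.coe_act, ← Finsupp.mapDomain_comp]
  congr 1
  funext x
  simp [mul_smul]

/-- The action of `G` on the points of `T`: `(g t)(j) = t(g⁻¹ j)`. -/
def torusAct (R : Type u) [CommRing R] : G →* MulAut (TorusPoints X m R) where
  toFun g :=
    { toFun := fun t => t.comp (AddMonoidHom.toMultiplicative (J.act m g⁻¹))
      invFun := fun t => t.comp (AddMonoidHom.toMultiplicative (J.act m g))
      left_inv := fun t => by
        ext j
        simp [← J.act_mul, J.act_one]
      right_inv := fun t => by
        ext j
        simp [← J.act_mul, J.act_one]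
      map_mul' := fun t t' => rfl }
  map_one' := by
    ext t j
    simp [J.act_one]
  map_mul' g h := by
    ext t j
    simp [J.act_mul]

/-- The `R`-points of `T ⋊ G`, for `R` with connected spectrum (only fields are used), where `G` is
regarded as a constant group. -/
abbrev TorusSemidirect (R : Type u) [CommRing R] : Type _ :=
  TorusPoints X m R ⋊[torusAct X m G R] G

/-- `Gal(F_sep/F)` acts on `(T ⋊ G)(F_sep)` through `F_sep`; so the action on `G` is trivial. -/
instance (F : Type u) [Field F] :
    MulDistribMulAction (AbsGal F) (TorusSemidirect X m G (SeparableClosure F)) where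
  smul σ p := ⟨(Units.map (σ : SeparableClosure F →* SeparableClosure F)).comp p.left, p.right⟩
  one_smul p := by
    refine SemidirectProduct.ext ?_ rfl
    ext j; rfl
  mul_smul σ τ p := by
    refine SemidirectProduct.ext ?_ rfl
    ext j; rfl
  smul_mul σ p q := by
    refine SemidirectProduct.ext ?_ rfl
    exact MonoidHom.comp_mul _ _ _
  smul_one σ := by
    refine SemidirectProduct.ext ?_ rfl
    exact MonoidHom.comp_one _

theorem smul_left (F : Type u) [Field F] (σ : AbsGal F)
    (p : TorusSemidirect X m G (SeparableClosure F)) : (σ • p).left =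
      (Units.map (σ : SeparableClosure F →* SeparableClosure F)).comp p.left := rfl

theorem smul_right (F : Type u) [Field F] (σ : AbsGal F)
    (p : TorusSemidirect X m G (SeparableClosure F)) : (σ • p).right = p.right := rfl

end Torus

/-! ### Galois `G`-algebras -/

section GaloisAlgebras

variable (G : Type w) [Group G] (F : Type u) [Field F]

/-- A Galois `G`-algebra over `F`: an étale `F`-algebra `E` of dimension `|G|` on which `G` acts by
`F`-algebra automorphisms with `E^G = F`. -/
structure GaloisAlgebra where
  carrier : Type u
  [commRing : CommRing carrier]
  [algebra : Algebra F carrier]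
  [action : MulSemiringAction G carrier]
  [smulComm : SMulCommClass G F carrier]
  [etale : Algebra.Etale F carrier]
  finrank_eq : Module.finrank F carrier = Nat.card G
  [invariant : Algebra.IsInvariant F carrier G]

instance : CoeSort (GaloisAlgebra G F) (Type u) := ⟨GaloisAlgebra.carrier⟩

attribute [instance] GaloisAlgebra.commRing GaloisAlgebra.algebra GaloisAlgebra.action
  GaloisAlgebra.smulComm GaloisAlgebra.etale GaloisAlgebra.invariant

/-- Galois `G`-algebras are isomorphic if there is a `G`-equivariant `F`-algebra isomorphism. -/
def galoisIso : Setoid (GaloisAlgebra G F) where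
  r E E' := ∃ e : E ≃ₐ[F] E', ∀ (g : G) (x : E), e (g • x) = g • e x
  iseqv :=
    { refl := fun E => ⟨AlgEquiv.refl, fun _ _ => rfl⟩
      symm := by
        rintro E E' ⟨e, he⟩
        exact ⟨e.symm, fun g x => by rw [AlgEquiv.symm_apply_eq, he, e.apply_symm_apply]⟩
      trans := by
        rintro E E' E'' ⟨e, he⟩ ⟨e', he'⟩
        exact ⟨e.trans e', fun g x => by simp [he, he']⟩ }

/-- Isomorphism classes of Galois `G`-algebras over `F`. -/
def GaloisClass : Type _ := Quotient (galoisIso G F)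

variable {G F} in
/-- The isomorphism class of a Galois `G`-algebra. -/
def GaloisClass.mk (E : GaloisAlgebra G F) : GaloisClass G F := Quotient.mk (galoisIso G F) E

variable {G F} in
/-- For a Galois `G`-algebra `E` and a `G`-set `X`, the algebra `Map_G(X, E) = (E ⊗ F^X)^G` of
`G`-equivariant maps `X → E`, that is the form of `F^X` obtained by twisting with the `G`-torsor
`Spec E`. -/
def assocAlgebra (X : Type v) [MulAction G X] (E : GaloisAlgebra G F) : Subalgebra F (X → E) where
  carrier := {φ | ∀ (g : G) (x : X), φ (g • x) = g • φ x}
  mul_mem' := fun {φ ψ} hφ hψ g x => by simp [hφ g x, hψ g x]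
  add_mem' := fun {φ ψ} hφ hψ g x => by simp [hφ g x, hψ g x]
  algebraMap_mem' r g x := by simp

end GaloisAlgebras

/-! ### Relative Brauer groups -/

section Brauer

/-- A `K`-algebra is split if it is a full matrix algebra over `K`. -/
def IsSplit (K : Type u) [CommRing K] (B : Type v) [Ring B] [Algebra K B] : Prop :=
  ∃ d : ℕ, d ≠ 0 ∧ Nonempty (B ≃ₐ[K] Matrix (Fin d) (Fin d) K)

/-- `Br_m(K/F) = ker (Br_m(F) → Br(K))` for an étale `F`-algebra `K ≠ 0`, as a subset of `Br(F)`: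
the classes of central simple `F`-algebras `A` whose `m`-th tensor power is split and which are
split by `K`. -/
def relBrauer (m : ℕ) (F : Type u) [Field F] (K : Type v) [CommRing K] [Algebra F K] :
    Set (BrauerGroup.{u, u} F) :=
  {b | ∃ A : CSA.{u, u} F, Quotient.mk (Brauer.CSA_Setoid F) A = b ∧
    IsSplit F (⨂[F] _ : Fin m, A) ∧ IsSplit K (K ⊗[F] A)}

theorem relBrauer_mono (m : ℕ) (F : Type u) [Field F] {K : Type v} [CommRing K] [Algebra F K]
    {K' : Type w} [CommRing K'] [Algebra F K'] (e : K ≃ₐ[F] K') :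
    relBrauer m F K ⊆ relBrauer m F K' := by
  rintro b ⟨A, hA, hm, d, hd, ⟨f⟩⟩
  refine ⟨A, hA, hm, d, hd, ⟨?_⟩⟩
  let f' : K' ⊗[F] A ≃+* Matrix (Fin d) (Fin d) K' :=
    ((Algebra.TensorProduct.congr e.symm (AlgEquiv.refl (A₁ := A))).toRingEquiv.trans
      f.toRingEquiv).trans e.toRingEquiv.mapMatrix
  refine AlgEquiv.ofRingEquiv (f := f') fun k => ?_
  have h : f ((e.symm k) ⊗ₜ[F] (1 : A)) = algebraMap K _ (e.symm k) := f.commutes (e.symm k)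
  change (f ((e.symm k) ⊗ₜ[F] (1 : A))).map e = _
  rw [h]
  ext i j
  by_cases hij : i = j
  · subst hij; simp [Matrix.algebraMap_matrix_apply]
  · simp [Matrix.algebraMap_matrix_apply, hij]

theorem relBrauer_congr (m : ℕ) (F : Type u) [Field F] {K : Type v} [CommRing K] [Algebra F K]
    {K' : Type w} [CommRing K'] [Algebra F K'] (e : K ≃ₐ[F] K') :
    relBrauer m F K = relBrauer m F K' :=
  (relBrauer_mono m F e).antisymm (relBrauer_mono m F e.symm)

variable {G : Type w} [Group G] {F : Type u} [Field F] (X : Type v) [MulAction G X]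

/-- An isomorphism of Galois `G`-algebras induces one of the associated algebras. -/
def assocAlgebraEquiv {E E' : GaloisAlgebra G F} (e : E ≃ₐ[F] E')
    (he : ∀ (g : G) (x : E), e (g • x) = g • e x) :
    assocAlgebra X E ≃ₐ[F] assocAlgebra X E' where
  toFun φ := ⟨fun x => e (φ.1 x), fun g x => by
    beta_reduce
    rw [show φ.1 (g • x) = g • φ.1 x from φ.2 g x, he]⟩
  invFun φ := ⟨fun x => e.symm (φ.1 x), fun g x => by
    beta_reduce
    rw [show φ.1 (g • x) = g • φ.1 x from φ.2 g x, AlgEquiv.symm_apply_eq, he,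
      e.apply_symm_apply]⟩
  left_inv φ := by ext x; simp
  right_inv φ := by ext x; simp
  map_mul' φ ψ := by ext x; simp
  map_add' φ ψ := by ext x; simp
  commutes' r := by ext x; exact e.commutes r

/-- `Br_m(Map_G(X, E)/F)` as a function of the isomorphism class of `E`. -/
def relBrauerClass (m : ℕ) : GaloisClass G F → Set (BrauerGroup.{u, u} F) :=
  Quotient.lift (fun E => relBrauer m F (assocAlgebra X E)) fun _ _ ⟨e, he⟩ =>
    relBrauer_congr m F (assocAlgebraEquiv X e he)

end Brauer

/-! ### The objects attached to a cocycle -/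

section Twist

variable {F : Type u} [Field F] {G : Type w} [Group G] {X : Type v} [MulAction G X] {m : ℕ}

/-- The Galois `G`-algebra attached to the image `γ` of a cocycle `c` in `Z¹(F, G)`: the maps
`f : G → F_sep` with `f(γ_σ h) = σ(f(h))`, that is the invariants in `Map(G, F_sep)` of the Galois
action twisted by left translations. The group `G` acts on it by right translations. -/
def twistGalois (c : Cocycle (AbsGal F) (TorusSemidirect X m G (SeparableClosure F))) :
    Subalgebra F (G → SeparableClosure F) where
  carrier := {f | ∀ (σ : AbsGal F) (h : G), f ((c σ).right * h) = σ (f h)}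
  mul_mem' := fun {f f'} hf hf' σ h => by simp [hf σ h, hf' σ h]
  add_mem' := fun {f f'} hf hf' σ h => by simp [hf σ h, hf' σ h]
  algebraMap_mem' r σ h := by simp

variable [Fintype X] [DecidableEq X]

/-- The action of `(t, g) ∈ (T ⋊ G)(R)` on `M_X(R)` through
`T ⋊ G = (𝔾_m^X / μ_m) ⋊ G → PGL_X`: conjugation by the diagonal matrix of a lift of `t` times the
permutation matrix of `g`. -/
def adMatrix {R : Type u} [CommRing R] (p : TorusSemidirect X m G R) (M : Matrix X X R) :
    Matrix X X R :=
  Matrix.of fun x y => (p.left (Multiplicative.ofAdd (J.diff X m x y)) : R) *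
    M (p.right⁻¹ • x) (p.right⁻¹ • y)

/-- The form of `M_X(F)` attached to a cocycle `c`: the invariants in `M_X(F_sep)` of the Galois
action twisted by `c`. -/
def twistMatrix (c : Cocycle (AbsGal F) (TorusSemidirect X m G (SeparableClosure F))) :
    Subalgebra F (Matrix X X (SeparableClosure F)) where
  carrier := {M | ∀ σ : AbsGal F, adMatrix (c σ) (M.map σ) = M}
  mul_mem' := by
    intro M N hM hN σ
    refine Matrix.ext fun x y => ?_
    have h1 := fun z => (congrFun (congrFun (hM σ) x) z).symm
    have h2 := fun z => (congrFun (congrFun (hN σ) z) y).symm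
    simp only [adMatrix, Matrix.of_apply, Matrix.map_apply] at h1 h2
    simp only [adMatrix, Matrix.of_apply, Matrix.map_apply, Matrix.mul_apply, map_sum, map_mul]
    rw [Finset.mul_sum]
    refine Fintype.sum_equiv (MulAction.toPerm (c σ).right) _ _ fun z => ?_
    rw [MulAction.toPerm_apply, h1, h2, inv_smul_smul]
    rw [← J.diff_add m x ((c σ).right • z) y, ofAdd_add, map_mul, Units.val_mul]
    ring
  add_mem' := by
    intro M N hM hN σ
    refine Matrix.ext fun x y => ?_
    have h1 := congrFun (congrFun (hM σ) x) y
    have h2 := congrFun (congrFun (hN σ) x) y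
    simp only [adMatrix, Matrix.of_apply, Matrix.map_apply] at h1 h2
    simp only [adMatrix, Matrix.of_apply, Matrix.map_apply, Matrix.add_apply, map_add, mul_add,
      h1, h2]
  algebraMap_mem' := by
    intro r σ
    refine Matrix.ext fun x y => ?_
    by_cases hxy : x = y
    · subst hxy
      simp [adMatrix, Matrix.algebraMap_matrix_apply, J.diff_self]
    · simp [adMatrix, Matrix.algebraMap_matrix_apply, hxy]

end Twist

end TorusBrauer

end

open TorusBrauer

/-! Dually to the inclusion of `J` in `ℤ[X]`, the torus `T` is `𝔾_m^X / μ_m`. A cocycle `(t, γ)`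
gives a homomorphism `γ : Gal → G`, that is, a Galois algebra `E`. For fixed `γ` the twisted
sequence `1 → μ_m → R_{E_X/F} 𝔾_m → T_γ → 1`, with Hilbert 90 in the middle, identifies `H¹(F, T_γ)`
with the kernel of `H²(F, μ_m) → Br(E_X)`. When `m` is invertible in `F`, this kernel is
`Br_m(E_X/F)`. The proof carries this out with matrices instead of `H²`. Its basic tools are Galois
descent (`span_invariants`, `linearIndependent_of_invariant`) and the forms of Hilbert 90 derived
from it (`exists_eq_coboundary`, `exists_invariant_unit`).

The map is well defined for two reasons. After choosing a base point `z`, the functions `x ↦ t_σ(x -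
z)` times the permutations `γ_σ` form a projective cocycle, and conjugation by it twists `M_X`. On
the `m`-th tensor power the weights `t_σ(x₁ + ⋯ + x_m)` are available, because this sum lies in `J`.
They give an honest cocycle, so the power is split (`isSplit_tensorPower`). The diagonal matrix
units are permuted through `γ`, so the columns of the twisted algebra form a Galois-equivariant
family of representations, and `E_X` splits it (`isSplit_twistFun`).

Injectivity: isomorphic Galois algebras have conjugate `γ` (`isConj_of_twistFun_equiv`), so the
homomorphisms may be assumed equal. Brauer equivalence gives an intertwining matrix that is
equivariant up to scalars. Hilbert 90 for the units of `E_X` then turns the ratio of the two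
cocycles into a coboundary on differences `x - y` (`exists_diff_ratio`). What remains factors
through the degree `J → ℤ` and is removed by Hilbert 90 for `F_sepˣ` (`exists_cohomologous`).

Surjectivity: every Galois algebra comes from some `γ` (`exists_equiv_twistFun`). If `A` is split by
`E_X` and its `m`-th tensor power is split, a projective cocycle of `A` can be rescaled to have its
factor set `a` in `μ_m` (`exists_rescaled_projective`). Comparing it with the family of
representations over `E_X` gives functions `u_σ` on `X` with the same defect `a`. Since `a` dies in
`𝔾_m^X / μ_m`, these define a cocycle. Its twisted algebra `B` is Brauer equivalent to `A`, because
the factor sets cancel in `A ⊗ Bᵒᵖ` and in `B ⊗ Bᵒᵖ` (`exists_cocycle_of_isSplit`). -/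

noncomputable section
namespace TorusBrauer

/-! ### Galois descent for vector spaces -/

section Descent

open Topology

variable {F : Type*} {L : Type*} [Field F] [Field L] [Algebra F L]

/-- A continuous semilinear action of `Gal(L/F)` on an `L`-vector space. -/
structure SemilinearAction (F L V : Type*) [Field F] [Field L] [Algebra F L] [AddCommGroup V]
    [Module L V] where
  toFun : Gal(L/F) → V →+ V
  map_smul' : ∀ σ (a : L) v, toFun σ (a • v) = σ a • toFun σ v
  map_mul' : ∀ σ τ v, toFun (σ * τ) v = toFun σ (toFun τ v)
  eventually_fixed : ∀ v, ∀ᶠ σ in 𝓝 1, toFun σ v = v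

namespace SemilinearAction

variable {V : Type*} [AddCommGroup V] [Module L V] (ρ : SemilinearAction F L V)

instance : CoeFun (SemilinearAction F L V) (fun _ => Gal(L/F) → V →+ V) := ⟨toFun⟩

theorem map_one (v : V) : ρ 1 v = v := (ρ.eventually_fixed v).self_of_nhds

variable [Module F V] [IsScalarTower F L V]

/-- The `F`-space of invariant vectors. -/
def invariants : Submodule F V where
  carrier := {v | ∀ σ, ρ σ v = v}
  add_mem' hv hw σ := by rw [map_add, hv, hw]
  zero_mem' σ := map_zero _
  smul_mem' a v hv σ := by
    rw [← algebraMap_smul L a v, ρ.map_smul', AlgEquiv.commutes, hv]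

variable [IsGalois F L]

/-- Artin's argument: a relation normalised to have one coefficient equal to `1`, minus its Galois
conjugate, is a shorter relation. By induction all coefficients are then Galois-fixed, so the
relation is already one over `F`. -/
theorem linearIndependent_of_invariant {ι : Type*} {v : ι → V} (hv : ∀ i, v i ∈ ρ.invariants)
    (h : LinearIndependent F v) : LinearIndependent L v := by
  classical
  rw [linearIndependent_iff']
  intro s
  induction s using Finset.induction_on with
  | empty => simp
  | insert a s has ih =>
    have key : ∀ g : ι → L, ∑ i ∈ insert a s, g i • v i = 0 → g a = 0 := by
      intro g hg
      by_contra ha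
      -- The coefficient of `v a` is made `1`, so this term cancels on subtracting the
      -- `σ`-conjugate, and the induction hypothesis applies on `s`.
      have hg' : v a + ∑ i ∈ s, (g a)⁻¹ • g i • v i = 0 := by
        rw [Finset.sum_insert has] at hg
        rw [← Finset.smul_sum, ← inv_smul_smul₀ ha (v a), ← smul_add, hg, smul_zero]
      have hσ : ∀ σ : Gal(L/F), ∀ i ∈ s, σ ((g a)⁻¹ * g i) = (g a)⁻¹ * g i := by
        intro σ i hi
        have h1 := congrArg (ρ σ) hg'
        simp only [map_add, map_sum, smul_smul, ρ.map_smul', map_zero, (hv _) σ] at h1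
        simp only [smul_smul] at hg'
        have h2 : ∑ i ∈ s, (σ ((g a)⁻¹ * g i) - (g a)⁻¹ * g i) • v i = 0 := by
          simp only [sub_smul, Finset.sum_sub_distrib]
          rw [← add_sub_add_left_eq_sub _ _ (v a), h1, hg', sub_zero]
        exact sub_eq_zero.1 (ih _ h2 i hi)
      have hF : ∀ i, ∃ r : F, i ∈ s → algebraMap F L r = (g a)⁻¹ * g i := by
        intro i
        by_cases hi : i ∈ s
        · obtain ⟨r, hr⟩ := (InfiniteGalois.mem_range_algebraMap_iff_fixed _).2
            fun σ => hσ σ i hi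
          exact ⟨r, fun _ => hr⟩
        · exact ⟨0, fun h => absurd h hi⟩
      choose r hr using hF
      have h3 : ∑ i ∈ insert a s, (if i = a then 1 else r i) • v i = 0 := by
        rw [Finset.sum_insert has, if_pos rfl, one_smul, ← hg']
        congr 1
        refine Finset.sum_congr rfl fun i hi => ?_
        rw [if_neg (show i ≠ a by rintro rfl; exact has hi), ← algebraMap_smul L (r i), hr i hi, smul_smul]
      have h4 := linearIndependent_iff'.1 h _ _ h3 a (Finset.mem_insert_self _ _)
      simp at h4
    intro g hg i hi
    have ha := key g hg
    rw [Finset.sum_insert has, ha, zero_smul, zero_add] at hg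
    rcases Finset.mem_insert.1 hi with rfl | hi
    · exact ha
    · exact ih g hg i hi

/-- The stabilizer of a vector. -/
def stabilizer (v : V) : Subgroup Gal(L/F) where
  carrier := {σ | ρ σ v = v}
  mul_mem' {σ τ} hσ hτ := by
    change ρ _ v = v
    rw [ρ.map_mul', hτ, hσ]
  one_mem' := ρ.map_one v
  inv_mem' {σ} hσ := by
    change ρ _ v = v
    have hσ' : ρ σ v = v := hσ
    rw [← hσ', ← ρ.map_mul', inv_mul_cancel, ρ.map_one, hσ']

/-- If a functional `f` kills all invariants but not `v`, it kills the traces of `a • v` for every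
`a` in the fixed field of the open stabilizer of `v`. This is a linear relation among distinct
characters of that field with coefficients `f (ρ_q v)`, and Dedekind's independence of characters
forces `f v = 0`. -/
theorem span_invariants : Submodule.span L (ρ.invariants : Set V) = ⊤ := by
  classical
  rw [eq_top_iff]
  intro v _
  by_contra hv
  obtain ⟨f, hfv, hf⟩ := Submodule.exists_le_ker_of_notMem hv
  let U := ρ.stabilizer v
  have hU : IsOpen (U : Set Gal(L/F)) := Subgroup.isOpen_of_mem_nhds U (ρ.eventually_fixed v)
  have : Finite (Gal(L/F) ⧸ U) := Subgroup.quotient_finite_of_isOpen U hU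
  have : Fintype (Gal(L/F) ⧸ U) := Fintype.ofFinite _
  let K := IntermediateField.fixedField U
  have hK : K.fixingSubgroup = U :=
    InfiniteGalois.fixingSubgroup_fixedField ⟨U, Subgroup.isClosed_of_isOpen U hU⟩
  let w : K → V := fun a => ∑ q : Gal(L/F) ⧸ U, ρ q.out ((a : L) • v)
  have hout : ∀ (a : K) (σ τ : Gal(L/F)), (σ : Gal(L/F) ⧸ U) = τ →
      ρ σ ((a : L) • v) = ρ τ ((a : L) • v) := by
    intro a σ τ h
    have hu : σ⁻¹ * τ ∈ U := QuotientGroup.eq.1 h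
    have h1 : ρ (σ⁻¹ * τ) v = v := hu
    have h2 : (σ⁻¹ * τ) (a : L) = a := a.2 ⟨_, hu⟩
    conv_rhs => rw [← mul_inv_cancel_left σ τ, ρ.map_mul', ρ.map_smul' (σ⁻¹ * τ), h1, h2]
  have hw : ∀ a, w a ∈ ρ.invariants := by
    intro a τ
    simp only [w, map_sum, ← ρ.map_mul']
    refine Fintype.sum_equiv (MulAction.toPerm τ) _ _ fun q => hout _ _ _ ?_
    rw [MulAction.toPerm_apply, QuotientGroup.out_eq']
    conv_rhs => rw [← QuotientGroup.out_eq' q]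
    rfl
  let χ : Gal(L/F) ⧸ U → K →* L := fun q => ((q.out : Gal(L/F)) : L →* L).comp (K.val : K →* L)
  have hχ : Function.Injective χ := by
    intro q q' h
    rw [← QuotientGroup.out_eq' q, ← QuotientGroup.out_eq' q', QuotientGroup.eq]
    refine hK.le ((IntermediateField.mem_fixingSubgroup_iff _ _).2 ?_)
    intro a ha
    have := DFunLike.congr_fun h ⟨a, ha⟩
    change q.out a = q'.out a at this
    change q.out⁻¹ (q'.out a) = a
    rw [← this]
    exact q.out.symm_apply_apply a
  have hli := (linearIndependent_monoidHom K L).comp χ hχ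
  have h0 : ∑ q, f (ρ q.out v) • (χ q : K → L) = 0 := by
    funext a
    have h1 : f (w a) = 0 := hf (Submodule.subset_span (hw a))
    simp only [w, map_sum, ρ.map_smul', map_smul] at h1
    simp only [Finset.sum_apply, Pi.smul_apply, smul_eq_mul, Pi.zero_apply]
    rw [← h1]
    exact Finset.sum_congr rfl fun q _ => mul_comm _ _
  have h2 := Fintype.linearIndependent_iff.1 hli _ h0 (QuotientGroup.mk 1)
  apply hfv
  rw [← h2]
  -- The chosen representative of the trivial coset need not be `1`, but it lies in `U` and so fixes
  -- `v`.
  have h3 : (QuotientGroup.mk 1 : Gal(L/F) ⧸ U).out ∈ U := by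
    have := QuotientGroup.eq.1 ((QuotientGroup.out_eq' (QuotientGroup.mk 1 : Gal(L/F) ⧸ U)).symm)
    simpa using this
  exact congrArg f (show ρ _ v = v from h3).symm

/-- An `F`-basis of the invariants is an `L`-basis of the whole space. -/
def basisOfInvariants {ι : Type*} (b : Module.Basis ι F ρ.invariants) : Module.Basis ι L V :=
  Module.Basis.mk (v := fun i => (b i : V))
    (ρ.linearIndependent_of_invariant (fun i => (b i).2)
      (b.linearIndependent.map' ρ.invariants.subtype (Submodule.ker_subtype _)))
    (by
      rw [← ρ.span_invariants, Submodule.span_le]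
      intro v hv
      have h := congrArg ρ.invariants.subtype (b.linearCombination_repr ⟨v, hv⟩)
      rw [Finsupp.linearCombination_apply, Finsupp.sum, map_sum] at h
      change _ = v at h
      rw [← h]
      refine Submodule.sum_mem _ fun i _ => ?_
      rw [map_smul, ← algebraMap_smul L]
      exact Submodule.smul_mem _ _ (Submodule.subset_span ⟨i, rfl⟩))

theorem basisOfInvariants_apply {ι : Type*} (b : Module.Basis ι F ρ.invariants) (i : ι) :
    ρ.basisOfInvariants b i = b i := by simp [basisOfInvariants]

theorem finrank_invariants : Module.finrank F ρ.invariants = Module.finrank L V := by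
  let b := Module.Basis.ofVectorSpace F ρ.invariants
  rw [Module.finrank_eq_nat_card_basis b, Module.finrank_eq_nat_card_basis (ρ.basisOfInvariants b)]

theorem finite_invariants [Module.Finite L V] : Module.Finite F ρ.invariants := by
  let b := Module.Basis.ofVectorSpace F ρ.invariants
  have := Module.Finite.finite_basis (ρ.basisOfInvariants b)
  exact Module.Finite.of_basis b

end SemilinearAction

theorem eventually_apply_eq [Algebra.IsIntegral F L] (a : L) :
    ∀ᶠ σ : Gal(L/F) in 𝓝 1, σ a = a :=
  (stabilizer_isOpen_of_isIntegral a).mem_nhds (one_mem (MulAction.stabilizer _ a))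

end Descent

end TorusBrauer
end

noncomputable section
namespace TorusBrauer

/-! ### Forms of algebras over an extension field -/

section Forms

variable {F L S R : Type*} [Field F] [Field L] [Algebra F L] [Ring S] [Algebra F S]
  [Ring R] [Algebra F R] [Algebra L R] [IsScalarTower F L R]

variable (L) in
/-- The `L`-linear extension `L ⊗ S → R` of a homomorphism `S → R`. -/
def extendScalars (f : S →ₐ[F] R) : L ⊗[F] S →ₐ[L] R :=
  Algebra.TensorProduct.lift (Algebra.ofId L R) f fun a _ => Algebra.commutes a _

theorem extendScalars_tmul (f : S →ₐ[F] R) (a : L) (s : S) :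
    extendScalars L f (a ⊗ₜ s) = a • f s := by
  rw [Algebra.smul_def]
  exact Algebra.TensorProduct.lift_tmul _ _ _ _ _

variable (L) in
/-- The homomorphism `f` makes `S` an `F`-form of the `L`-algebra `R`. -/
def IsForm (f : S →ₐ[F] R) : Prop := Function.Bijective (extendScalars L f)

theorem range_extendScalars (f : S →ₐ[F] R) :
    LinearMap.range (extendScalars L f).toLinearMap = Submodule.span L (Set.range f) := by
  refine le_antisymm ?_ (Submodule.span_le.2 ?_)
  · rintro _ ⟨z, rfl⟩
    induction z with
    | zero => simp
    | add x y hx hy => rw [map_add]; exact Submodule.add_mem _ hx hy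
    | tmul a s =>
      change extendScalars L f (a ⊗ₜ s) ∈ Submodule.span L (Set.range f)
      rw [extendScalars_tmul]
      exact Submodule.smul_mem _ _ (Submodule.subset_span ⟨s, rfl⟩)
  · rintro _ ⟨s, rfl⟩
    exact ⟨1 ⊗ₜ s, by simp [extendScalars_tmul]⟩

theorem isForm_of_span [Module.Finite F S] (f : S →ₐ[F] R)
    (hf : Submodule.span L (Set.range f) = ⊤) (hd : Module.finrank F S = Module.finrank L R) :
    IsForm L f := by
  have hs : Function.Surjective (extendScalars L f).toLinearMap := by
    rw [← LinearMap.range_eq_top, range_extendScalars, hf]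
  have : Module.Finite L R := Module.Finite.of_surjective _ hs
  exact ⟨(LinearMap.injective_iff_surjective_of_finrank_eq_finrank
    (by rw [Module.finrank_baseChange, hd])).2 hs, hs⟩

namespace IsForm

variable {f : S →ₐ[F] R} (hf : IsForm L f)

include hf

theorem span_range : Submodule.span L (Set.range f) = ⊤ := by
  rw [← range_extendScalars, LinearMap.range_eq_top]
  exact hf.2

theorem finrank_eq : Module.finrank F S = Module.finrank L R := by
  rw [← Module.finrank_baseChange (R := L) (M' := S)]
  exact (LinearEquiv.ofBijective (extendScalars L f).toLinearMap hf).finrank_eq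

theorem injective : Function.Injective f := by
  intro s s' h
  have heq : (1 : L) ⊗ₜ[F] s = 1 ⊗ₜ s' := hf.1 (by simp [extendScalars_tmul, h])
  exact Algebra.TensorProduct.includeRight_injective (FaithfulSMul.algebraMap_injective F L) heq

/-- The isomorphism `L ⊗ S ≃ R` attached to a form. -/
def algEquiv : L ⊗[F] S ≃ₐ[L] R := AlgEquiv.ofBijective _ hf

theorem algEquiv_tmul (s : S) (a : L) : hf.algEquiv (a ⊗ₜ s) = a • f s := extendScalars_tmul f a s

/-- An `F`-basis of a form is an `L`-basis. -/
def basis {κ : Type*} (b : Module.Basis κ F S) : Module.Basis κ L R :=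
  (Algebra.TensorProduct.basis L b).map hf.algEquiv.toLinearEquiv

theorem basis_apply {κ : Type*} (b : Module.Basis κ F S) (i : κ) : hf.basis b i = f (b i) := by
  simp [basis, algEquiv_tmul]

theorem comp_algEquiv {R' : Type*} [Ring R'] [Algebra F R'] [Algebra L R'] [IsScalarTower F L R']
    (e : R ≃ₐ[L] R') : IsForm L ((e.restrictScalars F : R →ₐ[F] R').comp f) := by
  have : ⇑(extendScalars L ((e.restrictScalars F : R →ₐ[F] R').comp f)) =
      e ∘ extendScalars L f := by
    have h : extendScalars L ((e.restrictScalars F : R →ₐ[F] R').comp f) =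
      (e : R →ₐ[L] R').comp (extendScalars L f) := by
      ext s
      simp [extendScalars_tmul]
    rw [h]; rfl
  rw [IsForm, this]
  exact e.bijective.comp hf

theorem comp_algEquiv_left {S' : Type*} [Ring S'] [Algebra F S'] (e : S' ≃ₐ[F] S) :
    IsForm L (f.comp (e : S' →ₐ[F] S)) := by
  have : ⇑(extendScalars L (f.comp (e : S' →ₐ[F] S))) = extendScalars L f ∘
      (Algebra.TensorProduct.congr (AlgEquiv.refl (R := L) (A₁ := L)) e) := by
    have h : extendScalars L (f.comp (e : S' →ₐ[F] S)) = (extendScalars L f).comp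
      (Algebra.TensorProduct.congr (AlgEquiv.refl (R := L) (A₁ := L)) e : _ →ₐ[L] _) := by
      ext s
      simp [extendScalars_tmul]
    rw [h]; rfl
  rw [IsForm, this]
  exact hf.comp (AlgEquiv.bijective _)

/-- For a proper ideal `I`, the map `L ⊗ S → L ⊗ (S/I)` goes from a simple ring to a nonzero ring.
It is therefore injective, which forces `I = 0`. -/
theorem isSimpleRing [IsSimpleRing R] : IsSimpleRing S := by
  have hT : IsSimpleRing (L ⊗[F] S) := IsSimpleRing.of_ringEquiv hf.algEquiv.symm.toRingEquiv ‹_›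
  have : Nontrivial S := by
    by_contra h
    rw [not_nontrivial_iff_subsingleton] at h
    exact one_ne_zero (α := L ⊗[F] S) (by
      rw [Algebra.TensorProduct.one_def, Subsingleton.elim (1 : S) 0, TensorProduct.tmul_zero])
  refine IsSimpleRing.of_eq_bot_or_eq_top fun I => ?_
  by_cases hI : I = ⊤
  · exact Or.inr hI
  left
  have hQ : Nontrivial I.ringCon.Quotient := by
    refine ⟨0, 1, fun h => hI ?_⟩
    rw [eq_top_iff]
    intro s _
    have h1 : I.ringCon 0 1 := (RingCon.eq _).1 h
    have h2 : (1 : S) ∈ I := (TwoSidedIdeal.mem_iff _ _).2 (I.ringCon.symm h1)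
    simpa using I.mul_mem_left s 1 h2
  let q : S →ₐ[F] I.ringCon.Quotient := I.ringCon.mkₐ F
  let Q : L ⊗[F] S →ₐ[L] L ⊗[F] I.ringCon.Quotient :=
    Algebra.TensorProduct.map (AlgHom.id L L) q
  have hN : Nontrivial (L ⊗[F] I.ringCon.Quotient) :=
    (Algebra.TensorProduct.includeRight_injective (B := I.ringCon.Quotient)
      (FaithfulSMul.algebraMap_injective F L)).nontrivial
  have hi : Function.Injective Q.toRingHom := RingHom.injective _
  rw [eq_bot_iff]
  intro s hs
  have h0 : q s = 0 := (RingCon.eq _).2 ((TwoSidedIdeal.mem_iff _ _).1 hs)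
  have h1 : (1 : L) ⊗ₜ[F] s = 0 := hi (by
    change Q _ = Q _
    simp [Q, h0])
  have h2 : s = 0 := Algebra.TensorProduct.includeRight_injective
    (FaithfulSMul.algebraMap_injective F L) (by simpa using h1)
  simp [h2]

/-- A central element commutes with the span of the form, so its image is a scalar `a` of `L`. It
remains to see that `a` lies in `F`. -/
theorem isCentral [Algebra.IsCentral L R] : Algebra.IsCentral F S := by
  refine ⟨fun z hz => ?_⟩
  have hc : f z ∈ Subalgebra.center L R := by
    rw [Subalgebra.mem_center_iff]
    intro r
    have hr : r ∈ Submodule.span L (Set.range f) := hf.span_range ▸ Submodule.mem_top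
    induction hr using Submodule.span_induction with
    | mem x hx =>
      obtain ⟨s, rfl⟩ := hx
      rw [← map_mul, ← map_mul, Subalgebra.mem_center_iff.1 hz]
    | zero => simp
    | add x y _ _ hx hy => rw [add_mul, mul_add, hx, hy]
    | smul a x _ hx => rw [smul_mul_assoc, mul_smul_comm, hx]
  obtain ⟨a, ha⟩ := (Algebra.IsCentral.mem_center_iff L).1 hc
  by_cases hS : Nontrivial S
  · have h1 : a ⊗ₜ[F] (1 : S) = 1 ⊗ₜ z := hf.1 (by
      rw [extendScalars_tmul, extendScalars_tmul, ha, map_one, one_smul, Algebra.smul_def, mul_one])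
    -- Applying `id ⊗ φ` with `φ 1 = 1` to `a ⊗ 1 = 1 ⊗ z` gives `a = φ z`.
    obtain ⟨φ, hφ⟩ := Module.Projective.exists_dual_eq_one F (one_ne_zero (α := S))
    have h2 := congrArg (TensorProduct.rid F L ∘ LinearMap.lTensor L φ) h1
    simp only [Function.comp_apply, LinearMap.lTensor_tmul, TensorProduct.rid_tmul, hφ,
      one_smul] at h2
    refine ⟨φ z, hf.injective ?_⟩
    change f (algebraMap F S (φ z)) = f z
    rw [ha, h2, AlgHom.commutes, ← Algebra.algebraMap_eq_smul_one, ← IsScalarTower.algebraMap_apply]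
  · rw [not_nontrivial_iff_subsingleton] at hS
    rw [Subsingleton.elim z 0]; exact zero_mem _

end IsForm

end Forms

end TorusBrauer
end

noncomputable section
namespace TorusBrauer

/-! ### Forms of matrix algebras -/

section MatrixForms

open Topology Matrix
open scoped Kronecker

variable {F L S : Type*} [Field F] [Field L] [Algebra F L] [Ring S] [Algebra F S]
  {ι κ : Type*} [Fintype ι] [DecidableEq ι] [Fintype κ] [DecidableEq κ]

theorem isForm_matrix_of_span [Module.Finite F S] (f : S →ₐ[F] Matrix ι ι L)
    (hf : Submodule.span L (Set.range f) = ⊤) (hd : Module.finrank F S = Fintype.card ι ^ 2) :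
    IsForm L f :=
  isForm_of_span f hf (by rw [hd, Module.finrank_matrix, Module.finrank_self, mul_one, sq])

theorem IsForm.finrank_matrix {f : S →ₐ[F] Matrix ι ι L} (hf : IsForm L f) :
    Module.finrank F S = Fintype.card ι ^ 2 := by
  rw [hf.finrank_eq, Module.finrank_matrix, Module.finrank_self, mul_one, sq]

/-- An isomorphism of matrix algebras over a field is a conjugation. -/
theorem exists_conj_of_algEquiv (e : Matrix κ κ L ≃ₐ[L] Matrix ι ι L) :
    ∃ (P : Matrix ι κ L) (Q : Matrix κ ι L), P * Q = 1 ∧ Q * P = 1 ∧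
      ∀ M, e M * P = P * M := by
  -- Skolem–Noether in the form for endomorphism algebras of vector spaces; the linear equivalence
  -- and its inverse supply the two matrices.
  let e' : Module.End L (κ → L) ≃ₐ[L] Module.End L (ι → L) :=
    (Matrix.toLinAlgEquiv' (R := L) (n := κ)).symm.trans
      (e.trans (Matrix.toLinAlgEquiv' (R := L) (n := ι)))
  obtain ⟨T, hT⟩ := e'.eq_linearEquivConjAlgEquiv
  refine ⟨LinearMap.toMatrix' T.toLinearMap, LinearMap.toMatrix' T.symm.toLinearMap, ?_, ?_, ?_⟩
  · rw [← LinearMap.toMatrix'_comp]; simp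
  · rw [← LinearMap.toMatrix'_comp]; simp
  · intro M
    have h := DFunLike.congr_fun hT (Matrix.toLin' M)
    have h1 : e' (Matrix.toLin' M) = Matrix.toLin' (e M) := by
      change Matrix.toLin' (e (LinearMap.toMatrix' (Matrix.toLin' M))) = _
      rw [LinearMap.toMatrix'_toLin']
    rw [h1] at h
    apply Matrix.toLin'.injective
    rw [Matrix.toLin'_mul, Matrix.toLin'_mul, h, Matrix.toLin'_toMatrix']
    ext1 x
    ext1
    simp [LinearEquiv.conjAlgEquiv_apply]

/-- Two embeddings of a form in matrix algebras are conjugate. -/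
theorem IsForm.exists_conj {f : S →ₐ[F] Matrix ι ι L} (hf : IsForm L f)
    {g : S →ₐ[F] Matrix κ κ L} (hg : IsForm L g) :
    ∃ (P : Matrix ι κ L) (Q : Matrix κ ι L), P * Q = 1 ∧ Q * P = 1 ∧ ∀ s, f s * P = P * g s := by
  obtain ⟨P, Q, h1, h2, h⟩ := exists_conj_of_algEquiv (hg.algEquiv.symm.trans hf.algEquiv)
  refine ⟨P, Q, h1, h2, fun s => ?_⟩
  have h3 : hg.algEquiv (1 ⊗ₜ s) = g s := by rw [hg.algEquiv_tmul, one_smul]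
  rw [← h, AlgEquiv.trans_apply, ← h3, AlgEquiv.symm_apply_apply, hf.algEquiv_tmul, one_smul]

/-- Schur's lemma for forms: commuting with `f` means commuting with its `L`-span, the whole matrix
algebra. Most scalars below (multipliers, factor sets, the functions `u`) come from it. -/
theorem IsForm.exists_scalar {f : S →ₐ[F] Matrix ι ι L} (hf : IsForm L f) {M : Matrix ι ι L}
    (hM : ∀ s, f s * M = M * f s) : ∃ a : L, M = a • 1 := by
  have hc : M ∈ Subalgebra.center L (Matrix ι ι L) := by
    rw [Subalgebra.mem_center_iff]
    intro r
    have hr : r ∈ Submodule.span L (Set.range f) := hf.span_range ▸ Submodule.mem_top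
    induction hr using Submodule.span_induction with
    | mem x hx => obtain ⟨s, rfl⟩ := hx; exact hM s
    | zero => simp
    | add x y _ _ hx hy => rw [add_mul, mul_add, hx, hy]
    | smul a x _ hx => rw [smul_mul_assoc, mul_smul_comm, hx]
  obtain ⟨a, ha⟩ := (Algebra.IsCentral.mem_center_iff L).1 hc
  exact ⟨a, by rw [ha, Algebra.algebraMap_eq_smul_one]⟩

theorem IsForm.mapMatrix {R : Type*} [Ring R] [Algebra F R] [Algebra L R] [IsScalarTower F L R]
    [Module.Finite F S] {f : S →ₐ[F] R} (hf : IsForm L f) : IsForm L (f.mapMatrix (m := κ)) := by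
  refine isForm_of_span _ ?_ ?_
  · rw [eq_top_iff]
    intro M _
    rw [Matrix.matrix_eq_sum_single M]
    refine Submodule.sum_mem _ fun i _ => Submodule.sum_mem _ fun j _ => ?_
    have hr : M i j ∈ Submodule.span L (Set.range f) := hf.span_range ▸ Submodule.mem_top
    generalize M i j = r at hr
    induction hr using Submodule.span_induction with
    | mem x hx =>
      obtain ⟨s, rfl⟩ := hx
      refine Submodule.subset_span ⟨Matrix.single i j s, ?_⟩
      simp [Matrix.map_single]
    | zero => simp
    | add x y _ _ hx hy => rw [Matrix.single_add]; exact Submodule.add_mem _ hx hy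
    | smul a x _ hx => rw [← Matrix.smul_single]; exact Submodule.smul_mem _ _ hx
  · rw [Module.finrank_matrix, Module.finrank_matrix, hf.finrank_eq]

/-- The form of a matrix algebra over a form of a matrix algebra. -/
def matrixComp (κ : Type*) [Fintype κ] [DecidableEq κ] (f : S →ₐ[F] Matrix ι ι L) :
    Matrix κ κ S →ₐ[F] Matrix (κ × ι) (κ × ι) L :=
  (((Matrix.compAlgEquiv κ ι L L).restrictScalars F :
    Matrix κ κ (Matrix ι ι L) ≃ₐ[F] Matrix (κ × ι) (κ × ι) L) :
      Matrix κ κ (Matrix ι ι L) →ₐ[F] Matrix (κ × ι) (κ × ι) L).comp f.mapMatrix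

theorem matrixComp_apply (f : S →ₐ[F] Matrix ι ι L) (M : Matrix κ κ S) (x y : κ × ι) :
    matrixComp κ f M x y = f (M x.1 y.1) x.2 y.2 := rfl

theorem IsForm.matrixComp [Module.Finite F S] {f : S →ₐ[F] Matrix ι ι L} (hf : IsForm L f) :
    IsForm L (matrixComp κ f) :=
  hf.mapMatrix.comp_algEquiv _

/-- The form of the opposite algebra by transposition. -/
def transposeHom (f : S →ₐ[F] Matrix ι ι L) : Sᵐᵒᵖ →ₐ[F] Matrix ι ι L where
  toFun s := (f s.unop)ᵀ
  map_one' := by simp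
  map_mul' s s' := by simp
  map_zero' := by simp
  map_add' s s' := by simp
  commutes' r := by
    rw [MulOpposite.algebraMap_apply, MulOpposite.unop_op, AlgHom.commutes]
    ext i j
    simp [Matrix.algebraMap_matrix_apply, eq_comm]

theorem transposeHom_apply (f : S →ₐ[F] Matrix ι ι L) (s : Sᵐᵒᵖ) :
    transposeHom f s = (f s.unop)ᵀ := rfl

theorem IsForm.transposeHom [Module.Finite F S] {f : S →ₐ[F] Matrix ι ι L} (hf : IsForm L f) :
    IsForm L (transposeHom f) := by
  refine isForm_matrix_of_span _ ?_ ?_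
  · have h := congrArg (Submodule.map (Matrix.transposeLinearEquiv ι ι L L).toLinearMap)
      hf.span_range
    rw [Submodule.map_span, Submodule.map_top, LinearEquiv.range] at h
    rw [← h]
    congr 1
    ext M
    constructor
    · rintro ⟨s, rfl⟩
      exact ⟨_, ⟨s.unop, rfl⟩, rfl⟩
    · rintro ⟨_, ⟨s, rfl⟩, rfl⟩
      exact ⟨MulOpposite.op s, rfl⟩
  · rw [← hf.finrank_matrix]
    exact (MulOpposite.opLinearEquiv F (M := S)).symm.finrank_eq

/-- The tensor product of two representations, by Kronecker products. -/
def kroneckerHom {S' : Type*} [Ring S'] [Algebra F S'] (f : S →ₐ[F] Matrix ι ι L)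
    (g : S' →ₐ[F] Matrix κ κ L) : S ⊗[F] S' →ₐ[F] Matrix (ι × κ) (ι × κ) L :=
  Algebra.TensorProduct.lift
    { toFun := fun s => f s ⊗ₖ (1 : Matrix κ κ L)
      map_one' := by simp
      map_mul' := fun s s' => by rw [map_mul, ← Matrix.mul_kronecker_mul, one_mul]
      map_zero' := by simp
      map_add' := fun s s' => by rw [map_add, Matrix.add_kronecker]
      commutes' := fun r => by
        rw [AlgHom.commutes, Algebra.algebraMap_eq_smul_one, Matrix.smul_kronecker,
          Matrix.one_kronecker_one, Algebra.algebraMap_eq_smul_one] }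
    { toFun := fun s => (1 : Matrix ι ι L) ⊗ₖ g s
      map_one' := by simp
      map_mul' := fun s s' => by rw [map_mul, ← Matrix.mul_kronecker_mul, one_mul]
      map_zero' := by simp
      map_add' := fun s s' => by rw [map_add, Matrix.kronecker_add]
      commutes' := fun r => by
        rw [AlgHom.commutes, Algebra.algebraMap_eq_smul_one, Matrix.kronecker_smul,
          Matrix.one_kronecker_one, Algebra.algebraMap_eq_smul_one] }
    (fun s s' => by
      change (f s ⊗ₖ (1 : Matrix κ κ L)) * ((1 : Matrix ι ι L) ⊗ₖ g s') =
        ((1 : Matrix ι ι L) ⊗ₖ g s') * (f s ⊗ₖ (1 : Matrix κ κ L))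
      rw [← Matrix.mul_kronecker_mul, ← Matrix.mul_kronecker_mul]
      simp)

theorem kroneckerHom_tmul {S' : Type*} [Ring S'] [Algebra F S'] (f : S →ₐ[F] Matrix ι ι L)
    (g : S' →ₐ[F] Matrix κ κ L) (s : S) (s' : S') :
    kroneckerHom f g (s ⊗ₜ s') = f s ⊗ₖ g s' := by
  rw [kroneckerHom, Algebra.TensorProduct.lift_tmul]
  change (f s ⊗ₖ (1 : Matrix κ κ L)) * ((1 : Matrix ι ι L) ⊗ₖ g s') = _
  rw [← Matrix.mul_kronecker_mul]
  simp

theorem IsForm.kroneckerHom {S' : Type*} [Ring S'] [Algebra F S'] [Module.Finite F S]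
    [Module.Finite F S'] {f : S →ₐ[F] Matrix ι ι L} (hf : IsForm L f)
    {g : S' →ₐ[F] Matrix κ κ L} (hg : IsForm L g) : IsForm L (kroneckerHom f g) := by
  refine isForm_matrix_of_span _ ?_ ?_
  · have key : ∀ (M : Matrix ι ι L) (N : Matrix κ κ L),
        M ⊗ₖ N ∈ Submodule.span L (Set.range (TorusBrauer.kroneckerHom f g)) := by
      intro M N
      have hM : M ∈ Submodule.span L (Set.range f) := hf.span_range ▸ Submodule.mem_top
      have hN : N ∈ Submodule.span L (Set.range g) := hg.span_range ▸ Submodule.mem_top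
      induction hM using Submodule.span_induction with
      | mem x hx =>
        obtain ⟨s, rfl⟩ := hx
        induction hN using Submodule.span_induction with
        | mem x hx =>
          obtain ⟨s', rfl⟩ := hx
          exact Submodule.subset_span ⟨s ⊗ₜ s', kroneckerHom_tmul f g s s'⟩
        | zero => rw [Matrix.kronecker_zero]; exact zero_mem _
        | add x y _ _ hx hy => rw [Matrix.kronecker_add]; exact Submodule.add_mem _ hx hy
        | smul a x _ hx => rw [Matrix.kronecker_smul]; exact Submodule.smul_mem _ _ hx
      | zero => rw [Matrix.zero_kronecker]; exact zero_mem _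
      | add x y _ _ hx hy => rw [Matrix.add_kronecker]; exact Submodule.add_mem _ hx hy
      | smul a x _ hx => rw [Matrix.smul_kronecker]; exact Submodule.smul_mem _ _ hx
    rw [eq_top_iff]
    intro M _
    rw [Matrix.matrix_eq_sum_single M]
    refine Submodule.sum_mem _ fun i _ => Submodule.sum_mem _ fun j _ => ?_
    have := key (Matrix.single i.1 j.1 (M i j)) (Matrix.single i.2 j.2 1)
    rwa [Matrix.single_kronecker_single, mul_one] at this
  · rw [Module.finrank_tensorProduct, hf.finrank_matrix, hg.finrank_matrix, Fintype.card_prod,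
      mul_pow]

/-! #### Tensor powers -/

/-- The Kronecker product of a family of matrices. -/
def piKronecker (F : Type*) [Field F] [Algebra F L] (ι : Type*) (m : ℕ) :
    MultilinearMap F (fun _ : Fin m => Matrix ι ι L) (Matrix (Fin m → ι) (Fin m → ι) L) :=
  MultilinearMap.pi fun x => MultilinearMap.pi fun y =>
    (MultilinearMap.mkPiAlgebra F (Fin m) L).compLinearMap fun i =>
      Matrix.entryLinearMap F L (x i) (y i)

omit [Fintype ι] [DecidableEq ι] in
theorem piKronecker_apply (m : ℕ) (M : Fin m → Matrix ι ι L) (x y : Fin m → ι) :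
    piKronecker F ι m M x y = ∏ i, M i (x i) (y i) := rfl

omit [Fintype ι] in
theorem piKronecker_one (m : ℕ) : piKronecker F ι m (1 : Fin m → Matrix ι ι L) = 1 := by
  ext x y
  rw [piKronecker_apply]
  by_cases h : x = y
  · subst h; simp
  · rw [Matrix.one_apply_ne h]
    obtain ⟨i, hi⟩ := Function.ne_iff.1 h
    exact Finset.prod_eq_zero (Finset.mem_univ i) (Matrix.one_apply_ne hi)

omit [DecidableEq ι] in
theorem piKronecker_mul (m : ℕ) (M N : Fin m → Matrix ι ι L) :
    piKronecker F ι m (M * N) = piKronecker F ι m M * piKronecker F ι m N := by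
  ext x y
  simp only [piKronecker_apply, Matrix.mul_apply, Pi.mul_apply, ← Finset.prod_mul_distrib]
  rw [Finset.prod_univ_sum, Fintype.piFinset_univ]

/-- The tensor power of a representation. -/
def piKroneckerHom (m : ℕ) (f : S →ₐ[F] Matrix ι ι L) :
    (⨂[F] _ : Fin m, S) →ₐ[F] Matrix (Fin m → ι) (Fin m → ι) L :=
  PiTensorProduct.liftAlgHom ((piKronecker F ι m).compLinearMap fun _ => f.toLinearMap)
    (by
      rw [← piKronecker_one (F := F) m]
      change piKronecker F ι m (fun i => f 1) = _
      rw [map_one]; rfl)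
    (fun s s' => by
      change piKronecker F ι m (fun i => f (s i * s' i)) =
        piKronecker F ι m (fun i => f (s i)) * piKronecker F ι m (fun i => f (s' i))
      rw [← piKronecker_mul]
      congr 1
      ext1 i
      exact map_mul f _ _)

theorem piKroneckerHom_tprod (m : ℕ) (f : S →ₐ[F] Matrix ι ι L) (s : Fin m → S) :
    piKroneckerHom m f (PiTensorProduct.tprod F s) = piKronecker F ι m fun i => f (s i) := by
  rw [piKroneckerHom, PiTensorProduct.liftAlgHom_apply, PiTensorProduct.lift.tprod]; rfl

/-- A matrix unit of the big algebra is a Kronecker product of matrix units. Each factor expands in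
the `L`-basis coming from `S`, and multilinearity over `L` puts the product in the span of the
images of pure tensors. The scalars are in `L`, which is why `piKronecker L` appears. -/
theorem IsForm.piKroneckerHom [Module.Finite F S] {f : S →ₐ[F] Matrix ι ι L} (hf : IsForm L f)
    (m : ℕ) : IsForm L (piKroneckerHom m f) := by
  let b := Module.finBasis F S
  refine isForm_matrix_of_span _ ?_ ?_
  · rw [eq_top_iff]
    intro M _
    rw [Matrix.matrix_eq_sum_single M]
    refine Submodule.sum_mem _ fun x _ => Submodule.sum_mem _ fun y _ => ?_
    have h1 : Matrix.single x y (M x y) =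
        M x y • piKronecker L ι m (fun i => Matrix.single (x i) (y i) 1) := by
      ext x' y'
      rw [Matrix.smul_apply, piKronecker_apply, Matrix.single_apply]
      split_ifs with h
      · obtain ⟨rfl, rfl⟩ := h
        simp
      · by_cases hx : x = x'
        · have hy : y ≠ y' := fun hy => h ⟨hx, hy⟩
          obtain ⟨i, hi⟩ := Function.ne_iff.1 hy
          rw [Finset.prod_eq_zero (Finset.mem_univ i), smul_zero]
          rw [Matrix.single_apply, if_neg fun h => hi h.2]
        · obtain ⟨i, hi⟩ := Function.ne_iff.1 hx
          rw [Finset.prod_eq_zero (Finset.mem_univ i), smul_zero]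
          rw [Matrix.single_apply, if_neg fun h => hi h.1]
    rw [h1]
    refine Submodule.smul_mem _ _ ?_
    have h2 : (fun i => Matrix.single (x i) (y i) (1 : L)) = fun i =>
        ∑ j, (hf.basis b).repr (Matrix.single (x i) (y i) (1 : L)) j • f (b j) := by
      ext1 i
      conv_lhs => rw [← (hf.basis b).sum_repr (Matrix.single (x i) (y i) (1 : L))]
      simp only [hf.basis_apply]
    rw [h2, MultilinearMap.map_sum]
    refine Submodule.sum_mem _ fun r _ => ?_
    rw [MultilinearMap.map_smul_univ]
    refine Submodule.smul_mem _ _ (Submodule.subset_span ⟨PiTensorProduct.tprod F fun i => b (r i), ?_⟩)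
    rw [piKroneckerHom_tprod]; rfl
  · rw [Module.finrank_eq_card_basis (Basis.piTensorProduct fun _ : Fin m => b)]
    simp only [Fintype.card_pi, Finset.prod_const, Fintype.card_fin, Finset.card_univ]
    rw [hf.finrank_matrix, ← pow_mul, ← pow_mul, mul_comm]

end MatrixForms

end TorusBrauer
end

noncomputable section
namespace TorusBrauer

/-! ### Hilbert 90 and splitting -/

section Hilbert

open Topology Matrix

variable {F L : Type*} [Field F] [Field L] [Algebra F L] [IsGalois F L]
  {ι : Type*} [Fintype ι]

omit [IsGalois F L] in
theorem map_galois_mul {κ μ : Type*} (σ : Gal(L/F)) (A : Matrix κ ι L) (B : Matrix ι μ L) :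
    (A * B).map σ = A.map σ * B.map σ := Matrix.map_mul (f := (σ : L →+* L))

omit [IsGalois F L] [Fintype ι] in
theorem map_galois_one [DecidableEq ι] (σ : Gal(L/F)) : (1 : Matrix ι ι L).map σ = 1 :=
  Matrix.map_one _ (map_zero _) (map_one _)

theorem eventually_comp_eq {Y : Type*} [Finite Y] (v : Y → L) :
    ∀ᶠ σ : Gal(L/F) in 𝓝 1, ∀ y, σ (v y) = v y :=
  Filter.eventually_all.2 fun y => eventually_apply_eq (v y)

/-- Galois descent for algebras: the invariants span over `L` and have the right dimension. -/
theorem isForm_val_of_invariants {R : Type*} [Ring R] [Algebra F R] [Algebra L R]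
    [IsScalarTower F L R] [Module.Finite L R] (ρ : SemilinearAction F L R) (S : Subalgebra F R)
    (h : ∀ r, r ∈ S ↔ ∀ σ, ρ σ r = r) : Module.Finite F S ∧ IsForm L S.val := by
  have hS : Subalgebra.toSubmodule S = ρ.invariants := Submodule.ext h
  have hfin : Module.Finite F (Subalgebra.toSubmodule S) := by
    rw [hS]; exact ρ.finite_invariants
  have hfin' : Module.Finite F S := hfin
  refine ⟨hfin', isForm_of_span _ ?_ ?_⟩
  · rw [← ρ.span_invariants, ← hS]
    congr 1
    exact Subtype.range_coe
  · change Module.finrank F (Subalgebra.toSubmodule S) = _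
    rw [hS, ρ.finrank_invariants]

/-- The semilinear action attached to a matrix cocycle. -/
def matrixAction [DecidableEq ι] (p : Gal(L/F) → Matrix ι ι L)
    (hmul : ∀ σ τ, p (σ * τ) = p σ * (p τ).map σ) (hp : ∀ᶠ σ in 𝓝 1, p σ = 1) :
    SemilinearAction F L (ι → L) where
  toFun σ :=
    { toFun := fun v => p σ *ᵥ (σ ∘ v)
      map_zero' := by
        rw [show (σ ∘ (0 : ι → L)) = 0 by ext; simp, Matrix.mulVec_zero]
      map_add' := fun v w => by
        rw [← Matrix.mulVec_add]; congr 1; ext; simp }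
  map_smul' σ a v := by
    change p σ *ᵥ (σ ∘ (a • v)) = σ a • (p σ *ᵥ (σ ∘ v))
    rw [← Matrix.mulVec_smul]; congr 1; ext; simp
  map_mul' σ τ v := by
    change p (σ * τ) *ᵥ ((σ * τ) ∘ v) = p σ *ᵥ (σ ∘ (p τ *ᵥ (τ ∘ v)))
    rw [hmul, ← Matrix.mulVec_mulVec]
    congr 1
    ext i
    simp [Matrix.mulVec, dotProduct]
  eventually_fixed v := by
    filter_upwards [hp, eventually_comp_eq v] with σ h1 h2
    change p σ *ᵥ (σ ∘ v) = v
    rw [h1, Matrix.one_mulVec]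
    exact funext h2

theorem matrixAction_apply [DecidableEq ι] (p : Gal(L/F) → Matrix ι ι L)
    (hmul : ∀ σ τ, p (σ * τ) = p σ * (p τ).map σ) (hp : ∀ᶠ σ in 𝓝 1, p σ = 1) (σ : Gal(L/F))
    (v : ι → L) : matrixAction p hmul hp σ v = p σ *ᵥ (σ ∘ v) := rfl

/-- Hilbert's theorem 90 for the general linear group. -/
theorem exists_eq_coboundary [DecidableEq ι] (p : Gal(L/F) → Matrix ι ι L)
    (hmul : ∀ σ τ, p (σ * τ) = p σ * (p τ).map σ) (hp : ∀ᶠ σ in 𝓝 1, p σ = 1) :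
    ∃ N N' : Matrix ι ι L, N * N' = 1 ∧ N' * N = 1 ∧ ∀ σ, p σ * N.map σ = N := by
  let ρ := matrixAction p hmul hp
  have := ρ.finite_invariants
  let b : Module.Basis ι F ρ.invariants := (Module.finBasisOfFinrankEq F ρ.invariants
    (n := Fintype.card ι) (by rw [ρ.finrank_invariants, Module.finrank_fintype_fun_eq_card])).reindex
      (Fintype.equivFin ι).symm
  let B := ρ.basisOfInvariants b
  -- The columns of `N` are an `F`-basis of the invariant vectors of the twisted action on `L^ι`;
  -- their invariance is the required identity.
  refine ⟨(Pi.basisFun L ι).toMatrix B, B.toMatrix (Pi.basisFun L ι),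
    Module.Basis.toMatrix_mul_toMatrix_flip _ _, Module.Basis.toMatrix_mul_toMatrix_flip _ _,
    fun σ => ?_⟩
  ext i j
  have h : ρ σ (B j) = B j := by
    have := (b j).2 σ
    rwa [← ρ.basisOfInvariants_apply b] at this
  have hi := congrFun h i
  rw [matrixAction_apply] at hi
  simpa [Matrix.mul_apply, Matrix.mulVec, dotProduct, Module.Basis.toMatrix_apply] using hi

/-- A form on which the Galois action is conjugation by a cocycle is split. -/
theorem isSplit_of_cocycle [DecidableEq ι] [Nonempty ι] {S : Type*} [Ring S] [Algebra F S]
    [Module.Finite F S] {f : S →ₐ[F] Matrix ι ι L} (hf : IsForm L f) (p : Gal(L/F) → Matrix ι ι L)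
    (hmul : ∀ σ τ, p (σ * τ) = p σ * (p τ).map σ) (hp : ∀ᶠ σ in 𝓝 1, p σ = 1)
    (h : ∀ σ s, p σ * (f s).map σ = f s * p σ) : IsSplit F S := by
  obtain ⟨N, N', h1, h2, hN⟩ := exists_eq_coboundary p hmul hp
  -- After conjugation by the matrix of Hilbert 90 the image of `S` is fixed entrywise by the Galois
  -- group. Hence it lies in matrices over `F`, and equality of dimensions gives all of them.
  let g : S →ₐ[F] Matrix ι ι L :=
    { toFun := fun s => N' * f s * N
      map_one' := by rw [map_one, mul_one, h2]
      map_mul' := fun s s' => by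
        rw [map_mul]
        calc N' * (f s * f s') * N = N' * f s * 1 * f s' * N := by simp only [mul_assoc, one_mul]
          _ = _ := by rw [← h1]; simp only [mul_assoc]
      map_zero' := by simp
      map_add' := fun s s' => by rw [map_add, mul_add, add_mul]
      commutes' := fun r => by
        rw [AlgHom.commutes, Algebra.algebraMap_eq_smul_one, mul_smul_comm, smul_mul_assoc,
          mul_one, h2] }
  have hg : ∀ (σ : Gal(L/F)) s, (g s).map σ = g s := by
    intro σ s
    change (N' * f s * N).map σ = N' * f s * N
    have h3 : p σ = N * N'.map σ := by
      rw [← hN σ, mul_assoc, ← map_galois_mul, h1, map_galois_one, mul_one]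
    have h4 := h σ s
    rw [h3] at h4
    calc (N' * f s * N).map σ = (N' * N) * N'.map σ * (f s).map σ * N.map σ := by
          rw [h2, one_mul, map_galois_mul, map_galois_mul]
      _ = N' * (N * N'.map σ * (f s).map σ) * N.map σ := by simp only [mul_assoc]
      _ = N' * f s * N * (N' * N).map σ := by rw [h4, map_galois_mul]; simp only [mul_assoc]
      _ = _ := by rw [h2, map_galois_one, mul_one]
  let j : Matrix ι ι F →ₐ[F] Matrix ι ι L := (Algebra.ofId F L).mapMatrix
  have hj : Function.Injective j := by
    intro A B hAB
    ext x y
    exact FaithfulSMul.algebraMap_injective F L (congrFun (congrFun hAB x) y)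
  have hmem : ∀ s, g s ∈ j.range := by
    intro s
    have : ∀ x y, ∃ r : F, algebraMap F L r = g s x y := fun x y =>
      (InfiniteGalois.mem_range_algebraMap_iff_fixed _).2 fun σ =>
        congrFun (congrFun (hg σ s) x) y
    choose r hr using this
    exact ⟨Matrix.of r, Matrix.ext hr⟩
  let k : S →ₐ[F] Matrix ι ι F :=
    ((AlgEquiv.ofInjective j hj).symm : j.range →ₐ[F] _).comp (g.codRestrict j.range hmem)
  have hk : Function.Injective k := by
    intro s s' hs
    have h3 := congrArg Subtype.val ((AlgEquiv.ofInjective j hj).symm.injective hs)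
    change N' * f s * N = N' * f s' * N at h3
    apply hf.injective
    calc f s = (N * N') * f s * (N * N') := by rw [h1, one_mul, mul_one]
      _ = N * (N' * f s * N) * N' := by simp only [mul_assoc]
      _ = (N * N') * f s' * (N * N') := by rw [h3]; simp only [mul_assoc]
      _ = f s' := by rw [h1, one_mul, mul_one]
  have hd : Module.finrank F S = Module.finrank F (Matrix ι ι F) := by
    rw [hf.finrank_matrix, Module.finrank_matrix, Module.finrank_self, mul_one, sq]
  have hb : Function.Bijective k :=
    ⟨hk, (LinearMap.injective_iff_surjective_of_finrank_eq_finrank (f := k.toLinearMap) hd).1 hk⟩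
  exact ⟨Fintype.card ι, Fintype.card_ne_zero, ⟨(AlgEquiv.ofBijective k hb).trans
    (Matrix.reindexAlgEquiv F F (Fintype.equivFin ι))⟩⟩

end Hilbert

/-! ### Monomial actions -/

section Monomial

open Topology Matrix

variable {L : Type*} [Field L] {G Y : Type*} [Group G] [MulAction G Y] [DecidableEq Y]

/-- The product of the diagonal matrix of `w` and the permutation matrix of `g`. -/
def monomialMatrix (w : Y → L) (g : G) : Matrix Y Y L :=
  Matrix.of fun x y => if y = g⁻¹ • x then w x else 0

theorem monomialMatrix_apply (w : Y → L) (g : G) (x y : Y) :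
    monomialMatrix w g x y = if y = g⁻¹ • x then w x else 0 := rfl

theorem monomialMatrix_one : monomialMatrix (1 : Y → L) (1 : G) = 1 := by
  ext x y
  simp [monomialMatrix_apply, Matrix.one_apply, eq_comm]

theorem map_monomialMatrix {L' : Type*} [Field L'] (σ : L →+* L') (w : Y → L) (g : G) :
    (monomialMatrix w g).map σ = monomialMatrix (σ ∘ w) g := by
  ext x y
  simp only [Matrix.map_apply, monomialMatrix_apply, Function.comp_apply]
  split_ifs <;> simp

variable [Fintype Y]

theorem monomialMatrix_mulVec (w : Y → L) (g : G) (v : Y → L) (x : Y) :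
    (monomialMatrix w g *ᵥ v) x = w x * v (g⁻¹ • x) := by
  simp [Matrix.mulVec, dotProduct, monomialMatrix_apply]

theorem monomialMatrix_mul_apply {Z : Type*} (w : Y → L) (g : G) (M : Matrix Y Z L) (x : Y)
    (z : Z) : (monomialMatrix w g * M) x z = w x * M (g⁻¹ • x) z := by
  simp [Matrix.mul_apply, monomialMatrix_apply]

theorem mul_monomialMatrix_apply {Z : Type*} (w : Y → L) (g : G) (M : Matrix Z Y L) (z : Z)
    (x : Y) : (M * monomialMatrix w g) z x = M z (g • x) * w (g • x) := by
  simp [Matrix.mul_apply, monomialMatrix_apply, eq_inv_smul_iff, eq_comm]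

theorem monomialMatrix_mul (w w' : Y → L) (g g' : G) :
    monomialMatrix w g * monomialMatrix w' g' =
      monomialMatrix (fun x => w x * w' (g⁻¹ • x)) (g * g') := by
  ext x y
  rw [monomialMatrix_mul_apply, monomialMatrix_apply, monomialMatrix_apply, _root_.mul_inv_rev, mul_smul]
  split_ifs <;> simp

variable {F : Type*} [Field F] [Algebra F L] [IsGalois F L] (γ : Gal(L/F) →* G)

/-- The semilinear action `v ↦ (x ↦ w_σ(x) σ(v(γ_σ⁻¹ x)))`. -/
def monomialAction (hγ : ∀ᶠ σ in 𝓝 1, γ σ = 1) (w : Gal(L/F) → Y → L)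
    (hmul : ∀ σ τ y, w (σ * τ) y = w σ y * σ (w τ ((γ σ)⁻¹ • y))) (hw : ∀ᶠ σ in 𝓝 1, w σ = 1) :
    SemilinearAction F L (Y → L) :=
  matrixAction (fun σ => monomialMatrix (w σ) (γ σ))
    (fun σ τ => by
      have h := map_monomialMatrix (σ : L →+* L) (w τ) (γ τ)
      erw [h]
      rw [monomialMatrix_mul, map_mul]
      congr 1
      funext y
      exact hmul σ τ y)
    (hγ.mp (hw.mono fun σ h2 h1 => by rw [h1, h2, monomialMatrix_one]))

theorem monomialAction_apply (hγ : ∀ᶠ σ in 𝓝 1, γ σ = 1) (w : Gal(L/F) → Y → L)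
    (hmul : ∀ σ τ y, w (σ * τ) y = w σ y * σ (w τ ((γ σ)⁻¹ • y))) (hw : ∀ᶠ σ in 𝓝 1, w σ = 1)
    (σ : Gal(L/F)) (v : Y → L) (x : Y) :
    monomialAction γ hγ w hmul hw σ v x = w σ x * σ (v ((γ σ)⁻¹ • x)) := by
  exact monomialMatrix_mulVec _ _ _ _

-- Choices made pointwise on `Y` become Galois-equivariant once they are made at `rep y`.
omit [DecidableEq Y] [Fintype Y] [IsGalois F L] in
theorem exists_orbit_rep : ∃ rep : Y → Y, (∀ σ y, rep (γ σ • y) = rep y) ∧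
    ∀ y, ∃ σ, γ σ • rep y = y := by
  let s := MulAction.orbitRel γ.range Y
  refine ⟨fun y => (Quotient.mk s y).out, fun σ y => ?_, fun y => ?_⟩
  · have : (Quotient.mk s (γ σ • y)) = Quotient.mk s y :=
      Quotient.sound ⟨⟨γ σ, σ, rfl⟩, rfl⟩
    simp only [this]
  · have h : s y (Quotient.mk s y).out := s.symm (Quotient.mk_out y)
    obtain ⟨⟨_, σ, rfl⟩, hg⟩ := h
    exact ⟨σ, hg⟩

/-- Hilbert's theorem 90 for the units of a twisted form of `L^Y`. -/
theorem exists_invariant_unit (hγ : ∀ᶠ σ in 𝓝 1, γ σ = 1) (w : Gal(L/F) → Y → L)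
    (hw0 : ∀ σ y, w σ y ≠ 0)
    (hmul : ∀ σ τ y, w (σ * τ) y = w σ y * σ (w τ ((γ σ)⁻¹ • y))) (hw : ∀ᶠ σ in 𝓝 1, w σ = 1) :
    ∃ D : Y → L, (∀ y, D y ≠ 0) ∧ ∀ σ y, w σ y * σ (D ((γ σ)⁻¹ • y)) = D y := by
  let ρ := monomialAction γ hγ w hmul hw
  -- The invariants span `L^Y`, so no coordinate vanishes on all of them.
  have h1 : ∀ y, ∃ v ∈ ρ.invariants, v y ≠ 0 := by
    intro y
    by_contra! h
    have h2 : Submodule.span L (ρ.invariants : Set (Y → L)) ≤ LinearMap.ker (LinearMap.proj y) :=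
      Submodule.span_le.2 h
    rw [ρ.span_invariants] at h2
    have h3 : (1 : Y → L) y = 0 := h2 (Submodule.mem_top (x := (1 : Y → L)))
    exact one_ne_zero h3
  choose v hv hv0 using h1
  have hv' : ∀ z σ y, w σ y * σ (v z ((γ σ)⁻¹ • y)) = v z y := fun z σ y => by
    rw [← monomialAction_apply γ hγ w hmul hw]
    exact congrFun (hv z σ) y
  obtain ⟨rep, hrep, hrep'⟩ := exists_orbit_rep (Y := Y) γ
  -- On each Galois orbit, `D` is an invariant vector that is nonzero at the orbit's representative;
  -- invariance carries the nonvanishing along the orbit. No single invariant vector has to be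
  -- nonzero everywhere.
  refine ⟨fun y => v (rep y) y, fun y => ?_, fun σ y => ?_⟩
  · obtain ⟨σ, hσ⟩ := hrep' y
    beta_reduce
    rw [← hv' (rep y) σ y]
    have : (γ σ)⁻¹ • y = rep y := by rw [inv_smul_eq_iff, hσ]
    rw [this]
    exact mul_ne_zero (hw0 σ y) (by simpa using hv0 (rep y))
  · have : rep ((γ σ)⁻¹ • y) = rep y := by rw [← map_inv, hrep]
    beta_reduce
    rw [this, hv']

omit [DecidableEq Y] [Fintype Y] [IsGalois F L] in
variable (Y) in
/-- The form of `L^Y` twisted by `γ`. -/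
def twistFun : Subalgebra F (Y → L) where
  carrier := {φ | ∀ (σ : Gal(L/F)) (y : Y), φ (γ σ • y) = σ (φ y)}
  mul_mem' := fun {f f'} hf hf' σ h => by simp [hf σ h, hf' σ h]
  add_mem' := fun {f f'} hf hf' σ h => by simp [hf σ h, hf' σ h]
  algebraMap_mem' r σ h := by simp

theorem twistFun_isForm (hγ : ∀ᶠ σ in 𝓝 1, γ σ = 1) :
    Module.Finite F (twistFun Y γ) ∧ IsForm L (twistFun Y γ).val := by
  refine isForm_val_of_invariants (monomialAction γ hγ (fun _ => 1) (by simp) (by simp)) _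
    fun v => ?_
  simp only [funext_iff, monomialAction_apply, Pi.one_apply, one_mul]
  constructor
  · intro hv σ x
    rw [← hv, smul_inv_smul]
  · intro hv σ x
    rw [← hv σ, inv_smul_smul]

theorem finrank_twistFun (hγ : ∀ᶠ σ in 𝓝 1, γ σ = 1) :
    Module.finrank F (twistFun Y γ) = Fintype.card Y := by
  rw [(twistFun_isForm γ hγ).2.finrank_eq, Module.finrank_fintype_fun_eq_card]

end Monomial

end TorusBrauer
end

noncomputable section
namespace TorusBrauer

/-! ### Galois algebras and homomorphisms of the Galois group -/

section GaloisAlgebraTwist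

open Topology

/-! ### Transitivity of the group on the points of a Galois algebra. -/

section Transitive

variable {F L E G : Type*} [Field F] [Field L] [Algebra F L] [CommRing E] [Algebra F E]
  [Group G] [MulSemiringAction G E] [SMulCommClass G F E]

/-- The action of `G` on `L ⊗ E` through `E`. -/
@[reducible]
def tensorAction : MulSemiringAction G (L ⊗[F] E) where
  smul g z := Algebra.TensorProduct.map (AlgHom.id L L) (MulSemiringAction.toAlgHom F E g) z
  one_smul z := by
    change Algebra.TensorProduct.map (AlgHom.id L L) (MulSemiringAction.toAlgHom F E (1 : G)) z = z
    rw [show MulSemiringAction.toAlgHom F E (1 : G) = AlgHom.id F E by ext x; simp]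
    simp
  mul_smul g h z := by
    change Algebra.TensorProduct.map (AlgHom.id L L) (MulSemiringAction.toAlgHom F E (g * h)) z =
      Algebra.TensorProduct.map (AlgHom.id L L) (MulSemiringAction.toAlgHom F E g)
        (Algebra.TensorProduct.map (AlgHom.id L L) (MulSemiringAction.toAlgHom F E h) z)
    induction z with
    | zero => simp
    | add x y hx hy => simp only [map_add, hx, hy]
    | tmul a x => simp [mul_smul]
  smul_zero g := map_zero _
  smul_add g := map_add _
  smul_one g := map_one _
  smul_mul g := map_mul _

attribute [local instance] tensorAction

theorem smul_tmul_eq (g : G) (a : L) (x : E) : g • (a ⊗ₜ[F] x) = a ⊗ₜ (g • x) := rfl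

/-- In an `F`-basis of `L` the group acts on the coefficients alone, so an invariant tensor has
coefficients in `F`. -/
theorem isInvariant_tensor [Algebra.IsInvariant F E G] :
    Algebra.IsInvariant L (L ⊗[F] E) G where
  isInvariant z hz := by
    classical
    let b := Module.Basis.ofVectorSpace F L
    let e := TensorProduct.equivFinsuppOfBasisLeft (N := E) b
    have he : ∀ (g : G) (z : L ⊗[F] E) i, e (g • z) i = g • e z i := by
      intro g z i
      induction z with
      | zero => simp
      | add x y hx hy => simp only [smul_add, map_add, Finsupp.add_apply, hx, hy]
      | tmul a x => simp [e, smul_tmul_eq, smul_comm g]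
    have h1 : ∀ i, ∃ r : F, algebraMap F E r = e z i := fun i =>
      Algebra.IsInvariant.isInvariant (G := G) (e z i) fun g => by rw [← he, hz]
    choose r hr using h1
    have h2 : z = ∑ i ∈ (e z).support, b i ⊗ₜ[F] e z i := by
      conv_lhs => rw [← e.symm_apply_apply z]
      rw [TensorProduct.equivFinsuppOfBasisLeft_symm_apply]
      rfl
    refine ⟨∑ i ∈ (e z).support, r i • b i, ?_⟩
    conv_rhs => rw [h2]
    rw [map_sum]
    refine Finset.sum_congr rfl fun i _ => ?_
    rw [← hr, Algebra.TensorProduct.algebraMap_apply, Algebra.algebraMap_self_apply,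
      TensorProduct.smul_tmul, Algebra.algebraMap_eq_smul_one]

/-- A homomorphism `E → L` is determined by the kernel of its extension to `L ⊗ E`, a prime over the
zero ideal of `L`. The group `G` permutes the primes over a given prime transitively. -/
theorem exists_smul_algHom [Finite G] [Algebra.IsInvariant F E G] (φ ψ : E →ₐ[F] L) :
    ∃ g : G, ∀ x, ψ x = φ (g • x) := by
  have := isInvariant_tensor (F := F) (L := L) (E := E) (G := G)
  have : SMulCommClass G L (L ⊗[F] E) := ⟨fun g a z => map_smul
    (Algebra.TensorProduct.map (AlgHom.id L L) (MulSemiringAction.toAlgHom F E g)) a z⟩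
  let P := RingHom.ker (extendScalars L φ)
  let Q := RingHom.ker (extendScalars L ψ)
  have hP : P.IsPrime := RingHom.ker_isPrime _
  have hQ : Q.IsPrime := RingHom.ker_isPrime _
  obtain ⟨g, hg⟩ := Algebra.IsInvariant.exists_smul_of_under_eq L (L ⊗[F] E) G P Q (by
    ext a
    simp [P, Q, Ideal.mem_comap, extendScalars_tmul])
  refine ⟨g⁻¹, fun x => ?_⟩
  have h1 : (1 : L) ⊗ₜ[F] x - algebraMap L _ (ψ x) ∈ Q := by
    simp [Q, RingHom.mem_ker, extendScalars_tmul]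
  rw [hg, Ideal.mem_pointwise_smul_iff_inv_smul_mem, smul_sub] at h1
  have h2 : g⁻¹ • algebraMap L (L ⊗[F] E) (ψ x) = algebraMap L (L ⊗[F] E) (ψ x) :=
    AlgHom.commutes _ _
  rw [h2] at h1
  have h3 : extendScalars L φ _ = 0 := h1
  rw [map_sub, AlgHom.commutes, smul_tmul_eq, extendScalars_tmul, one_smul, sub_eq_zero] at h3
  exact h3.symm

end Transitive

/-! ### Counting the points of an étale algebra over a separably closed field. -/

section Etale

variable {F L E : Type u} [Field F] [Field L] [Algebra F L] [IsSepClosed L] [CommRing E]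
  [Algebra F E] [Algebra.Etale F E]

/-- The homomorphisms `E → L` attached to the points of `L ⊗ E`. -/
def pointHom (p : PrimeSpectrum (L ⊗[F] E)) : E →ₐ[F] L :=
  (((Pi.evalAlgHom L (fun _ => L) p).comp
    (Algebra.FormallyEtale.equivPiOfIsSepClosed L (L ⊗[F] E)).toAlgHom).restrictScalars F).comp
      Algebra.TensorProduct.includeRight

/-- `L ⊗ E` is a product of copies of `L`, and each projection restricts to a homomorphism `E → L`.
-/
theorem eq_zero_of_algHom (x : E) (h : ∀ φ : E →ₐ[F] L, φ x = 0) : x = 0 := by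
  let e := Algebra.FormallyEtale.equivPiOfIsSepClosed L (L ⊗[F] E)
  have h1 : e (1 ⊗ₜ x) = 0 := funext fun p => h (pointHom p)
  have h2 : (1 : L) ⊗ₜ[F] x = 0 := e.injective (by rw [h1, map_zero])
  exact Algebra.TensorProduct.includeRight_injective
    (FaithfulSMul.algebraMap_injective F L) (by simpa using h2)

theorem pointHom_injective : Function.Injective (pointHom (F := F) (L := L) (E := E)) := by
  classical
  intro p q h
  let e := Algebra.FormallyEtale.equivPiOfIsSepClosed L (L ⊗[F] E)
  have h1 : (Pi.evalAlgHom L (fun _ => L) p).comp e.toAlgHom =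
      (Pi.evalAlgHom L (fun _ => L) q).comp e.toAlgHom := by
    refine Algebra.TensorProduct.ext (by ext) ?_
    exact h
  by_contra hpq
  have h2 := DFunLike.congr_fun h1 (e.symm (Pi.single p 1))
  simp [Pi.single_eq_of_ne (Ne.symm hpq)] at h2

theorem card_primeSpectrum_tensor :
    Nat.card (PrimeSpectrum (L ⊗[F] E)) = Module.finrank F E := by
  let e := Algebra.FormallyEtale.equivPiOfIsSepClosed L (L ⊗[F] E)
  have : Module.Finite F E := Algebra.FormallyUnramified.finite_of_free F E
  have : IsArtinianRing (L ⊗[F] E) := isArtinian_of_tower L inferInstance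
  have : Fintype (PrimeSpectrum (L ⊗[F] E)) := Fintype.ofFinite _
  rw [← Module.finrank_baseChange (R := L), e.toLinearEquiv.finrank_eq,
    Module.finrank_fintype_fun_eq_card, Nat.card_eq_fintype_card]

/-- The points form a torsor: transitivity gives surjectivity, and the `dim E = |G|` factors of `L ⊗
E` give at least `|G|` distinct points. -/
theorem bijective_smul_algHom {G : Type*} [Group G] [Finite G] [MulSemiringAction G E]
    [SMulCommClass G F E] [Algebra.IsInvariant F E G] (hE : Module.finrank F E = Nat.card G)
    (φ : E →ₐ[F] L) :
    Function.Bijective fun g : G => φ.comp (MulSemiringAction.toAlgHom F E g) := by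
  have hs : Function.Surjective fun g : G => φ.comp (MulSemiringAction.toAlgHom F E g) := by
    intro ψ
    obtain ⟨g, hg⟩ := exists_smul_algHom (G := G) φ ψ
    exact ⟨g, AlgHom.ext fun x => (hg x).symm⟩
  have : Finite (E →ₐ[F] L) := Finite.of_surjective _ hs
  have h1 := Nat.card_le_card_of_injective _ (pointHom_injective (F := F) (L := L) (E := E))
  rw [card_primeSpectrum_tensor, hE] at h1
  exact (Nat.bijective_iff_surjective_and_card _).2
    ⟨hs, le_antisymm h1 (Nat.card_le_card_of_surjective _ hs)⟩

end Etale

end GaloisAlgebraTwist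

end TorusBrauer
end

noncomputable section
namespace TorusBrauer

/-! ### The correspondence between Galois algebras and continuous homomorphisms to `G`. -/

section GaloisAlgebraOfHom

open Topology

variable {F L : Type u} [Field F] [Field L] [Algebra F L] [IsGalois F L]
  {G : Type} [Group G] [Finite G]

/-- The action of `G` on the twisted form of `L^G` by right translations. -/
instance twistFunAction (γ : Gal(L/F) →* G) : MulSemiringAction G (twistFun G γ) where
  smul g f := ⟨fun h => f.1 (h * g), fun σ h => by
    have := f.2 σ (h * g)
    rwa [smul_eq_mul, ← mul_assoc] at this⟩
  one_smul f := Subtype.ext (funext fun h => congrArg f.1 (mul_one h))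
  mul_smul g g' f := Subtype.ext (funext fun h => congrArg f.1 (mul_assoc h g g').symm)
  smul_zero g := rfl
  smul_add g f f' := rfl
  smul_one g := rfl
  smul_mul g f f' := rfl

omit [IsGalois F L] [Finite G] in
theorem twistFun_smul_apply (γ : Gal(L/F) →* G) (g h : G) (f : twistFun G γ) :
    (g • f).1 h = f.1 (h * g) := rfl

/-- The Galois `G`-algebra attached to a continuous homomorphism `Gal(L/F) → G`. -/
def galoisAlgebraOfHom (γ : Gal(L/F) →* G) (hγ : ∀ᶠ σ in 𝓝 1, γ σ = 1) : GaloisAlgebra G F :=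
  haveI := Fintype.ofFinite G
  haveI := Classical.decEq G
  { carrier := twistFun G γ
    smulComm := ⟨fun g r f => rfl⟩
    -- Over `L` the algebra becomes `L^G`, and étaleness descends along the faithfully flat
    -- extension `L/F`.
    etale := by
      have : Algebra.Etale L (L ⊗[F] twistFun G γ) :=
        Algebra.Etale.of_equiv (twistFun_isForm γ hγ).2.algEquiv.symm
      exact Algebra.Etale.of_etale_tensorProduct_of_faithfullyFlat L
    finrank_eq := by rw [finrank_twistFun γ hγ, Nat.card_eq_fintype_card]
    invariant := by
      refine ⟨fun f hf => ?_⟩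
      have h1 : ∀ h, f.1 h = f.1 1 := fun h => by
        have := congrArg (fun f : twistFun G γ => f.1 1) (hf h)
        simpa [twistFun_smul_apply] using this
      -- A `G`-invariant function is constant; comparing its values at `1` and at `γ σ` shows that
      -- this constant is Galois-fixed.
      obtain ⟨r, hr⟩ := (InfiniteGalois.mem_range_algebraMap_iff_fixed (k := F) (f.1 1)).2
        fun σ => by rw [← f.2 σ 1, h1]
      refine ⟨r, Subtype.ext (funext fun h => ?_)⟩
      rw [h1 h, ← hr]
      rfl }

-- The twisted form spans `L^Y` over `L`, so it separates the points of `Y`.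
omit [Finite G] in
theorem eq_of_twistFun {Y : Type*} [Finite Y] [MulAction G Y] (γ : Gal(L/F) →* G)
    (hγ : ∀ᶠ σ in 𝓝 1, γ σ = 1) {y y' : Y} (h : ∀ f : twistFun Y γ, f.1 y = f.1 y') : y = y' := by
  classical
  have := Fintype.ofFinite Y
  by_contra hy
  have h1 : Submodule.span L (Set.range (twistFun Y γ).val) ≤
      LinearMap.ker (LinearMap.proj (R := L) (φ := fun _ => L) y - LinearMap.proj y') := by
    rw [Submodule.span_le]
    rintro _ ⟨f, rfl⟩
    exact sub_eq_zero.2 (h f)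
  rw [(twistFun_isForm γ hγ).2.span_range] at h1
  have h2 := h1 (Submodule.mem_top (x := Pi.single y (1 : L)))
  simp [Pi.single_eq_of_ne (Ne.symm hy)] at h2

/-- Evaluation at `1`, taken before and after `e`, gives two points of the same Galois algebra. They
differ by some `g`, hence `e` is `f ↦ f(g ·)`, and `g` conjugates one homomorphism into the other.
-/
theorem isConj_of_twistFun_equiv [IsSepClosed L] (γ γ' : Gal(L/F) →* G)
    (hγ : ∀ᶠ σ in 𝓝 1, γ σ = 1) (e : twistFun G γ ≃ₐ[F] twistFun G γ')
    (he : ∀ (g : G) x, e (g • x) = g • e x) :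
    ∃ g : G, ∀ σ, γ' σ = g⁻¹ * γ σ * g := by
  classical
  have := Fintype.ofFinite G
  let E := galoisAlgebraOfHom γ hγ
  have : Algebra.IsInvariant F (twistFun G γ) G := E.invariant
  have : SMulCommClass G F (twistFun G γ) := E.smulComm
  let ev : twistFun G γ →ₐ[F] L := (Pi.evalAlgHom F (fun _ => L) 1).comp (twistFun G γ).val
  let ev' : twistFun G γ →ₐ[F] L :=
    ((Pi.evalAlgHom F (fun _ => L) 1).comp (twistFun G γ').val).comp e.toAlgHom
  obtain ⟨g, hg⟩ := exists_smul_algHom (G := G) ev ev'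
  have h1 : ∀ (f : twistFun G γ) h, (e f).1 h = f.1 (g * h) := by
    intro f h
    have h2 : (e (h • f)).1 1 = (h • f).1 (1 * g) := by
      have := hg (h • f)
      exact this
    rw [he, twistFun_smul_apply, twistFun_smul_apply, one_mul, one_mul] at h2
    exact h2
  refine ⟨g, fun σ => ?_⟩
  -- Both sides are compared through all `f`: `f(g γ'_σ) = (e f)(γ'_σ) = σ((e f)(1)) = σ(f(g)) =
  -- f(γ_σ g)`.
  have h2 : g * γ' σ = γ σ * g := by
    refine eq_of_twistFun γ hγ fun f => ?_
    rw [← h1]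
    have h3 := (e f).2 σ 1
    rw [smul_eq_mul, mul_one, h1 f 1, mul_one, ← f.2 σ] at h3
    exact h3
  rw [mul_assoc, ← h2, inv_mul_cancel_left]

/-- Fix a point `φ : E → L`. Since the points form a torsor, `σ ∘ φ = φ ∘ γ_σ` defines `γ`, and `x ↦
(h ↦ φ(h x))` is the isomorphism. It is injective because points separate elements, and the
dimensions agree. -/
theorem exists_equiv_twistFun [IsSepClosed L] (E : GaloisAlgebra G F) :
    ∃ (γ : Gal(L/F) →* G) (_ : ∀ᶠ σ in 𝓝 1, γ σ = 1) (e : E ≃ₐ[F] twistFun G γ),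
      ∀ (g : G) (x : E) (h : G), (e (g • x)).1 h = (e x).1 (h * g) := by
  classical
  have := Fintype.ofFinite G
  have hfin : Module.Finite F E := Algebra.FormallyUnramified.finite_of_free F E
  obtain ⟨φ⟩ : Nonempty (E →ₐ[F] L) := by
    have h1 : 0 < Nat.card (PrimeSpectrum (L ⊗[F] E)) := by
      rw [card_primeSpectrum_tensor, E.finrank_eq]
      exact Nat.card_pos
    obtain ⟨p⟩ := (Nat.card_pos_iff.1 h1).1
    exact ⟨pointHom p⟩
  have hφ := bijective_smul_algHom (L := L) E.finrank_eq φ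
  have hφ' : ∀ {g h : G}, (∀ x, φ (g • x) = φ (h • x)) → g = h := fun h =>
    hφ.1 (AlgHom.ext h)
  have h1 : ∀ σ : Gal(L/F), ∃ g : G, ∀ x, φ (g • x) = σ (φ x) := fun σ => by
    obtain ⟨g, hg⟩ := hφ.2 (σ.toAlgHom.comp φ)
    exact ⟨g, fun x => DFunLike.congr_fun hg x⟩
  choose γ hγ using h1
  let γ' : Gal(L/F) →* G :=
    { toFun := γ
      map_one' := hφ' fun x => by rw [hγ, one_smul]; rfl
      map_mul' := fun σ τ => hφ' fun x => by rw [hγ, mul_smul, hγ, hγ]; rfl }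
  have hγ' : ∀ᶠ σ in 𝓝 1, γ' σ = 1 := by
    let b := Module.finBasis F E
    filter_upwards [eventually_comp_eq (F := F) fun i => φ (b i)] with σ hσ
    have h2 : (σ.toAlgHom.comp φ).toLinearMap = φ.toLinearMap := b.ext hσ
    refine hφ' fun x => ?_
    rw [one_smul]
    exact (hγ σ x).trans (LinearMap.congr_fun h2 x)
  let k : E →ₐ[F] twistFun G γ' :=
    { toFun := fun x => ⟨fun h => φ (h • x), fun σ h => by
        change φ ((γ σ * h) • x) = σ (φ (h • x))
        rw [mul_smul, hγ]⟩
      map_one' := by ext h; simp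
      map_mul' := fun x y => by ext h; simp
      map_zero' := by ext h; simp
      map_add' := fun x y => by ext h; simp
      commutes' := fun r => by
        ext h
        change φ (h • algebraMap F E r) = algebraMap F L r
        rw [smul_algebraMap, AlgHom.commutes] }
  have hk : Function.Injective k := by
    rw [injective_iff_map_eq_zero]
    intro x hx
    refine eq_zero_of_algHom (F := F) (L := L) x fun ψ => ?_
    obtain ⟨g, rfl⟩ := hφ.2 ψ
    exact congrArg (fun f : twistFun G γ' => f.1 g) hx
  have hfin' := (twistFun_isForm (Y := G) γ' hγ').1
  have hb : Function.Bijective k :=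
    ⟨hk, (LinearMap.injective_iff_surjective_of_finrank_eq_finrank (f := k.toLinearMap)
      (by rw [E.finrank_eq, finrank_twistFun γ' hγ', Nat.card_eq_fintype_card])).1 hk⟩
  refine ⟨γ', hγ', AlgEquiv.ofBijective k hb, fun g x h => ?_⟩
  change φ (h • g • x) = φ ((h * g) • x)
  rw [mul_smul]

/-- `Map_G(Y, E)` for the Galois algebra `E` attached to `γ` is the form of `L^Y` twisted by `γ`. -/
def assocAlgebraTwistEquiv (Y : Type v) [MulAction G Y] (γ : Gal(L/F) →* G)
    (hγ : ∀ᶠ σ in 𝓝 1, γ σ = 1) :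
    assocAlgebra Y (galoisAlgebraOfHom γ hγ) ≃ₐ[F] twistFun Y γ where
  toFun φ := ⟨fun x => (show twistFun G γ from φ.1 x).1 1, fun σ y => by
    have h1 : φ.1 (γ σ • y) = γ σ • φ.1 y := φ.2 (γ σ) y
    beta_reduce
    rw [h1, ← (show twistFun G γ from φ.1 y).2 σ 1]
    change (show twistFun G γ from φ.1 y).1 (1 * γ σ) = _
    rw [one_mul, smul_eq_mul, mul_one]⟩
  invFun φ := ⟨fun y => (⟨fun h => φ.1 (h • y), fun σ h => by
      beta_reduce
      rw [← φ.2 σ (h • y), smul_eq_mul, mul_smul]⟩ : twistFun G γ), fun g y =>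
    Subtype.ext (funext fun h => by
      change φ.1 (h • g • y) = φ.1 ((h * g) • y)
      rw [mul_smul])⟩
  left_inv φ := by
    refine Subtype.ext (funext fun y => Subtype.ext (funext fun h => ?_))
    change (show twistFun G γ from φ.1 (h • y)).1 1 = (show twistFun G γ from φ.1 y).1 h
    rw [show φ.1 (h • y) = h • φ.1 y from φ.2 h y]
    change (show twistFun G γ from φ.1 y).1 (1 * h) = _
    rw [one_mul]
  right_inv φ := Subtype.ext (funext fun y => congrArg φ.1 (one_smul G y))
  map_mul' φ ψ := rfl
  map_add' φ ψ := rfl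
  commutes' r := rfl

end GaloisAlgebraOfHom

end TorusBrauer
end

noncomputable section
namespace TorusBrauer

/-! ### The action of the torus normalizer on matrices -/

section Twists

open Topology Matrix Multiplicative

variable {F : Type u} [Field F] {G : Type w} [Group G] {X : Type v} [MulAction G X] {m : ℕ}

theorem J.act_diff (g : G) (x y : X) :
    J.act m g (J.diff X m x y) = J.diff X m (g • x) (g • y) := by
  ext1
  rw [J.coe_act]
  simp only [J.diff]
  rw [sub_eq_add_neg, Finsupp.mapDomain_add, Finsupp.mapDomain_single, ← Finsupp.single_neg,
    Finsupp.mapDomain_single, Finsupp.single_neg, sub_eq_add_neg]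

theorem torusAct_apply {R : Type u} [CommRing R] (g : G) (t : TorusPoints X m R) (j : J X m) :
    torusAct X m G R g t (ofAdd j) = t (ofAdd (J.act m g⁻¹ j)) := rfl

section Matrices

variable {R : Type u} [CommRing R]

theorem adMatrix_apply (p : TorusSemidirect X m G R) (M : Matrix X X R) (x y : X) :
    adMatrix p M x y = (p.left (ofAdd (J.diff X m x y)) : R) *
      M (p.right⁻¹ • x) (p.right⁻¹ • y) := rfl

theorem adMatrix_mul (p q : TorusSemidirect X m G R) (M : Matrix X X R) :
    adMatrix (p * q) M = adMatrix p (adMatrix q M) := by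
  ext x y
  simp only [adMatrix_apply, SemidirectProduct.mul_left, SemidirectProduct.mul_right,
    MonoidHom.mul_apply, torusAct_apply, J.act_diff, Units.val_mul, _root_.mul_inv_rev, mul_smul]
  ring

theorem adMatrix_one (M : Matrix X X R) : adMatrix (1 : TorusSemidirect X m G R) M = M := by
  ext x y
  simp [adMatrix_apply]

theorem adMatrix_mul_apply [Fintype X] (p : TorusSemidirect X m G R) (M N : Matrix X X R) :
    adMatrix p (M * N) = adMatrix p M * adMatrix p N := by
  ext x y
  simp only [adMatrix_apply, Matrix.mul_apply, Finset.mul_sum]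
  refine Fintype.sum_equiv (MulAction.toPerm p.right) _ _ fun z => ?_
  rw [MulAction.toPerm_apply, inv_smul_smul,
    ← J.diff_add m x (p.right • z) y, ofAdd_add, map_mul, Units.val_mul]
  ring

theorem map_adMatrix (σ : AbsGal F) (p : TorusSemidirect X m G (SeparableClosure F))
    (M : Matrix X X (SeparableClosure F)) :
    (adMatrix p M).map σ = adMatrix (σ • p) (M.map σ) := by
  ext x y
  simp [adMatrix_apply, smul_left, smul_right]

/-- The function `x ↦ t(x - z)` lifts `t` to a diagonal matrix, since its ratios are the values `t(x
- y)`. So `adMatrix p` is conjugation by a monomial matrix; changing `z` rescales that matrix. -/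
theorem adMatrix_mul_monomialMatrix {R : Type u} [Field R] [Fintype X] [DecidableEq X]
    (p : TorusSemidirect X m G R) (M : Matrix X X R) (z : X) :
    adMatrix p M * monomialMatrix (fun x => (p.left (ofAdd (J.diff X m x z)) : R)) p.right =
      monomialMatrix (fun x => (p.left (ofAdd (J.diff X m x z)) : R)) p.right * M := by
  ext x y
  rw [mul_monomialMatrix_apply, monomialMatrix_mul_apply, adMatrix_apply, inv_smul_smul,
    ← J.diff_add m x (p.right • y) z, ofAdd_add, map_mul, Units.val_mul]
  ring

end Matrices

namespace Cocycle

variable (c : Cocycle (AbsGal F) (TorusSemidirect X m G (SeparableClosure F)))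

/-- The image of a cocycle in `Hom(Gal(F_sep/F), G)`. -/
def rightHom : AbsGal F →* G where
  toFun σ := (c σ).right
  map_one' := by
    have h := c.map_mul' 1 1
    rw [mul_one, one_smul] at h
    rw [left_eq_mul.1 h]
    rfl
  map_mul' σ τ := by rw [c.map_mul', SemidirectProduct.mul_right, smul_right]

theorem rightHom_apply (σ : AbsGal F) : c.rightHom σ = (c σ).right := rfl

theorem map_one : c 1 = 1 := by
  have h := c.map_mul' 1 1
  rw [mul_one, one_smul] at h
  exact left_eq_mul.1 h

theorem eventually_eq_one : ∀ᶠ σ in 𝓝 1, c σ = 1 := by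
  have h := (IsLocallyConstant.iff_eventually_eq _).1 c.locConst 1
  rwa [c.map_one] at h

theorem eventually_rightHom : ∀ᶠ σ in 𝓝 1, c.rightHom σ = 1 :=
  c.eventually_eq_one.mono fun σ h => by rw [rightHom_apply, h]; rfl

theorem left_mul (σ τ : AbsGal F) (j : J X m) :
    ((c (σ * τ)).left (ofAdd j) : (SeparableClosure F)) =
      (c σ).left (ofAdd j) * σ ((c τ).left (ofAdd (J.act m (c σ).right⁻¹ j))) := by
  rw [c.map_mul', SemidirectProduct.mul_left, MonoidHom.mul_apply, torusAct_apply, smul_left]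
  simp

variable [Fintype X] [DecidableEq X]

/-- The Galois action on `M_X(F_sep)` twisted by a cocycle. -/
def matrixAction : SemilinearAction F (SeparableClosure F) (Matrix X X (SeparableClosure F)) where
  toFun σ :=
    { toFun := fun M => adMatrix (c σ) (M.map σ)
      map_zero' := by refine Matrix.ext fun x y => ?_; simp [adMatrix_apply]
      map_add' := fun M N => by refine Matrix.ext fun x y => ?_; simp [adMatrix_apply, mul_add] }
  map_smul' σ a M := by
    refine Matrix.ext fun x y => ?_
    change adMatrix (c σ) ((a • M).map σ) x y = σ a • adMatrix (c σ) (M.map σ) x y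
    simp only [adMatrix_apply, Matrix.map_apply, Matrix.smul_apply, smul_eq_mul, map_mul]
    ring
  map_mul' σ τ M := by
    change adMatrix (c (σ * τ)) (M.map ⇑(σ * τ)) = adMatrix (c σ) ((adMatrix (c τ) (M.map τ)).map σ)
    rw [c.map_mul', adMatrix_mul, map_adMatrix]
    rfl
  eventually_fixed M := by
    filter_upwards [c.eventually_eq_one, eventually_comp_eq (F := F) fun z : X × X => M z.1 z.2]
      with σ h1 h2
    change adMatrix (c σ) (M.map σ) = M
    rw [h1, adMatrix_one]
    refine Matrix.ext fun x y => ?_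
    exact h2 (x, y)

/-- The homomorphism `f` identifies `S` with the form of `M_X(F)` attached to the cocycle `c`. -/
structure IsTwist {S : Type*} [Ring S] [Algebra F S] (f : S →ₐ[F] Matrix X X (SeparableClosure F)) : Prop where
  isForm : IsForm (SeparableClosure F) f
  ad_map : ∀ (σ : AbsGal F) s, adMatrix (c σ) ((f s).map σ) = f s

theorem finite_twistMatrix : Module.Finite F (twistMatrix c) :=
  (isForm_val_of_invariants c.matrixAction (twistMatrix c) fun _ => Iff.rfl).1

theorem isTwist_val : c.IsTwist (twistMatrix c).val where
  isForm := (isForm_val_of_invariants c.matrixAction (twistMatrix c) fun _ => Iff.rfl).2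
  ad_map σ s := s.2 σ

variable {c}

theorem IsTwist.comp_algEquiv {S S' : Type*} [Ring S] [Algebra F S] [Ring S'] [Algebra F S']
    {f : S →ₐ[F] Matrix X X (SeparableClosure F)} (hf : c.IsTwist f) (e : S' ≃ₐ[F] S) :
    c.IsTwist (f.comp (e : S' →ₐ[F] S)) where
  isForm := hf.isForm.comp_algEquiv_left e
  ad_map σ s := hf.ad_map σ (e s)

/-- On a twisted form, the Galois action is conjugation by these monomial matrices. They form only a
projective cocycle, because the base point `z` is not fixed by `γ`. -/
theorem IsTwist.mul_monomialMatrix {S : Type*} [Ring S] [Algebra F S]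
    {f : S →ₐ[F] Matrix X X (SeparableClosure F)} (hf : c.IsTwist f) (z : X) (σ : AbsGal F) (s : S) :
    f s * monomialMatrix (fun x => ((c σ).left (ofAdd (J.diff X m x z)) : (SeparableClosure F))) (c σ).right =
      monomialMatrix (fun x => ((c σ).left (ofAdd (J.diff X m x z)) : (SeparableClosure F))) (c σ).right *
        (f s).map σ := by
  rw [← adMatrix_mul_monomialMatrix, hf.ad_map]

theorem IsTwist.apply_eq {S : Type*} [Ring S] [Algebra F S]
    {f : S →ₐ[F] Matrix X X (SeparableClosure F)} (hf : c.IsTwist f) (σ : AbsGal F) (s : S) (x y : X) :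
    f s x y = (c σ).left (ofAdd (J.diff X m x y)) *
      σ (f s ((c σ).right⁻¹ • x) ((c σ).right⁻¹ • y)) := by
  conv_lhs => rw [← hf.ad_map σ s]
  rfl

/-- Cohomologous cocycles have isomorphic twisted matrix algebras. -/
theorem nonempty_twistMatrix_equiv {c c' : Cocycle (AbsGal F) (TorusSemidirect X m G (SeparableClosure F))}
    (a : TorusSemidirect X m G (SeparableClosure F)) (h : ∀ σ, c' σ = a⁻¹ * c σ * σ • a) :
    Nonempty (twistMatrix c ≃ₐ[F] twistMatrix c') := by
  have key : ∀ (c c' : Cocycle (AbsGal F) (TorusSemidirect X m G (SeparableClosure F)))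
      (a : TorusSemidirect X m G (SeparableClosure F)), (∀ σ, c' σ = a⁻¹ * c σ * σ • a) →
      ∀ M ∈ twistMatrix c, adMatrix a⁻¹ M ∈ twistMatrix c' := by
    intro c c' a h M hM σ
    rw [h, map_adMatrix, ← adMatrix_mul, smul_inv', mul_inv_cancel_right, adMatrix_mul, hM σ]
  have h' : ∀ σ, c σ = (a⁻¹)⁻¹ * c' σ * σ • a⁻¹ := fun σ => by rw [h]; simp [mul_assoc]
  refine ⟨{
    toFun := fun M => ⟨adMatrix a⁻¹ M.1, key c c' a h M.1 M.2⟩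
    invFun := fun M => ⟨adMatrix (a⁻¹)⁻¹ M.1, key c' c a⁻¹ h' M.1 M.2⟩
    left_inv := fun M => Subtype.ext (by
      change adMatrix (a⁻¹)⁻¹ (adMatrix a⁻¹ M.1) = M.1
      rw [← adMatrix_mul, inv_mul_cancel, adMatrix_one])
    right_inv := fun M => Subtype.ext (by
      change adMatrix a⁻¹ (adMatrix (a⁻¹)⁻¹ M.1) = M.1
      rw [← adMatrix_mul, mul_inv_cancel, adMatrix_one])
    map_mul' := fun M N => Subtype.ext (adMatrix_mul_apply _ _ _)
    map_add' := fun M N => Subtype.ext (by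
      refine Matrix.ext fun x y => ?_
      simp [adMatrix_apply, mul_add])
    commutes' := fun r => Subtype.ext (by
      refine Matrix.ext fun x y => ?_
      change adMatrix a⁻¹ (algebraMap F (Matrix X X (SeparableClosure F)) r) x y = algebraMap F (Matrix X X (SeparableClosure F)) r x y
      by_cases hxy : x = y
      · subst hxy
        simp [adMatrix_apply, Matrix.algebraMap_matrix_apply, J.diff_self]
      · simp [adMatrix_apply, Matrix.algebraMap_matrix_apply, hxy]) }⟩

end Cocycle

end Twists

end TorusBrauer
end

noncomputable section
namespace TorusBrauer

/-! ### Splitting of twisted matrix algebras -/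

section TwistSplit

open Topology Matrix Multiplicative

variable {F : Type u} [Field F] {G : Type w} [Group G] {X : Type v} [MulAction G X] {m : ℕ}

/-- The element `x₁ + ⋯ + x_m` of `J`. -/
def J.sum (x : Fin m → X) : J X m :=
  ⟨∑ i, Finsupp.single (x i) 1, by
    rw [J, AddMonoidHom.mem_ker, map_sum]
    simp [augMod]⟩

theorem J.act_sum (g : G) (x : Fin m → X) : J.act m g (J.sum x) = J.sum (g • x) := by
  ext1
  rw [J.coe_act]
  simp only [J.sum]
  rw [Finsupp.mapDomain_finsetSum]
  simp [Finsupp.mapDomain_single]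

theorem J.sum_eq (x y : Fin m → X) : J.sum x = ∑ i, J.diff X m (x i) (y i) + J.sum y := by
  ext1
  rw [AddSubgroup.coe_add, AddSubgroup.val_finsetSum]
  simp [J.sum, J.diff]

theorem map_ofAdd_sum {R : Type*} [CommRing R] {A : Type*} [AddCommGroup A] {κ : Type*}
    [Fintype κ] (t : Multiplicative A →* Rˣ) (a : κ → A) :
    ((t (ofAdd (∑ i, a i)) : Rˣ) : R) = ∏ i, (t (ofAdd (a i)) : R) := by
  rw [ofAdd_sum, map_prod, Units.coe_prod]

theorem isUnit_monomialMatrix {L : Type*} [Field L] [Fintype X] [DecidableEq X] (w : X → L)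
    (hw : ∀ x, w x ≠ 0) (g : G) : IsUnit (monomialMatrix w g) := by
  refine IsUnit.of_mul_eq_one (monomialMatrix (fun x => (w (g • x))⁻¹) g⁻¹) ?_
  rw [monomialMatrix_mul, mul_inv_cancel, ← monomialMatrix_one (G := G)]
  congr 1
  funext x
  simp [mul_inv_cancel₀ (hw x)]

/-- `K` is not assumed to be a field, so bijectivity is obtained by comparing dimensions over `F`.
-/
theorem isSplit_of_injective {K S : Type*} [CommRing K] [Algebra F K] [Module.Finite F K] [Ring S]
    [Algebra F S] [Module.Finite F S] [Fintype X] [DecidableEq X] [Nonempty X]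
    (k : K ⊗[F] S →ₐ[K] Matrix X X K) (hk : Function.Injective k)
    (hd : Module.finrank F S = Fintype.card X ^ 2) : IsSplit K (K ⊗[F] S) := by
  have hb : Function.Bijective k := by
    refine ⟨hk, (LinearMap.injective_iff_surjective_of_finrank_eq_finrank
      (f := (k.restrictScalars F).toLinearMap) ?_).1 hk⟩
    rw [Module.finrank_tensorProduct, Module.finrank_matrix, hd, sq, mul_comm]
  exact ⟨Fintype.card X, Fintype.card_ne_zero, ⟨(AlgEquiv.ofBijective k hb).trans
    (Matrix.reindexAlgEquiv K K (Fintype.equivFin X))⟩⟩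

namespace Cocycle

variable [Fintype X] [DecidableEq X]
  {c : Cocycle (AbsGal F) (TorusSemidirect X m G (SeparableClosure F))}
  {S : Type*} [Ring S] [Algebra F S] {f : S →ₐ[F] Matrix X X (SeparableClosure F)}

/-- Although `x` itself is not in `J`, the sum `x₁ + ⋯ + x_m` is. The monomial matrices on `X^m`
with weights `t_σ(x₁ + ⋯ + x_m)` therefore need no base point and form a genuine cocycle inducing
the Galois action on the tensor power. -/
theorem IsTwist.isSplit_tensorPower [Nonempty X] [Module.Finite F S] (hf : c.IsTwist f) :
    IsSplit F (⨂[F] _ : Fin m, S) := by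
  have hfin : Module.Finite F (⨂[F] _ : Fin m, S) := inferInstance
  refine isSplit_of_cocycle (hf.isForm.piKroneckerHom m) (fun σ => monomialMatrix
    (fun x : Fin m → X => ((c σ).left (ofAdd (J.sum x)) : SeparableClosure F)) (c σ).right)
    (fun σ τ => ?_) ?_ (fun σ s => ?_)
  · have h := map_monomialMatrix (σ : SeparableClosure F →+* SeparableClosure F)
      (fun x : Fin m → X => ((c τ).left (ofAdd (J.sum x)) : SeparableClosure F)) (c τ).right
    erw [h]
    rw [monomialMatrix_mul, show (c (σ * τ)).right = (c σ).right * (c τ).right from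
      c.rightHom.map_mul σ τ]
    congr 1
    funext x
    rw [c.left_mul, J.act_sum]
    rfl
  · filter_upwards [c.eventually_eq_one] with σ h
    rw [h]
    exact monomialMatrix_one
  · induction s using PiTensorProduct.induction_on with
    | add s s' h h' =>
      rw [map_add, add_mul, ← h, ← h', ← mul_add]
      congr 1
      refine Matrix.ext fun x y => ?_
      simp
    | smul_tprod r s =>
      rw [map_smul, piKroneckerHom_tprod]
      refine Matrix.ext fun x y => ?_
      -- The weights of `x` and of `γ_σ y` differ by the product of the `t_σ(x_i - γ_σ y_i)`,
      -- exactly the factor contributed by the entries of `f (s i)`.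
      rw [monomialMatrix_mul_apply, mul_monomialMatrix_apply, J.sum_eq x ((c σ).right • y),
        ofAdd_add, map_mul, Units.val_mul, map_ofAdd_sum]
      simp only [Matrix.map_apply, Matrix.smul_apply, piKronecker_apply, Pi.smul_apply]
      have h : ∀ i, f (s i) (x i) ((c σ).right • y i) =
          (c σ).left (ofAdd (J.diff X m (x i) ((c σ).right • y i))) *
          σ (f (s i) ((c σ).right⁻¹ • x i) (y i)) := fun i => by
        rw [hf.apply_eq σ (s i), inv_smul_smul]
      simp only [h, Finset.prod_mul_distrib]
      rw [Algebra.smul_def, map_mul, AlgEquiv.commutes, map_prod, Algebra.smul_def]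
      ring

/-- Since `f(S)` spans all matrices, the `y`-th columns of its elements span `L^X`, and a basis can
be selected among them. -/
theorem IsTwist.exists_column_basis (hf : c.IsTwist f) (y : X) :
    ∃ b : X → S, IsUnit (Matrix.of fun x i => f (b i) x y) := by
  let col : Matrix X X (SeparableClosure F) →ₗ[SeparableClosure F] (X → SeparableClosure F) :=
    { toFun := fun M x => M x y
      map_add' := fun _ _ => rfl
      map_smul' := fun _ _ => rfl }
  have hcol : LinearMap.range col = ⊤ := by
    rw [LinearMap.range_eq_top]
    exact fun v => ⟨Matrix.of fun x _ => v x, rfl⟩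
  have hs : ⊤ ≤ Submodule.span (SeparableClosure F) (col '' Set.range f) := by
    rw [← Submodule.map_span, hf.isForm.span_range, Submodule.map_top, hcol]
  let B := Module.Basis.ofSpan hs
  have hB : ∀ i, B i ∈ col '' Set.range f := fun i => Module.Basis.ofSpan_subset hs ⟨i, rfl⟩
  have hfin := Module.Finite.finite_basis B
  have := Fintype.ofFinite ↑((linearIndepOn_empty (SeparableClosure F) id).extend (Set.empty_subset
    (col '' Set.range f)))
  have hcard := Module.finrank_eq_card_basis B
  rw [Module.finrank_fintype_fun_eq_card] at hcard
  let B' := B.reindex (Fintype.equivOfCardEq hcard.symm)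
  have hB' : ∀ i, ∃ s : S, col (f s) = B' i := by
    intro i
    rw [Module.Basis.reindex_apply]
    obtain ⟨_, ⟨s, rfl⟩, h⟩ := hB ((Fintype.equivOfCardEq hcard.symm).symm i)
    exact ⟨s, h⟩
  choose b hb using hB'
  refine ⟨b, ?_⟩
  have : (Matrix.of fun x i => f (b i) x y) = (Pi.basisFun (SeparableClosure F) X).toMatrix B' := by
    refine Matrix.ext fun x i => ?_
    rw [Module.Basis.toMatrix_apply, Pi.basisFun_repr, ← hb]
    rfl
  rw [this]
  exact IsUnit.of_mul_eq_one _ (Module.Basis.toMatrix_mul_toMatrix_flip _ _)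

/-- The matrix `N y` describes the minimal left ideal of matrices supported in column `y`, in a
basis taken from `S`. Using the same elements of `S` along each Galois orbit makes the family
equivariant. -/
theorem IsTwist.exists_trivialization (hf : c.IsTwist f) :
    ∃ N : X → Matrix X X (SeparableClosure F), (∀ y, IsUnit (N y)) ∧
      ∀ σ y, N ((c σ).right • y) = monomialMatrix
        (fun x => ((c σ).left (ofAdd (J.diff X m x ((c σ).right • y))) : SeparableClosure F))
        (c σ).right * (N y).map σ := by
  choose b hb using hf.exists_column_basis
  obtain ⟨rep, hrep, hrep'⟩ := exists_orbit_rep (Y := X) c.rightHom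
  have key : ∀ z σ y, (Matrix.of fun x i => f (b z i) x ((c σ).right • y)) = monomialMatrix
        (fun x => ((c σ).left (ofAdd (J.diff X m x ((c σ).right • y))) : SeparableClosure F))
        (c σ).right * (Matrix.of fun x i => f (b z i) x y).map σ := by
    intro z σ y
    refine Matrix.ext fun x i => ?_
    rw [monomialMatrix_mul_apply, Matrix.of_apply, hf.apply_eq σ, inv_smul_smul]
    rfl
  refine ⟨fun y => Matrix.of fun x i => f (b (rep y) i) x y, fun y => ?_, fun σ y => ?_⟩
  · obtain ⟨σ, hσ⟩ := hrep' y
    have h := key (rep y) σ (rep y)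
    rw [← rightHom_apply, hσ] at h
    beta_reduce
    rw [h]
    refine (isUnit_monomialMatrix _ (fun x => Units.ne_zero _) _).mul ?_
    exact (hb (rep y)).map (σ : SeparableClosure F →+* SeparableClosure F).mapMatrix
  · beta_reduce
    rw [← rightHom_apply, hrep]
    exact key _ _ _

/-- Writing the left multiplication of `S` on column `y` in the basis `N y` gives representations `θ
y`, from which the monomial factors have disappeared. Their entries, as functions of `y`, lie in the
twisted form `K` of `L^X`, so together they are one map to matrices over `K`. -/
theorem IsTwist.isSplit_twistFun [Nonempty X] [Module.Finite F S] (hf : c.IsTwist f) :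
    IsSplit (twistFun X c.rightHom) (twistFun X c.rightHom ⊗[F] S) := by
  obtain ⟨N, hN, hNσ⟩ := hf.exists_trivialization
  have hdet : ∀ y, IsUnit (N y).det := fun y => (Matrix.isUnit_iff_isUnit_det _).1 (hN y)
  let θ : X → S → Matrix X X (SeparableClosure F) := fun y s => (N y)⁻¹ * f s * N y
  have hθ : ∀ y s, N y * θ y s = f s * N y := fun y s => by
    simp only [θ, mul_assoc]
    rw [Matrix.mul_nonsing_inv_cancel_left _ _ (hdet y)]
  have hθσ : ∀ σ y s, θ (c.rightHom σ • y) s = (θ y s).map σ := by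
    intro σ y s
    rw [rightHom_apply]
    apply (hN ((c σ).right • y)).mul_left_cancel
    rw [hθ, hNσ, mul_assoc, ← map_galois_mul, hθ, map_galois_mul, ← mul_assoc, ← mul_assoc,
      hf.mul_monomialMatrix]
  have hθmul : ∀ y s s', θ y (s * s') = θ y s * θ y s' := fun y s s' => by
    apply (hN y).mul_left_cancel
    rw [hθ, ← mul_assoc, hθ, mul_assoc, hθ, map_mul, mul_assoc]
  have hθone : ∀ y, θ y 1 = 1 := fun y => by
    apply (hN y).mul_left_cancel
    rw [hθ, _root_.map_one, one_mul, mul_one]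
  have hθalg : ∀ y r, θ y (algebraMap F S r) = r • 1 := fun y r => by
    apply (hN y).mul_left_cancel
    rw [hθ, AlgHom.commutes, Algebra.algebraMap_eq_smul_one, smul_mul_assoc, mul_smul_comm,
      mul_one, one_mul]
  let K := twistFun X c.rightHom
  let Θ : S →ₐ[F] Matrix X X K :=
    { toFun := fun s => Matrix.of fun i j => ⟨fun y => θ y s i j, fun σ y => by
        beta_reduce; rw [hθσ]; rfl⟩
      map_one' := by
        refine Matrix.ext fun i j => Subtype.ext (funext fun y => ?_)
        change θ y 1 i j = _
        rw [hθone]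
        by_cases hij : i = j
        · subst hij; simp
        · simp [Matrix.one_apply_ne hij]
      map_mul' := fun s s' => by
        refine Matrix.ext fun i j => Subtype.ext (funext fun y => ?_)
        change θ y (s * s') i j = _
        rw [hθmul, Matrix.mul_apply, Matrix.mul_apply]
        simp
      map_zero' := by
        refine Matrix.ext fun i j => Subtype.ext (funext fun y => ?_)
        change θ y 0 i j = 0
        simp [θ]
      map_add' := fun s s' => by
        refine Matrix.ext fun i j => Subtype.ext (funext fun y => ?_)
        change θ y (s + s') i j = θ y s i j + θ y s' i j
        simp [θ, mul_add, add_mul]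
      commutes' := fun r => by
        refine Matrix.ext fun i j => Subtype.ext (funext fun y => ?_)
        change θ y (algebraMap F S r) i j = _
        rw [hθalg, Algebra.algebraMap_eq_smul_one]
        by_cases hij : i = j
        · subst hij; simp
        · simp [Matrix.one_apply_ne hij] }
  have hγ := c.eventually_rightHom
  have hKfin : Module.Finite F K := (twistFun_isForm c.rightHom hγ).1
  let k : K ⊗[F] S →ₐ[K] Matrix X X K :=
    Algebra.TensorProduct.lift (Algebra.ofId K _) Θ fun a _ => Algebra.commutes a _
  have hk : ∀ (a : K) (s : S) (i j y : X), (k (a ⊗ₜ s) i j).1 y = a.1 y * θ y s i j := by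
    intro a s i j y
    have h : k (a ⊗ₜ s) = a • Θ s := by
      rw [Algebra.smul_def]
      exact Algebra.TensorProduct.lift_tmul _ _ _ _ _
    rw [h]
    rfl
  let b := Module.finBasis F S
  let B := Algebra.TensorProduct.basis K b
  have hinj : Function.Injective k := by
    rw [injective_iff_map_eq_zero]
    intro z hz
    have hzsum : z = ∑ i, (B.repr z i) ⊗ₜ[F] b i := by
      conv_lhs => rw [← B.sum_repr z]
      refine Finset.sum_congr rfl fun i _ => ?_
      rw [Algebra.TensorProduct.basis_apply, TensorProduct.smul_tmul', smul_eq_mul, mul_one]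
    have h0 : ∀ y, ∑ i, (B.repr z i).1 y • θ y (b i) = 0 := by
      intro y
      refine Matrix.ext fun i j => ?_
      have h1 : (k z i j).1 y = 0 := by rw [hz]; rfl
      rw [hzsum, map_sum, Matrix.sum_apply] at h1
      rw [Matrix.sum_apply, Matrix.zero_apply, ← h1]
      simp only [Matrix.smul_apply, smul_eq_mul, ← hk]
      rw [AddSubmonoidClass.coe_finsetSum, Finset.sum_apply]
    -- At each point `y`, the matrices `θ y (b i)` are conjugates of the `L`-basis `f (b i)`, so the
    -- coefficients vanish there.
    have h2 : ∀ y i, (B.repr z i).1 y = 0 := by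
      intro y
      refine Fintype.linearIndependent_iff.1 (hf.isForm.basis b).linearIndependent _ ?_
      apply (hN y).mul_right_cancel
      rw [zero_mul, Finset.sum_mul, ← mul_zero (N y), ← h0 y, Finset.mul_sum]
      refine Finset.sum_congr rfl fun i _ => ?_
      rw [mul_smul_comm, hθ, smul_mul_assoc, hf.isForm.basis_apply]
    have h3 : B.repr z = 0 := Finsupp.ext fun i => Subtype.ext (funext fun y => h2 y i)
    exact B.repr.map_eq_zero_iff.1 h3
  exact isSplit_of_injective k hinj hf.isForm.finrank_matrix

end Cocycle

end TwistSplit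

end TorusBrauer
end

noncomputable section
namespace TorusBrauer

/-! ### The structure of the lattice `J` -/

section Lattice

open Multiplicative

variable {X : Type v} {m : ℕ} {G : Type w} [Group G] [MulAction G X]

/-- The sum of the coefficients. -/
def total (X : Type v) : (X →₀ ℤ) →+ ℤ := Finsupp.liftAddHom fun _ => AddMonoidHom.id ℤ

theorem total_single (x : X) (k : ℤ) : total X (Finsupp.single x k) = k := by
  simp [total]

theorem total_eq_sum [Fintype X] (f : X →₀ ℤ) : total X f = ∑ x, f x := by
  simp only [total, Finsupp.liftAddHom_apply]
  exact Finsupp.sum_fintype _ _ (by simp)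

theorem augMod_eq (f : X →₀ ℤ) : augMod X m f = (total X f : ZMod m) := by
  have : augMod X m = (Int.castAddHom (ZMod m)).comp (total X) := by
    ext x
    simp [augMod, total]
  rw [this]; rfl

theorem total_act (g : G) (j : J X m) :
    total X (J.act m g j : X →₀ ℤ) = total X (j : X →₀ ℤ) := by
  rw [J.coe_act]
  simp only [total, Finsupp.liftAddHom_apply]
  rw [Finsupp.sum_mapDomain_index] <;> simp

theorem dvd_total (j : J X m) : (m : ℤ) ∣ total X (j : X →₀ ℤ) := by
  have h : augMod X m (j : X →₀ ℤ) = 0 := j.2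
  rwa [augMod_eq, ZMod.intCast_zmod_eq_zero_iff_dvd] at h

/-- The sum of the coefficients, divided by `m`. -/
def J.deg (X : Type v) (m : ℕ) : J X m →+ ℤ where
  toFun j := total X (j : X →₀ ℤ) / m
  map_zero' := by simp
  map_add' i j := by
    rw [AddSubgroup.coe_add, map_add, Int.add_ediv_of_dvd_left (dvd_total i)]

theorem J.deg_mul (j : J X m) : J.deg X m j * m = total X (j : X →₀ ℤ) :=
  Int.ediv_mul_cancel (dvd_total j)

theorem J.deg_act (g : G) (j : J X m) : J.deg X m (J.act m g j) = J.deg X m j := by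
  change total X (J.act m g j : X →₀ ℤ) / (m : ℤ) = total X (j : X →₀ ℤ) / m
  rw [total_act]

/-- The element `m x` of `J`. -/
def J.mulSingle (m : ℕ) (x : X) : J X m :=
  ⟨Finsupp.single x m, by rw [J, AddMonoidHom.mem_ker, augMod_eq, total_single]; simp⟩

theorem J.act_mulSingle (g : G) (x : X) :
    J.act m g (J.mulSingle m x) = J.mulSingle m (g • x) := by
  ext1
  rw [J.coe_act]
  exact Finsupp.mapDomain_single

theorem J.mulSingle_eq (x y : X) :
    J.mulSingle m x = m • J.diff X m x y + J.mulSingle m y := by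
  ext1
  simp [J.mulSingle, J.diff, smul_sub]

/-- `J` is generated by the differences `x - z` together with `m z`, the multiplicity of the latter
being the degree. -/
theorem J.eq_sum [Fintype X] (z : X) (j : J X m) :
    j = ∑ x, (j : X →₀ ℤ) x • J.diff X m x z + J.deg X m j • J.mulSingle m z := by
  ext1
  rw [AddSubgroup.coe_add, AddSubgroup.val_finsetSum]
  simp only [J.diff, J.mulSingle, AddSubgroup.coe_zsmul, smul_sub, Finsupp.smul_single, smul_eq_mul,
    mul_one, Finset.sum_sub_distrib]
  rw [J.deg_mul, total_eq_sum, ← Finsupp.single_finsetSum, sub_add_cancel]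
  exact (Finsupp.univ_sum_single _).symm

/-- Homomorphisms on `J` trivial on differences are determined by the value at `m z`. -/
theorem map_eq_zpow_of_diff [Fintype X] {M : Type*} [CommGroup M] (χ : Multiplicative (J X m) →* M)
    (hχ : ∀ x y, χ (ofAdd (J.diff X m x y)) = 1) (z : X) (j : J X m) :
    χ (ofAdd j) = χ (ofAdd (J.mulSingle m z)) ^ J.deg X m j := by
  conv_lhs => rw [J.eq_sum z j]
  rw [ofAdd_add, map_mul, ofAdd_sum, map_prod, ofAdd_zsmul, map_zpow]
  simp [ofAdd_zsmul, hχ]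

/-- The point of the torus attached to a unit-valued function on `X`. -/
def torusOfFun [Fintype X] (m : ℕ) {R : Type*} [CommRing R] (D : X → Rˣ) : TorusPoints X m R where
  toFun j := ∏ x, D x ^ (j.toAdd : X →₀ ℤ) x
  map_one' := by simp
  map_mul' i j := by simp [zpow_add, Finset.prod_mul_distrib]

theorem torusOfFun_apply [Fintype X] {R : Type*} [CommRing R] (D : X → Rˣ) (j : J X m) :
    torusOfFun m D (ofAdd j) = ∏ x, D x ^ (j : X →₀ ℤ) x := rfl

theorem torusOfFun_diff [Fintype X] {R : Type*} [CommRing R] (D : X → Rˣ) (x y : X) :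
    torusOfFun m D (ofAdd (J.diff X m x y)) = D x / D y := by
  classical
  rw [torusOfFun_apply]
  simp only [J.diff, Finsupp.sub_apply, Finsupp.single_apply, zpow_sub, Finset.prod_mul_distrib,
    Finset.prod_inv_distrib]
  rw [div_eq_mul_inv]
  congr 1
  · rw [Finset.prod_eq_single x] <;> simp +contextual [eq_comm]
  · rw [Finset.prod_eq_single y] <;> simp +contextual [eq_comm]

/-- The action of `g⁻¹` on `J` corresponds to translating the function. -/
theorem torusOfFun_act [Fintype X] {R : Type*} [CommRing R] (D : X → Rˣ) (g : G) (j : J X m) :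
    torusOfFun m D (ofAdd (J.act m g j)) = ∏ x, D (g • x) ^ (j : X →₀ ℤ) x := by
  rw [torusOfFun_apply]
  refine (Fintype.prod_equiv (MulAction.toPerm g) _ _ fun x => ?_).symm
  rw [MulAction.toPerm_apply, J.coe_act, Finsupp.mapDomain_apply (MulAction.injective g)]

end Lattice

end TorusBrauer
end

noncomputable section
namespace TorusBrauer

/-! ### Cocycles with the same Brauer class are cohomologous -/

section Injectivity

open Topology Matrix Multiplicative
open scoped Kronecker

variable {F : Type u} [Field F] {G : Type w} [Group G] {X : Type v} [MulAction G X] {m : ℕ}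

theorem matrixComp_mul_kronecker {L S ι κ : Type*} [Field L] [Algebra F L] [Ring S] [Algebra F S]
    [Fintype ι] [DecidableEq ι] [Fintype κ] [DecidableEq κ] (f : S →ₐ[F] Matrix ι ι L)
    (M : Matrix κ κ S) (N : Matrix ι ι L) (x y : κ × ι) :
    (matrixComp κ f M * ((1 : Matrix κ κ L) ⊗ₖ N)) x y = (f (M x.1 y.1) * N) x.2 y.2 := by
  rw [Matrix.mul_apply, Fintype.sum_prod_type, Finset.sum_eq_single y.1, Matrix.mul_apply]
  · simp [matrixComp_apply, Matrix.kroneckerMap_apply]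
  · intro i _ hi
    simp [Matrix.kroneckerMap_apply, Matrix.one_apply_ne hi]
  · simp

theorem kronecker_mul_matrixComp {L S ι κ : Type*} [Field L] [Algebra F L] [Ring S] [Algebra F S]
    [Fintype ι] [DecidableEq ι] [Fintype κ] [DecidableEq κ] (f : S →ₐ[F] Matrix ι ι L)
    (M : Matrix κ κ S) (N : Matrix ι ι L) (σ : Gal(L/F)) (x y : κ × ι) :
    (((1 : Matrix κ κ L) ⊗ₖ N) * (matrixComp κ f M).map σ) x y =
      (N * (f (M x.1 y.1)).map σ) x.2 y.2 := by
  rw [Matrix.mul_apply, Fintype.sum_prod_type, Finset.sum_eq_single x.1, Matrix.mul_apply]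
  · simp [matrixComp_apply, Matrix.kroneckerMap_apply]
  · intro i _ hi
    simp [Matrix.kroneckerMap_apply, Matrix.one_apply_ne hi.symm]
  · simp

theorem kronecker_monomial_mul_apply {L κ Z : Type*} [Field L] [Fintype X] [DecidableEq X]
    [Fintype κ] [DecidableEq κ] (w : X → L) (g : G) (M : Matrix (κ × X) Z L) (i : κ) (x : X)
    (z : Z) :
    (((1 : Matrix κ κ L) ⊗ₖ monomialMatrix w g) * M) (i, x) z = w x * M (i, g⁻¹ • x) z := by
  rw [Matrix.mul_apply, Fintype.sum_prod_type, Finset.sum_eq_single i]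
  · simp [Matrix.kroneckerMap_apply, monomialMatrix_apply]
  · intro j _ hj
    simp [Matrix.kroneckerMap_apply, Matrix.one_apply_ne hj.symm]
  · simp

theorem mul_kronecker_monomial_apply {L κ Z : Type*} [Field L] [Fintype X] [DecidableEq X]
    [Fintype κ] [DecidableEq κ] (w : X → L) (g : G) (M : Matrix Z (κ × X) L) (i : κ) (x : X)
    (z : Z) :
    (M * ((1 : Matrix κ κ L) ⊗ₖ monomialMatrix w g)) z (i, x) = M z (i, g • x) * w (g • x) := by
  rw [Matrix.mul_apply, Fintype.sum_prod_type, Finset.sum_eq_single i]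
  · simp [Matrix.kroneckerMap_apply, monomialMatrix_apply, eq_inv_smul_iff, eq_comm]
  · intro j _ hj
    simp [Matrix.kroneckerMap_apply, Matrix.one_apply_ne hj]
  · simp

theorem mul_mul_inv_mul_distrib {M : Type*} [CommGroup M] (a a' b b' c c' d d' : M) :
    a * a' * (b * b') * (c * c' * (d * d'))⁻¹ = a * b * (c * d)⁻¹ * (a' * b' * (c' * d')⁻¹) := by
  rw [mul_mul_mul_comm a, mul_mul_mul_comm c, mul_inv, mul_mul_mul_comm]

theorem mul_mul_inv_mul_cancel {M : Type*} [CommGroup M] (p q r s d y w : M) :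
    p * q * d * (r * s * w)⁻¹ = p * d * (r * y)⁻¹ * (q * y * (s * w)⁻¹) := by
  rw [← div_eq_mul_inv, ← div_eq_mul_inv, ← div_eq_mul_inv, div_mul_div_comm,
    div_eq_div_iff_mul_eq_mul]
  ac_rfl

namespace Cocycle

variable [Fintype X] [DecidableEq X]

section Ratio

variable {c c' : Cocycle (AbsGal F) (TorusSemidirect X m G (SeparableClosure F))}
  {S S' : Type*} [Ring S] [Algebra F S] [Ring S']
  [Algebra F S'] [Module.Finite F S] [Module.Finite F S']
  {f : S →ₐ[F] Matrix X X (SeparableClosure F)} {f' : S' →ₐ[F] Matrix X X (SeparableClosure F)}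

/-- Isomorphic matrix algebras over two twisted forms give a nonzero matrix which is equivariant up
to scalars. -/
theorem exists_projective_intertwiner [Nonempty X] (hf : c.IsTwist f) (hf' : c'.IsTwist f')
    {k : ℕ} (hk : k ≠ 0) (e : Matrix (Fin k) (Fin k) S ≃ₐ[F] Matrix (Fin k) (Fin k) S') (z : X) :
    ∃ (P : Matrix (Fin k × X) (Fin k × X) (SeparableClosure F)) (l : AbsGal F → SeparableClosure F),
      P ≠ 0 ∧ (∀ σ, l σ ≠ 0) ∧ ∀ σ i x j y,
        l σ * ((c' σ).left (ofAdd (J.diff X m y z)) : SeparableClosure F) * P (i, x) (j, y) =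
          (c σ).left (ofAdd (J.diff X m x z)) *
            σ (P (i, (c σ).right⁻¹ • x) (j, (c' σ).right⁻¹ • y)) := by
  have : NeZero k := ⟨hk⟩
  let L := SeparableClosure F
  let f₁ : Matrix (Fin k) (Fin k) S →ₐ[F] Matrix (Fin k × X) (Fin k × X) L := matrixComp (Fin k) f
  let f₂ : Matrix (Fin k) (Fin k) S →ₐ[F] Matrix (Fin k × X) (Fin k × X) L :=
    (matrixComp (Fin k) f').comp e.toAlgHom
  have h₁ : IsForm L f₁ := hf.isForm.matrixComp
  have h₂ : IsForm L f₂ := hf'.isForm.matrixComp.comp_algEquiv_left e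
  -- Two embeddings of the same algebra are now compared: `f` applied entrywise, and `f'` applied
  -- after `e`.
  obtain ⟨P, Q, hPQ, hQP, hP⟩ := h₁.exists_conj h₂
  let p : AbsGal F → Matrix (Fin k × X) (Fin k × X) L := fun σ => (1 : Matrix (Fin k) (Fin k) L) ⊗ₖ
    monomialMatrix (fun x => ((c σ).left (ofAdd (J.diff X m x z)) : L)) (c σ).right
  let p' : AbsGal F → Matrix (Fin k × X) (Fin k × X) L := fun σ => (1 : Matrix (Fin k) (Fin k) L) ⊗ₖ
    monomialMatrix (fun x => ((c' σ).left (ofAdd (J.diff X m x z)) : L)) (c' σ).right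
  have hp : ∀ σ s, f₁ s * p σ = p σ * (f₁ s).map σ := by
    intro σ s
    refine Matrix.ext fun x y => ?_
    rw [matrixComp_mul_kronecker, kronecker_mul_matrixComp, hf.mul_monomialMatrix]
  have hp' : ∀ σ s, f₂ s * p' σ = p' σ * (f₂ s).map σ := by
    intro σ s
    refine Matrix.ext fun x y => ?_
    change (matrixComp (Fin k) f' (e s) * p' σ) x y =
      (p' σ * (matrixComp (Fin k) f' (e s)).map σ) x y
    rw [matrixComp_mul_kronecker, kronecker_mul_matrixComp, hf'.mul_monomialMatrix]
  have hu : ∀ {c : Cocycle (AbsGal F) (TorusSemidirect X m G (SeparableClosure F))} (σ : AbsGal F),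
      IsUnit ((1 : Matrix (Fin k) (Fin k) L) ⊗ₖ
    monomialMatrix (fun x => ((c σ).left (ofAdd (J.diff X m x z)) : L)) (c σ).right) := by
    intro c σ
    obtain ⟨u, hu⟩ := isUnit_monomialMatrix (G := G)
      (fun x => ((c σ).left (ofAdd (J.diff X m x z)) : L)) (fun x => Units.ne_zero _) (c σ).right
    rw [← hu]
    refine IsUnit.of_mul_eq_one ((1 : Matrix (Fin k) (Fin k) L) ⊗ₖ (↑u⁻¹ : Matrix X X L)) ?_
    rw [← Matrix.mul_kronecker_mul, one_mul, Units.mul_inv, Matrix.one_kronecker_one]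
  -- `P` and `p_σ σ(P) p'_σ⁻¹` both intertwine `f₂` with `f₁`, so they are proportional by Schur's
  -- lemma.
  have hl : ∀ σ, ∃ l : L, p σ * P.map σ = l • (P * p' σ) := by
    intro σ
    obtain ⟨u, hu⟩ := hu (c := c') σ
    change (u : Matrix _ _ L) = p' σ at hu
    have h1 : ∀ s, f₁ s * (p σ * P.map σ * (↑u⁻¹ : Matrix _ _ L)) =
        (p σ * P.map σ * (↑u⁻¹ : Matrix _ _ L)) * f₂ s := by
      intro s
      have h2 : (f₂ s).map σ * (↑u⁻¹ : Matrix _ _ L) = (↑u⁻¹ : Matrix _ _ L) * f₂ s := by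
        rw [Units.mul_inv_eq_iff_eq_mul, mul_assoc, hu, hp', ← hu, Units.inv_mul_cancel_left]
      calc f₁ s * (p σ * P.map σ * (↑u⁻¹ : Matrix _ _ L))
          = (f₁ s * p σ) * P.map σ * (↑u⁻¹ : Matrix _ _ L) := by simp only [mul_assoc]
        _ = p σ * (f₁ s * P).map σ * (↑u⁻¹ : Matrix _ _ L) := by
          rw [hp, map_galois_mul]; simp only [mul_assoc]
        _ = p σ * P.map σ * ((f₂ s).map σ * (↑u⁻¹ : Matrix _ _ L)) := by
          rw [hP, map_galois_mul]; simp only [mul_assoc]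
        _ = _ := by rw [h2]; simp only [mul_assoc]
    have h3 : ∀ s, f₂ s * (Q * (p σ * P.map σ * (↑u⁻¹ : Matrix _ _ L))) =
        Q * (p σ * P.map σ * (↑u⁻¹ : Matrix _ _ L)) * f₂ s := by
      intro s
      have h4 : f₂ s * Q = Q * f₁ s := by
        calc f₂ s * Q = Q * P * f₂ s * Q := by rw [hQP, one_mul]
          _ = Q * (f₁ s * P) * Q := by rw [hP]; simp only [mul_assoc]
          _ = Q * f₁ s * (P * Q) := by simp only [mul_assoc]
          _ = _ := by rw [hPQ, mul_one]
      rw [← mul_assoc, h4, mul_assoc, h1, ← mul_assoc]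
    obtain ⟨l, hl⟩ := h₂.exists_scalar h3
    refine ⟨l, ?_⟩
    calc p σ * P.map σ = (P * Q) * (p σ * P.map σ * (↑u⁻¹ : Matrix _ _ L)) * (u : Matrix _ _ L) := by
          rw [hPQ, one_mul, Units.inv_mul_cancel_right]
      _ = P * (Q * (p σ * P.map σ * (↑u⁻¹ : Matrix _ _ L))) * (u : Matrix _ _ L) := by simp only [mul_assoc]
      _ = l • (P * p' σ) := by rw [hl, hu, mul_smul_comm, mul_one, smul_mul_assoc]
  choose l hl using hl
  have hP0 : P ≠ 0 := by
    rintro rfl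
    rw [zero_mul] at hPQ
    exact zero_ne_one hPQ
  refine ⟨P, l, hP0, fun σ h0 => ?_, fun σ i x j y => ?_⟩
  · have h1 := hl σ
    rw [h0, zero_smul] at h1
    have h2 : P.map σ = 0 := (hu (c := c) σ).mul_left_cancel (by rw [mul_zero]; exact h1)
    apply hP0
    refine Matrix.ext fun a b => ?_
    have h3 := congrFun (congrFun h2 a) b
    simpa using h3
  · have h1 := congrFun (congrFun (hl σ) (i, x)) (j, (c' σ).right⁻¹ • y)
    rw [Matrix.smul_apply, kronecker_monomial_mul_apply, mul_kronecker_monomial_apply,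
      smul_inv_smul, Matrix.map_apply] at h1
    rw [h1, smul_eq_mul]
    ring

/-- If the twisted forms are Brauer equivalent, the cocycles agree on differences up to a
coboundary. -/
theorem exists_diff_ratio [Nonempty X] (hr : ∀ σ, (c' σ).right = (c σ).right)
    (hf : c.IsTwist f) (hf' : c'.IsTwist f')
    {k : ℕ} (hk : k ≠ 0) (e : Matrix (Fin k) (Fin k) S ≃ₐ[F] Matrix (Fin k) (Fin k) S') :
    ∃ D : X → (SeparableClosure F)ˣ, ∀ σ x y,
      ((c' σ).left (ofAdd (J.diff X m x y)) : SeparableClosure F) * (D x * σ (D ((c σ).right⁻¹ • y))) =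
        (c σ).left (ofAdd (J.diff X m x y)) * (D y * σ (D ((c σ).right⁻¹ • x))) := by
  obtain ⟨z⟩ := ‹Nonempty X›
  have : Nonempty X := ⟨z⟩
  obtain ⟨P, l, hP0, hl0, hP⟩ := exists_projective_intertwiner hf hf' hk e z
  -- Fixing `i` and `j` leaves an `X × X` block of `P` that satisfies the same equivariance; one
  -- nonzero entry of it suffices to determine the behaviour of `l`.
  obtain ⟨⟨i, x₀⟩, ⟨j, y₀⟩, hP0⟩ : ∃ a b, P a b ≠ 0 := by
    by_contra! h
    exact hP0 (Matrix.ext h)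
  let s : AbsGal F → X → SeparableClosure F := fun σ x => (c σ).left (ofAdd (J.diff X m x z))
  let s' : AbsGal F → X → SeparableClosure F := fun σ x => (c' σ).left (ofAdd (J.diff X m x z))
  have hs0 : ∀ σ x, s σ x ≠ 0 := fun σ x => Units.ne_zero _
  have hs0' : ∀ σ x, s' σ x ≠ 0 := fun σ x => Units.ne_zero _
  have hmul : ∀ (c : Cocycle (AbsGal F) (TorusSemidirect X m G (SeparableClosure F))) σ τ x,
      ((c (σ * τ)).left (ofAdd (J.diff X m x z)) : SeparableClosure F) =
      (c σ).left (ofAdd (J.diff X m x z)) *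
        σ ((c τ).left (ofAdd (J.diff X m ((c σ).right⁻¹ • x) z))) *
        σ ((c τ).left (ofAdd (J.diff X m z ((c σ).right⁻¹ • z)))) := by
    intro c σ τ x
    rw [c.left_mul, J.act_diff, ← J.diff_add m ((c σ).right⁻¹ • x) z ((c σ).right⁻¹ • z), ofAdd_add, map_mul,
      Units.val_mul, map_mul]
    ring
  -- The defect of `x ↦ t_σ(x - z)` from being a cocycle, caused by the motion of `z`. It does not
  -- depend on `x`.
  let a : AbsGal F → AbsGal F → SeparableClosure F := fun σ τ =>
    σ ((c τ).left (ofAdd (J.diff X m z ((c σ).right⁻¹ • z))))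
  let a' : AbsGal F → AbsGal F → SeparableClosure F := fun σ τ =>
    σ ((c' τ).left (ofAdd (J.diff X m z ((c σ).right⁻¹ • z))))
  have ha0 : ∀ σ τ, a σ τ ≠ 0 := fun σ τ => by simp [a]
  have ha0' : ∀ σ τ, a' σ τ ≠ 0 := fun σ τ => by simp [a']
  have hsm : ∀ σ τ x, s (σ * τ) x = s σ x * σ (s τ ((c σ).right⁻¹ • x)) * a σ τ := hmul c
  have hsm' : ∀ σ τ x, s' (σ * τ) x = s' σ x * σ (s' τ ((c σ).right⁻¹ • x)) * a' σ τ := by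
    intro σ τ x
    have := hmul c' σ τ x
    rw [hr] at this
    exact this
  have hP' : ∀ σ x y, l σ * s' σ y * P (i, x) (j, y) =
      s σ x * σ (P (i, (c σ).right⁻¹ • x) (j, (c σ).right⁻¹ • y)) := by
    intro σ x y
    have := hP σ i x j y
    rwa [hr] at this
  -- Expanding the equivariance of the nonzero entry under `σ τ` in two ways shows that the defect
  -- of `l` is the ratio of the two defects `a'` and `a`.
  have hlm : ∀ σ τ, l (σ * τ) * a' σ τ = l σ * σ (l τ) * a σ τ := by
    intro σ τ
    have h1 := hP' (σ * τ) x₀ y₀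
    have h2 := congrArg σ (hP' τ ((c σ).right⁻¹ • x₀) ((c σ).right⁻¹ • y₀))
    have h3 := hP' σ x₀ y₀
    rw [show (c (σ * τ)).right = (c σ).right * (c τ).right from c.rightHom.map_mul σ τ,
      _root_.mul_inv_rev, mul_smul, mul_smul, hsm, hsm', AlgEquiv.mul_apply] at h1
    simp only [map_mul] at h2
    have hA : s σ x₀ * σ (s τ ((c σ).right⁻¹ • x₀)) ≠ 0 :=
      mul_ne_zero (hs0 _ _) (by simpa using hs0 _ _)
    have hB : s' σ y₀ * σ (s' τ ((c σ).right⁻¹ • y₀)) * P (i, x₀) (j, y₀) ≠ 0 :=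
      mul_ne_zero (mul_ne_zero (hs0' _ _) (by simpa using hs0' _ _)) hP0
    apply mul_right_cancel₀ hB
    calc l (σ * τ) * a' σ τ * (s' σ y₀ * σ (s' τ ((c σ).right⁻¹ • y₀)) * P (i, x₀) (j, y₀))
        = l (σ * τ) * (s' σ y₀ * σ (s' τ ((c σ).right⁻¹ • y₀)) * a' σ τ) * P (i, x₀) (j, y₀) := by
          ring
      _ = a σ τ * s σ x₀ * (σ (s τ ((c σ).right⁻¹ • x₀)) *
          σ (τ (P (i, (c τ).right⁻¹ • (c σ).right⁻¹ • x₀)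
            (j, (c τ).right⁻¹ • (c σ).right⁻¹ • y₀)))) := by rw [h1]; ring
      _ = a σ τ * (σ (l τ) * σ (s' τ ((c σ).right⁻¹ • y₀))) *
          (s σ x₀ * σ (P (i, (c σ).right⁻¹ • x₀) (j, (c σ).right⁻¹ • y₀))) := by rw [← h2]; ring
      _ = _ := by rw [← h3]; ring
  -- The defects cancel in `l⁻¹ s / s'`, a genuine cocycle in the units of the twisted form of
  -- `L^X`. In ratios at `x` and `y` both `l` and the base point drop out.
  obtain ⟨D, hD0, hD⟩ := exists_invariant_unit (Y := X) c.rightHom c.eventually_rightHom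
    (fun σ x => (l σ)⁻¹ * s σ x * (s' σ x)⁻¹)
    (fun σ x => mul_ne_zero (mul_ne_zero (inv_ne_zero (hl0 σ)) (hs0 σ x)) (inv_ne_zero (hs0' σ x)))
    (fun σ τ x => by
      rw [rightHom_apply, hsm, hsm']
      simp only [map_mul, map_inv₀]
      have h1 : (l (σ * τ))⁻¹ = a' σ τ * (l σ * σ (l τ) * a σ τ)⁻¹ := by
        rw [← hlm, mul_inv, mul_comm (a' σ τ), inv_mul_cancel_right₀ (ha0' σ τ)]
      rw [h1]
      simp only [mul_inv]
      calc _ = (a' σ τ * (a' σ τ)⁻¹) * (a σ τ * (a σ τ)⁻¹) * ((l σ)⁻¹ * s σ x * (s' σ x)⁻¹ *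
            ((σ (l τ))⁻¹ * σ (s τ ((c σ).right⁻¹ • x)) * (σ (s' τ ((c σ).right⁻¹ • x)))⁻¹)) := by
            ring
        _ = _ := by rw [mul_inv_cancel₀ (ha0 σ τ), mul_inv_cancel₀ (ha0' σ τ), one_mul, one_mul])
    (by
      filter_upwards [c.eventually_eq_one, c'.eventually_eq_one,
        eventually_apply_eq (F := F) (P (i, x₀) (j, y₀))] with σ h1 h2 h3
      have h4 : ∀ x, s σ x = 1 := fun x => by simp [s, h1]
      have h5 : ∀ x, s' σ x = 1 := fun x => by simp [s', h2]
      have h6 := hP' σ x₀ y₀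
      rw [h4, h5, h1, SemidirectProduct.one_right, inv_one, one_smul, one_smul, h3, mul_one] at h6
      have h7 : l σ = 1 := mul_right_cancel₀ hP0 h6
      funext x
      simp [h4, h5, h7])
  refine ⟨fun x => Units.mk0 (D x) (hD0 x), fun σ x y => ?_⟩
  have hdiff : ∀ (t : TorusPoints X m (SeparableClosure F)),
      (t (ofAdd (J.diff X m x y)) : SeparableClosure F) * t (ofAdd (J.diff X m y z)) =
        t (ofAdd (J.diff X m x z)) := fun t => by
    rw [← Units.val_mul, ← map_mul, ← ofAdd_add, J.diff_add]
  have h1 : ((c σ).left (ofAdd (J.diff X m x y)) : SeparableClosure F) * s σ y = s σ x := hdiff _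
  have h2 : ((c' σ).left (ofAdd (J.diff X m x y)) : SeparableClosure F) * s' σ y = s' σ x := hdiff _
  have h3 := hD σ x
  have h4 := hD σ y
  rw [rightHom_apply] at h3 h4
  simp only [Units.val_mk0]
  rw [← h3, ← h4, ← h1, ← h2]
  have := hs0' σ y
  have := hs0 σ y
  have := hl0 σ
  have : ((c' σ).left (ofAdd (J.diff X m x y)) : SeparableClosure F) ≠ 0 := Units.ne_zero _
  field_simp

/-- Two cocycles with the same image in `Hom(Gal, G)` and Brauer equivalent twisted forms are
cohomologous. -/
theorem exists_cohomologous [Nonempty X] (hr : ∀ σ, (c' σ).right = (c σ).right)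
    (hf : c.IsTwist f) (hf' : c'.IsTwist f')
    {k : ℕ} (hk : k ≠ 0) (e : Matrix (Fin k) (Fin k) S ≃ₐ[F] Matrix (Fin k) (Fin k) S') :
    ∃ a : TorusSemidirect X m G (SeparableClosure F), ∀ σ, c' σ = a⁻¹ * c σ * σ • a := by
  obtain ⟨z⟩ := ‹Nonempty X›
  have : Nonempty X := ⟨z⟩
  obtain ⟨D, hD⟩ := exists_diff_ratio hr hf hf' hk e
  let d : TorusPoints X m (SeparableClosure F) := torusOfFun m D
  let gal : AbsGal F → (SeparableClosure F)ˣ →* (SeparableClosure F)ˣ := fun σ =>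
    Units.map (σ : SeparableClosure F →* SeparableClosure F)
  let tw : AbsGal F → TorusPoints X m (SeparableClosure F) → TorusPoints X m (SeparableClosure F) :=
    fun σ t => (gal σ).comp (torusAct X m G _ (c σ).right t)
  have htw : ∀ σ t j, tw σ t (ofAdd j) = gal σ (t (ofAdd (J.act m (c σ).right⁻¹ j))) :=
    fun _ _ _ => rfl
  have hcm : ∀ σ τ j, (c (σ * τ)).left (ofAdd j) = (c σ).left (ofAdd j) *
      gal σ ((c τ).left (ofAdd (J.act m (c σ).right⁻¹ j))) := by
    intro σ τ j
    rw [c.map_mul', SemidirectProduct.mul_left]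
    rfl
  have hcm' : ∀ σ τ j, (c' (σ * τ)).left (ofAdd j) = (c' σ).left (ofAdd j) *
      gal σ ((c' τ).left (ofAdd (J.act m (c σ).right⁻¹ j))) := by
    intro σ τ j
    rw [c'.map_mul', SemidirectProduct.mul_left, ← hr]
    rfl
  have hdm : ∀ σ τ j, gal (σ * τ) (d (ofAdd (J.act m (c (σ * τ)).right⁻¹ j))) =
      gal σ (gal τ (d (ofAdd (J.act m (c τ).right⁻¹ (J.act m (c σ).right⁻¹ j))))) := by
    intro σ τ j
    rw [show (c (σ * τ)).right = (c σ).right * (c τ).right from c.rightHom.map_mul σ τ,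
      _root_.mul_inv_rev, J.act_mul]
    rfl
  -- The discrepancy left between `c'` and `c` after the coboundary of `d` is taken into account; it
  -- is a cocycle in the twisted torus.
  let χ : AbsGal F → TorusPoints X m (SeparableClosure F) := fun σ =>
    { toFun := fun j => (c' σ).left j * d j * ((c σ).left j * tw σ d j)⁻¹
      map_one' := by simp only [_root_.map_one, mul_one, inv_one]
      map_mul' := fun i j => by
        simp only [map_mul]
        exact mul_mul_inv_mul_distrib _ _ _ _ _ _ _ _ }
  have hχapp : ∀ σ j, χ σ (ofAdd j) = (c' σ).left (ofAdd j) * d (ofAdd j) *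
      ((c σ).left (ofAdd j) * gal σ (d (ofAdd (J.act m (c σ).right⁻¹ j))))⁻¹ := fun _ _ => rfl
  have hχmul : ∀ σ τ j, χ (σ * τ) (ofAdd j) =
      χ σ (ofAdd j) * gal σ (χ τ (ofAdd (J.act m (c σ).right⁻¹ j))) := by
    intro σ τ j
    rw [hχapp, hχapp, hχapp, hcm, hcm', hdm]
    rw [map_mul (gal σ), map_mul (gal σ), map_inv, map_mul (gal σ)]
    exact mul_mul_inv_mul_cancel _ _ _ _ _ _ _
  have hχ : ∀ σ x y, χ σ (ofAdd (J.diff X m x y)) = 1 := by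
    intro σ x y
    rw [hχapp, J.act_diff]
    simp only [d, torusOfFun_diff, map_div]
    rw [mul_inv_eq_one]
    have h := hD σ x y
    rw [mul_div_assoc', mul_div_assoc', div_eq_div_iff_mul_eq_mul]
    apply Units.ext
    simp only [Units.val_mul, gal, Units.coe_map]
    rw [mul_assoc, mul_assoc]
    rw [mul_comm ((σ : SeparableClosure F →* SeparableClosure F) _)]
    exact h
  -- Being trivial on differences, `χ σ` takes the same value at `m z` and at `m (g z)`. Hence its
  -- value `κ` there is an untwisted cocycle in the units of the separable closure.
  have hact : ∀ σ (g : G), χ σ (ofAdd (J.act m g (J.mulSingle m z))) =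
      χ σ (ofAdd (J.mulSingle m z)) := by
    intro σ g
    rw [J.act_mulSingle, J.mulSingle_eq (g • z) z, ofAdd_add, map_mul, ofAdd_nsmul, map_pow, hχ,
      one_pow, one_mul]
  let κ : AbsGal F → (SeparableClosure F)ˣ := fun σ => χ σ (ofAdd (J.mulSingle m z))
  have hκ : ∀ σ τ, κ (σ * τ) = κ σ * gal σ (κ τ) := by
    intro σ τ
    simp only [κ]
    rw [hχmul, hact]
  -- Classical Hilbert 90, as the case of a one-point set.
  obtain ⟨β, hβ0, hβ⟩ := exists_invariant_unit (Y := PUnit.{1}) c.rightHom c.eventually_rightHom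
    (fun σ _ => (κ σ : SeparableClosure F)) (fun σ _ => Units.ne_zero _)
    (fun σ τ _ => by
      rw [hκ]
      rfl)
    (by
      have hd : ∀ᶠ σ : AbsGal F in 𝓝 1, ∀ x, σ (D x : SeparableClosure F) = D x :=
        eventually_comp_eq (F := F) fun x => (D x : SeparableClosure F)
      filter_upwards [c.eventually_eq_one, c'.eventually_eq_one, hd] with σ h1 h2 h3
      funext y
      have h4 : tw σ d = d := by
        refine MonoidHom.ext fun j => ?_
        have h5 := htw σ d j.toAdd
        rw [h1, SemidirectProduct.one_right, inv_one, J.act_one] at h5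
        refine h5.trans ?_
        simp only [d, torusOfFun_apply, map_prod, map_zpow]
        refine Finset.prod_congr rfl fun x _ => ?_
        rw [show gal σ (D x) = D x from Units.ext (h3 x)]
      have h6 : κ σ = 1 := by
        change (c' σ).left _ * d _ * ((c σ).left _ * tw σ d _)⁻¹ = 1
        rw [h4, h1, h2]
        exact mul_inv_cancel _
      rw [h6]
      rfl)
  let b : (SeparableClosure F)ˣ := (Units.mk0 (β PUnit.unit) (hβ0 _))⁻¹
  have hb : ∀ σ, κ σ = b⁻¹ * gal σ b := by
    intro σ
    rw [show gal σ b = (gal σ (Units.mk0 (β PUnit.unit) (hβ0 _)))⁻¹ from map_inv _ _,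
      eq_mul_inv_iff_mul_eq, inv_inv]
    apply Units.ext
    exact hβ σ PUnit.unit
  -- The degree is `G`-invariant, so the twisted coboundary of `b ^ deg` is `κ ^ deg = χ`.
  let ε : TorusPoints X m (SeparableClosure F) :=
    { toFun := fun j => b ^ J.deg X m j.toAdd
      map_one' := by simp
      map_mul' := fun i j => by simp [_root_.zpow_add] }
  have hε : ∀ σ j, χ σ (ofAdd j) = (ε (ofAdd j))⁻¹ * gal σ (ε (ofAdd (J.act m (c σ).right⁻¹ j))) := by
    intro σ j
    rw [map_eq_zpow_of_diff (χ σ) (hχ σ) z j]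
    change κ σ ^ _ = (b ^ J.deg X m j)⁻¹ * gal σ (b ^ J.deg X m (J.act m (c σ).right⁻¹ j))
    rw [hb, _root_.mul_zpow, _root_.inv_zpow, J.deg_act, map_zpow]
  refine ⟨⟨d * ε, 1⟩, fun σ => ?_⟩
  rw [mul_assoc, eq_inv_mul_iff_mul_eq]
  refine SemidirectProduct.ext (MonoidHom.ext fun j => ?_) ?_
  · have h1 := hε σ j.toAdd
    rw [hχapp, mul_inv_eq_iff_eq_mul] at h1
    rw [SemidirectProduct.mul_left, SemidirectProduct.mul_left, _root_.map_one, MulAut.one_apply]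
    change d (ofAdd j.toAdd) * ε (ofAdd j.toAdd) * (c' σ).left (ofAdd j.toAdd) =
      (c σ).left (ofAdd j.toAdd) * gal σ (d (ofAdd (J.act m (c σ).right⁻¹ j.toAdd)) *
        ε (ofAdd (J.act m (c σ).right⁻¹ j.toAdd)))
    rw [mul_right_comm, mul_comm (d _), h1, map_mul]
    generalize ε (ofAdd (toAdd j)) = y
    rw [mul_assoc y⁻¹, mul_right_comm, inv_mul_cancel, one_mul, mul_left_comm,
      mul_comm (gal σ (d _))]
  · rw [SemidirectProduct.mul_right, SemidirectProduct.mul_right, smul_right, one_mul, mul_one, hr]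

end Ratio

end Cocycle

end Injectivity

end TorusBrauer
end

noncomputable section
namespace TorusBrauer

/-! ### Projective cocycles -/

section Projective

open Topology Matrix
open scoped Kronecker

variable {F L : Type*} [Field F] [Field L] [Algebra F L] [IsGalois F L]
  {ι κ : Type*} [Fintype ι] [DecidableEq ι] [Fintype κ] [DecidableEq κ]
  {A : Type*} [Ring A] [Algebra F A] [Module.Finite F A]
  {B : Type*} [Ring B] [Algebra F B] [Module.Finite F B]

/-- Forms with inverse projective cocycles have a split tensor product. -/
theorem isSplit_tensor_of_projective [Nonempty ι] [Nonempty κ] {f : A →ₐ[F] Matrix ι ι L}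
    (hf : IsForm L f) {g : B →ₐ[F] Matrix κ κ L} (hg : IsForm L g)
    (p : Gal(L/F) → Matrix ι ι L) (q : Gal(L/F) → Matrix κ κ L) (a : Gal(L/F) → Gal(L/F) → L)
    (ha : ∀ σ τ, a σ τ ≠ 0)
    (hpmul : ∀ σ τ, p σ * (p τ).map σ = a σ τ • p (σ * τ))
    (hqmul : ∀ σ τ, q σ * (q τ).map σ = (a σ τ)⁻¹ • q (σ * τ))
    (hp : ∀ᶠ σ in 𝓝 1, p σ = 1) (hq : ∀ᶠ σ in 𝓝 1, q σ = 1)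
    (hpf : ∀ σ s, p σ * (f s).map σ = f s * p σ)
    (hqg : ∀ σ s, q σ * (g s).map σ = g s * q σ) : IsSplit F (A ⊗[F] B) := by
  have hmap : ∀ (σ : Gal(L/F)) (M : Matrix ι ι L) (N : Matrix κ κ L),
      (M ⊗ₖ N).map σ = M.map σ ⊗ₖ N.map σ := fun σ M N => by
    refine Matrix.ext fun x y => ?_
    simp [Matrix.kroneckerMap_apply]
  refine isSplit_of_cocycle (hf.kroneckerHom hg) (fun σ => p σ ⊗ₖ q σ) (fun σ τ => ?_) ?_
    fun σ s => ?_
  · rw [hmap, ← Matrix.mul_kronecker_mul, hpmul, hqmul, Matrix.smul_kronecker,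
      Matrix.kronecker_smul, smul_smul, mul_inv_cancel₀ (ha σ τ), one_smul]
  · filter_upwards [hp, hq] with σ h1 h2
    rw [h1, h2, Matrix.one_kronecker_one]
  · induction s using TensorProduct.induction_on with
    | zero =>
      rw [map_zero, zero_mul, Matrix.map_zero _ (map_zero σ), mul_zero]
    | tmul s t =>
      rw [kroneckerHom_tmul, hmap, ← Matrix.mul_kronecker_mul, ← Matrix.mul_kronecker_mul, hpf, hqg]
    | add s t hs ht =>
      rw [map_add, Matrix.map_add _ (map_add σ), mul_add, add_mul, hs, ht]

omit [IsGalois F L] [DecidableEq ι] [Fintype ι] in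
theorem map_piKronecker (m : ℕ) (σ : Gal(L/F)) (M : Fin m → Matrix ι ι L) :
    (piKronecker F ι m M).map σ = piKronecker F ι m fun i => (M i).map σ := by
  refine Matrix.ext fun x y => ?_
  simp [piKronecker_apply]

omit [IsGalois F L] [DecidableEq ι] [Fintype ι] in
theorem piKronecker_smul_const (m : ℕ) (a : L) (M : Matrix ι ι L) :
    (piKronecker F ι m fun _ => a • M) = a ^ m • piKronecker F ι m fun _ => M := by
  refine Matrix.ext fun x y => ?_
  simp [piKronecker_apply, Finset.prod_mul_distrib]

omit [IsGalois F L] in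
theorem isForm_ofId : IsForm L (Algebra.ofId F L) := by
  refine isForm_of_span _ ?_ (by simp)
  rw [eq_top_iff]
  intro x _
  have h := Submodule.smul_mem (Submodule.span L (Set.range (Algebra.ofId F L))) x
    (Submodule.subset_span ⟨1, map_one _⟩)
  simpa using h

/-- If the tensor power `A^{⊗ m}` is split, a projective cocycle for `A` can be chosen with values
of the factor set in the `m`-th roots of unity. -/
theorem exists_rescaled_projective [IsSepClosed L] {m : ℕ} (hm : (m : L) ≠ 0) [Nonempty ι]
    {f : A →ₐ[F] Matrix ι ι L} (hf : IsForm L f) (hA : IsSplit F (⨂[F] _ : Fin m, A))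
    (q q' : Gal(L/F) → Matrix ι ι L) (hqq : ∀ σ, q σ * q' σ = 1) (hq : ∀ᶠ σ in 𝓝 1, q σ = 1)
    (hqf : ∀ σ s, q σ * (f s).map σ = f s * q σ) :
    ∃ (p p' : Gal(L/F) → Matrix ι ι L) (a : Gal(L/F) → Gal(L/F) → L),
      (∀ σ, p σ * p' σ = 1) ∧ (∀ᶠ σ in 𝓝 1, p σ = 1) ∧
      (∀ σ s, p σ * (f s).map σ = f s * p σ) ∧ (∀ σ τ, a σ τ ^ m = 1) ∧
      ∀ σ τ, p σ * (p τ).map σ = a σ τ • p (σ * τ) := by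
  obtain ⟨N, hN, ⟨e⟩⟩ := hA
  have : NeZero N := ⟨hN⟩
  let g : (⨂[F] _ : Fin m, A) →ₐ[F] Matrix (Fin N) (Fin N) L :=
    ((Algebra.ofId F L).mapMatrix).comp (e : _ →ₐ[F] Matrix (Fin N) (Fin N) F)
  have hg : IsForm L g := isForm_ofId.mapMatrix.comp_algEquiv_left e
  have hgσ : ∀ (σ : Gal(L/F)) s, (g s).map σ = g s := fun σ s =>
    Matrix.ext fun x y => σ.commutes (e s x y)
  obtain ⟨R, R', hR, hR', hfR⟩ := (hf.piKroneckerHom m).exists_conj hg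
  let T : Matrix ι ι L → Matrix (Fin m → ι) (Fin m → ι) L := fun M => piKronecker F ι m fun _ => M
  have hTmul : ∀ M M', T (M * M') = T M * T M' := fun M M' => piKronecker_mul m _ _
  have hTone : T 1 = 1 := piKronecker_one m
  have hT : ∀ σ s, T (q σ) * (piKroneckerHom m f s).map σ = piKroneckerHom m f s * T (q σ) := by
    intro σ s
    induction s using PiTensorProduct.induction_on with
    | add s s' h h' => rw [map_add, Matrix.map_add _ (map_add σ), mul_add, add_mul, h, h']
    | smul_tprod r s =>
      have h1 : ((piKroneckerHom m f) (r • PiTensorProduct.tprod F s)).map σ =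
          r • ((piKroneckerHom m f) (PiTensorProduct.tprod F s)).map σ := by
        rw [map_smul]
        refine Matrix.ext fun x y => ?_
        simp
      rw [h1, map_smul, mul_smul_comm, smul_mul_assoc, piKroneckerHom_tprod, map_piKronecker]
      congr 1
      rw [← piKronecker_mul, ← piKronecker_mul]
      congr 1
      funext i
      exact hqf σ (s i)
  -- `R` identifies the tensor power of `f` with the Galois-fixed embedding `g`, so `R⁻¹ T(q_σ)
  -- σ(R)` commutes with `g`.
  have hl : ∀ σ, ∃ l : L, T (q σ) * R.map σ = l • R := by
    intro σ
    have h1 : ∀ s, g s * (R' * (T (q σ) * R.map σ)) = R' * (T (q σ) * R.map σ) * g s := by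
      intro s
      have h2 : g s * R' = R' * piKroneckerHom m f s := by
        calc g s * R' = (R' * R) * g s * R' := by rw [hR', one_mul]
          _ = R' * (R * g s) * R' := by simp only [Matrix.mul_assoc]
          _ = R' * piKroneckerHom m f s * (R * R') := by rw [← hfR]; simp only [Matrix.mul_assoc]
          _ = _ := by rw [hR, Matrix.mul_one]
      calc g s * (R' * (T (q σ) * R.map σ)) = R' * (piKroneckerHom m f s * T (q σ)) * R.map σ := by
            rw [← Matrix.mul_assoc, h2]; simp only [Matrix.mul_assoc]
        _ = R' * T (q σ) * (piKroneckerHom m f s * R).map σ := by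
            rw [← hT, map_galois_mul]; simp only [Matrix.mul_assoc]
        _ = _ := by rw [hfR, map_galois_mul, hgσ]; simp only [Matrix.mul_assoc]
    obtain ⟨l, hl⟩ := hg.exists_scalar h1
    refine ⟨l, ?_⟩
    calc T (q σ) * R.map σ = (R * R') * (T (q σ) * R.map σ) := by rw [hR, Matrix.one_mul]
      _ = R * (R' * (T (q σ) * R.map σ)) := by simp only [Matrix.mul_assoc]
      _ = l • R := by rw [hl, Matrix.mul_smul, Matrix.mul_one]
  choose l hl using hl
  have hR0 : R ≠ 0 := by
    rintro rfl
    rw [Matrix.zero_mul] at hR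
    exact zero_ne_one hR
  have hl0 : ∀ σ, l σ ≠ 0 := by
    intro σ h0
    have h1 := hl σ
    rw [h0, zero_smul] at h1
    have h2 : T (q' σ) * T (q σ) = 1 := by
      rw [← hTmul, mul_eq_one_comm.1 (hqq σ), hTone]
    have h3 : R.map σ = 0 := by
      rw [← Matrix.one_mul (R.map σ), ← h2, Matrix.mul_assoc, h1, Matrix.mul_zero]
    apply hR0
    refine Matrix.ext fun x y => ?_
    have h4 := congrFun (congrFun h3 x) y
    simpa using h4
  have : NeZero (m : L) := ⟨hm⟩
  -- The root of `1` is chosen to be `1`, so that dividing `q_σ` by `r (l σ)` keeps it equal to `1`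
  -- near the identity.
  have hroot : ∃ r : L → L, r 1 = 1 ∧ ∀ x, r x ^ m = x := by
    choose r hr using fun x : L => IsSepClosed.exists_pow_nat_eq x m
    classical
    refine ⟨fun x => if x = 1 then 1 else r x, by simp, fun x => ?_⟩
    by_cases hx : x = 1
    · simp [hx]
    · simp [hx, hr]
  obtain ⟨r, hr1, hr⟩ := hroot
  have hm0 : m ≠ 0 := by rintro rfl; exact hm (by simp)
  have hr0 : ∀ σ, r (l σ) ≠ 0 := fun σ h => hl0 σ (by rw [← hr (l σ), h, zero_pow hm0])
  let p : Gal(L/F) → Matrix ι ι L := fun σ => (r (l σ))⁻¹ • q σ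
  let p' : Gal(L/F) → Matrix ι ι L := fun σ => r (l σ) • q' σ
  have hpp : ∀ σ, p σ * p' σ = 1 := fun σ => by
    simp only [p, p']
    rw [smul_mul_smul_comm, inv_mul_cancel₀ (hr0 σ), one_smul, hqq]
  have hpp' : ∀ σ, p' σ * p σ = 1 := fun σ => mul_eq_one_comm.1 (hpp σ)
  have hpf : ∀ σ s, p σ * (f s).map σ = f s * p σ := fun σ s => by
    simp only [p]
    rw [smul_mul_assoc, hqf, mul_smul_comm]
  have hpR : ∀ σ, T (p σ) * R.map σ = R := fun σ => by
    simp only [p, T]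
    rw [piKronecker_smul_const, Matrix.smul_mul, hl, smul_smul, inv_pow, hr,
      inv_mul_cancel₀ (hl0 σ), one_smul]
  -- The matrices `p_σ σ(p_τ)` and `p_{στ}` induce the same Galois action on the form.
  have ha : ∀ σ τ, ∃ a : L, p σ * (p τ).map σ = a • p (σ * τ) := by
    intro σ τ
    have h1 : ∀ s, f s * (p σ * (p τ).map σ * p' (σ * τ)) =
        p σ * (p τ).map σ * p' (σ * τ) * f s := by
      intro s
      have h2 : (f s).map (σ * τ) * p' (σ * τ) = p' (σ * τ) * f s := by
        calc (f s).map (σ * τ) * p' (σ * τ)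
            = p' (σ * τ) * (p (σ * τ) * (f s).map (σ * τ)) * p' (σ * τ) := by
              rw [← mul_assoc, hpp', one_mul]
          _ = p' (σ * τ) * f s * (p (σ * τ) * p' (σ * τ)) := by rw [hpf]; simp only [mul_assoc]
          _ = _ := by rw [hpp, mul_one]
      have h3 : (f s).map (σ * τ) = ((f s).map τ).map σ := rfl
      calc f s * (p σ * (p τ).map σ * p' (σ * τ))
          = f s * p σ * (p τ).map σ * p' (σ * τ) := by simp only [mul_assoc]
        _ = p σ * (f s * p τ).map σ * p' (σ * τ) := by
          rw [← hpf, map_galois_mul]; simp only [mul_assoc]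
        _ = p σ * (p τ).map σ * ((f s).map (σ * τ) * p' (σ * τ)) := by
          rw [← hpf, map_galois_mul, h3]; simp only [mul_assoc]
        _ = _ := by rw [h2]; simp only [mul_assoc]
    obtain ⟨a, ha⟩ := hf.exists_scalar h1
    refine ⟨a, ?_⟩
    calc p σ * (p τ).map σ = p σ * (p τ).map σ * (p' (σ * τ) * p (σ * τ)) := by
          rw [hpp', mul_one]
      _ = p σ * (p τ).map σ * p' (σ * τ) * p (σ * τ) := by simp only [mul_assoc]
      _ = _ := by rw [ha, smul_mul_assoc, one_mul]
  choose a ha using ha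
  refine ⟨p, p', a, hpp, ?_, hpf, fun σ τ => ?_, ha⟩
  · have hRev : ∀ᶠ σ : Gal(L/F) in 𝓝 1, R.map σ = R := by
      filter_upwards [eventually_comp_eq (F := F)
        fun xy : (Fin m → ι) × Fin N => R xy.1 xy.2] with σ h
      exact Matrix.ext fun x y => h (x, y)
    filter_upwards [hq, hRev] with σ h1 h2
    have h3 : l σ = 1 := by
      have h4 := hl σ
      rw [h1, h2, hTone, Matrix.one_mul] at h4
      have h5 : (1 - l σ) • R = 0 := by rw [sub_smul, one_smul, ← h4, sub_self]
      exact (sub_eq_zero.1 ((smul_eq_zero.1 h5).resolve_right hR0)).symm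
    simp only [p]
    rw [h1, h3, hr1, inv_one, one_smul]
  -- After rescaling, `R` trivialises `σ ↦ T(p_σ)` exactly. The factor `a` enters through `T` as `a
  -- ^ m`, which must therefore be `1`.
  · have h1 : T (p σ * (p τ).map σ) * R.map (σ * τ) = R := by
      have h2 : R.map (σ * τ) = (R.map τ).map σ := rfl
      have h3 : T ((p τ).map σ) = (T (p τ)).map σ := (map_piKronecker m σ _).symm
      rw [hTmul, h2, h3, Matrix.mul_assoc, ← map_galois_mul, hpR, hpR]
    have h4 : T (a σ τ • p (σ * τ)) = a σ τ ^ m • T (p (σ * τ)) := piKronecker_smul_const m _ _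
    rw [ha, h4, Matrix.smul_mul, hpR] at h1
    have h5 : (a σ τ ^ m - 1) • R = 0 := by rw [sub_smul, one_smul, h1, sub_self]
    exact sub_eq_zero.1 ((smul_eq_zero.1 h5).resolve_right hR0)

omit [Module.Finite F A] [Module.Finite F B] in
/-- `A ⊗ Bᵒᵖ` and `B ⊗ Bᵒᵖ` being split, `A` and `B` are Brauer equivalent. -/
theorem exists_matrix_equiv_of_isSplit (h : IsSplit F (A ⊗[F] Bᵐᵒᵖ))
    (h' : IsSplit F (B ⊗[F] Bᵐᵒᵖ)) : ∃ k l : ℕ, k ≠ 0 ∧ l ≠ 0 ∧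
      Nonempty (Matrix (Fin k) (Fin k) A ≃ₐ[F] Matrix (Fin l) (Fin l) B) := by
  obtain ⟨l, hl, ⟨e⟩⟩ := h
  obtain ⟨k, hk, ⟨e'⟩⟩ := h'
  refine ⟨k, l, hk, hl, ⟨?_⟩⟩
  -- `M_k(A) ≃ A ⊗ (Bᵒᵖ ⊗ B) ≃ (A ⊗ Bᵒᵖ) ⊗ B ≃ M_l(B)`.
  exact (matrixEquivTensor (Fin k) F A).trans <|
    (Algebra.TensorProduct.congr AlgEquiv.refl
      (e'.symm.trans (Algebra.TensorProduct.comm F B Bᵐᵒᵖ))).trans <|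
    (Algebra.TensorProduct.assoc F F F A Bᵐᵒᵖ B).symm.trans <|
    (Algebra.TensorProduct.congr e AlgEquiv.refl).trans <|
    (Algebra.TensorProduct.comm F _ B).trans (matrixEquivTensor (Fin l) F B).symm

end Projective

end TorusBrauer
end

noncomputable section
namespace TorusBrauer

/-! ### Cocycles from split algebras -/

section Family

open Topology Matrix

variable {F L : Type*} [Field F] [Field L] [Algebra F L] [IsGalois F L]
  {X G : Type*} [Group G] [MulAction G X] [Fintype X] [DecidableEq X]
  {A : Type*} [Ring A] [Algebra F A] [Module.Finite F A] (γ : Gal(L/F) →* G)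

/-- An algebra split by a twisted form of `F^X` has an equivariant family of forms. -/
theorem exists_family_of_isSplit [Nonempty X] (hγ : ∀ᶠ σ in 𝓝 1, γ σ = 1)
    (hA : IsSplit (twistFun X γ) (twistFun X γ ⊗[F] A)) :
    ∃ (d : ℕ) (_ : d ≠ 0) (θ : X → A →ₐ[F] Matrix (Fin d) (Fin d) L), (∀ x, IsForm L (θ x)) ∧
      ∀ σ x s, θ (γ σ • x) s = (θ x s).map σ := by
  obtain ⟨d, hd, ⟨e⟩⟩ := hA
  let K := twistFun X γ
  let ev : X → K →ₐ[F] L := fun x => (Pi.evalAlgHom F (fun _ : X => L) x).comp K.val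
  let eF : K ⊗[F] A →ₐ[F] Matrix (Fin d) (Fin d) K := (e.restrictScalars F).toAlgHom
  let θ : X → A →ₐ[F] Matrix (Fin d) (Fin d) L := fun x =>
    ((ev x).mapMatrix.comp eF).comp Algebra.TensorProduct.includeRight
  have hθ : ∀ x s, θ x s = (e (1 ⊗ₜ s)).map (ev x) := fun _ _ => rfl
  have hK : Module.Finite F K := (twistFun_isForm γ hγ).1
  have hfin : Module.finrank F A = d ^ 2 := by
    have h1 := (e.restrictScalars F).toLinearEquiv.finrank_eq
    rw [Module.finrank_tensorProduct, Module.finrank_matrix, finrank_twistFun γ hγ, mul_comm,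
      Fintype.card_fin] at h1
    rw [Nat.eq_of_mul_eq_mul_right Fintype.card_pos h1, sq]
  refine ⟨d, hd, θ, fun x => isForm_matrix_of_span _ ?_ (by rw [hfin, Fintype.card_fin]),
    fun σ x s => ?_⟩
  · have key : ∀ z, (e z).map (ev x) ∈ Submodule.span L (Set.range (θ x)) := by
      intro z
      induction z using TensorProduct.induction_on with
      | zero => rw [map_zero, Matrix.map_zero _ (map_zero _)]; exact Submodule.zero_mem _
      | add z w hz hw =>
        rw [map_add, Matrix.map_add _ (map_add _)]
        exact Submodule.add_mem _ hz hw
      | tmul k s =>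
        have h1 : (e (k ⊗ₜ s)).map (ev x) = ev x k • θ x s := by
          rw [hθ, show k ⊗ₜ[F] s = k • ((1 : K) ⊗ₜ[F] s) by
            rw [TensorProduct.smul_tmul', smul_eq_mul, mul_one], map_smul]
          refine Matrix.ext fun i j => ?_
          simp
        rw [h1]
        exact Submodule.smul_mem _ _ (Submodule.subset_span ⟨s, rfl⟩)
    rw [eq_top_iff]
    intro M _
    rw [Matrix.matrix_eq_sum_single M]
    refine Submodule.sum_mem _ fun i _ => Submodule.sum_mem _ fun j _ => ?_
    have h2 := Submodule.smul_mem _ (M i j) (key (e.symm (Matrix.single i j 1)))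
    rw [e.apply_symm_apply, Matrix.map_single _ _ _ (ev x), map_one, Matrix.smul_single,
      smul_eq_mul, mul_one] at h2
    exact h2
  · refine Matrix.ext fun i j => ?_
    -- The entries lie in the twisted form of `L^X`; its defining condition is the equivariance of
    -- the family.
    exact (e (1 ⊗ₜ s) i j).2 σ x

/-- The projective cocycle and the monomial factors attached to an algebra which is split by a
twisted form of `F^X` and whose `m`-th tensor power is split. -/
theorem exists_projective_of_isSplit [IsSepClosed L] {m : ℕ} (hm : (m : L) ≠ 0) [Nonempty X]
    (hγ : ∀ᶠ σ in 𝓝 1, γ σ = 1) (hA : IsSplit F (⨂[F] _ : Fin m, A))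
    (hA' : IsSplit (twistFun X γ) (twistFun X γ ⊗[F] A)) :
    ∃ (d : ℕ) (_ : d ≠ 0) (f : A →ₐ[F] Matrix (Fin d) (Fin d) L)
      (p : Gal(L/F) → Matrix (Fin d) (Fin d) L) (a : Gal(L/F) → Gal(L/F) → L)
      (u : Gal(L/F) → X → L), IsForm L f ∧ (∀ᶠ σ in 𝓝 1, p σ = 1) ∧
      (∀ σ s, p σ * (f s).map σ = f s * p σ) ∧ (∀ σ τ, a σ τ ^ m = 1) ∧
      (∀ σ τ, p σ * (p τ).map σ = a σ τ • p (σ * τ)) ∧ (∀ σ x, u σ x ≠ 0) ∧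
      (∀ᶠ σ in 𝓝 1, u σ = 1) ∧
      ∀ σ τ x, u (σ * τ) x = a σ τ * (u σ x * σ (u τ ((γ σ)⁻¹ • x))) := by
  obtain ⟨d, hd, θ, hθ, hθσ⟩ := exists_family_of_isSplit γ hγ hA'
  have : NeZero d := ⟨hd⟩
  obtain ⟨z⟩ := ‹Nonempty X›
  -- `Q x` carries the representation at `z` to that at `x`. The normalisation at `z` makes the
  -- projective cocycle `σ ↦ Q(γ_σ z)⁻¹` equal to `1` near the identity.
  have hQ : ∀ x, ∃ Q Q' : Matrix (Fin d) (Fin d) L, Q * Q' = 1 ∧ (x = z → Q = 1) ∧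
      ∀ s, θ x s * Q = Q * θ z s := by
    intro x
    by_cases hx : x = z
    · subst hx
      exact ⟨1, 1, one_mul _, fun _ => rfl, fun s => by rw [one_mul, mul_one]⟩
    · obtain ⟨Q, Q', h1, -, h⟩ := (hθ x).exists_conj (hθ z)
      exact ⟨Q, Q', h1, fun h => absurd h hx, h⟩
  choose Q Q' hQQ hQz hQ using hQ
  have hQQ' : ∀ x, Q' x * Q x = 1 := fun x => mul_eq_one_comm.1 (hQQ x)
  have hQ' : ∀ x s, Q' x * θ x s = θ z s * Q' x := by
    intro x s
    calc Q' x * θ x s = Q' x * (θ x s * Q x) * Q' x := by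
          rw [mul_assoc, mul_assoc, hQQ, mul_one]
      _ = (Q' x * Q x) * θ z s * Q' x := by rw [hQ]; simp only [mul_assoc]
      _ = _ := by rw [hQQ', one_mul]
  have hQmap : ∀ x, ∀ᶠ σ : Gal(L/F) in 𝓝 1, (Q x).map σ = Q x := fun x => by
    filter_upwards [eventually_comp_eq (F := F) fun ij : Fin d × Fin d => Q x ij.1 ij.2] with σ h
    exact Matrix.ext fun i j => h (i, j)
  obtain ⟨p, p', a, hpp, hp, hpf, ham, hpa⟩ := exists_rescaled_projective hm (hθ z) hA
    (fun σ => Q' (γ σ • z)) (fun σ => Q (γ σ • z)) (fun σ => hQQ' _)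
    (by
      filter_upwards [hγ] with σ h
      rw [h, one_smul]
      have h1 := hQQ z
      rwa [hQz z rfl, one_mul] at h1)
    (fun σ s => by rw [← hθσ, hQ'])
  have hpp' : ∀ σ, p' σ * p σ = 1 := fun σ => mul_eq_one_comm.1 (hpp σ)
  have hpf' : ∀ (σ : Gal(L/F)) s, (θ z s).map σ * p' σ = p' σ * θ z s := by
    intro σ s
    calc (θ z s).map σ * p' σ = p' σ * (p σ * (θ z s).map σ) * p' σ := by
          rw [← mul_assoc, hpp', one_mul]
      _ = p' σ * θ z s * (p σ * p' σ) := by rw [hpf]; simp only [mul_assoc]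
      _ = _ := by rw [hpp, mul_one]
  -- Both `σ(Q_{γ_σ⁻¹ x})` and `Q_x p_σ` carry `σ(θ_z)` to `θ_x`, so they differ by a scalar.
  have hu : ∀ σ x, ∃ u : L, (Q ((γ σ)⁻¹ • x)).map σ = u • (Q x * p σ) := by
    intro σ x
    have h0 : ∀ s, θ x s = (θ ((γ σ)⁻¹ • x) s).map σ := fun s => by rw [← hθσ, smul_inv_smul]
    have h1 : ∀ s, θ z s * (Q' x * (Q ((γ σ)⁻¹ • x)).map σ * p' σ) =
        Q' x * (Q ((γ σ)⁻¹ • x)).map σ * p' σ * θ z s := by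
      intro s
      calc θ z s * (Q' x * (Q ((γ σ)⁻¹ • x)).map σ * p' σ)
          = (θ z s * Q' x) * (Q ((γ σ)⁻¹ • x)).map σ * p' σ := by simp only [mul_assoc]
        _ = Q' x * (θ ((γ σ)⁻¹ • x) s * Q ((γ σ)⁻¹ • x)).map σ * p' σ := by
          rw [← hQ', h0, map_galois_mul]; simp only [mul_assoc]
        _ = Q' x * (Q ((γ σ)⁻¹ • x)).map σ * ((θ z s).map σ * p' σ) := by
          rw [hQ, map_galois_mul]; simp only [mul_assoc]
        _ = _ := by rw [hpf']; simp only [mul_assoc]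
    obtain ⟨u, hu⟩ := (hθ z).exists_scalar h1
    refine ⟨u, ?_⟩
    calc (Q ((γ σ)⁻¹ • x)).map σ
        = (Q x * Q' x) * (Q ((γ σ)⁻¹ • x)).map σ * (p' σ * p σ) := by
          rw [hQQ, hpp', one_mul, mul_one]
      _ = Q x * (Q' x * (Q ((γ σ)⁻¹ • x)).map σ * p' σ) * p σ := by simp only [mul_assoc]
      _ = _ := by rw [hu, mul_smul_comm, mul_one, smul_mul_assoc]
  choose u hu using hu
  have hQ0 : ∀ x, Q x ≠ 0 := fun x h => by
    have h1 := hQQ x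
    rw [h, zero_mul] at h1
    exact zero_ne_one h1
  have hQp0 : ∀ x σ, Q x * p σ ≠ 0 := fun x σ h => by
    apply hQ0 x
    rw [← mul_one (Q x), ← hpp σ, ← mul_assoc, h, zero_mul]
  have hsmul : ∀ x σ (b b' : L), b • (Q x * p σ) = b' • (Q x * p σ) → b = b' := by
    intro x σ b b' h
    have h1 : (b - b') • (Q x * p σ) = 0 := by rw [sub_smul, h, sub_self]
    exact sub_eq_zero.1 ((smul_eq_zero.1 h1).resolve_right (hQp0 x σ))
  refine ⟨d, hd, θ z, p, a, u, hθ z, hp, hpf, ham, hpa, fun σ x h => ?_, ?_, fun σ τ x => ?_⟩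
  · have h1 := hu σ x
    rw [h, zero_smul] at h1
    apply hQ0 ((γ σ)⁻¹ • x)
    refine Matrix.ext fun i j => ?_
    have h2 := congrFun (congrFun h1 i) j
    simpa using h2
  · filter_upwards [hγ, hp, Filter.eventually_all.2 hQmap] with σ h1 h2 h3
    funext x
    have h4 := hu σ x
    rw [h1, inv_one, one_smul, h3] at h4
    apply hsmul x σ
    rw [← h4, h2, Pi.one_apply, one_smul, mul_one]
  · apply hsmul x (σ * τ)
    -- Evaluating the conjugate of `Q` under `σ τ` at once or in two steps shows that `u` has the
    -- same defect `a` as `p`.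
    have h1 : (Q ((γ (σ * τ))⁻¹ • x)).map (σ * τ) =
        ((Q ((γ τ)⁻¹ • (γ σ)⁻¹ • x)).map τ).map σ := by
      rw [map_mul, _root_.mul_inv_rev, mul_smul]
      rfl
    have h2 : ∀ (b : L) (M : Matrix (Fin d) (Fin d) L), (b • M).map σ = σ b • M.map σ :=
      fun b M => Matrix.ext fun i j => by simp
    rw [← hu, h1, hu, h2, map_galois_mul, hu, smul_mul_assoc, mul_assoc, hpa, mul_smul_comm,
      smul_smul, smul_smul]
    congr 1
    ring

end Family

/-! ### Cocycles in `T ⋊ G` built from functions on `X`. -/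

section Cocycles

open Topology Matrix Multiplicative

variable {F : Type u} [Field F] {G : Type w} [Group G] {X : Type v} [MulAction G X] {m : ℕ}
  [Fintype X] [DecidableEq X] {A : Type*} [Ring A] [Algebra F A] [Module.Finite F A]

theorem prod_zpow_eq {M Y : Type*} [CommGroup M] (b : M) (s : Finset Y) (k : Y → ℤ) :
    ∏ x ∈ s, b ^ k x = b ^ ∑ x ∈ s, k x := by
  induction s using Finset.cons_induction with
  | empty => simp
  | cons x s hx ih => rw [Finset.prod_cons, Finset.sum_cons, _root_.zpow_add, ih]

/-- The cocycle identity `c(τ) = c(σ) σ(c(σ⁻¹ τ))` transports triviality near `1` to constancy near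
`σ`. -/
theorem isLocallyConstant_of_eventually_eq_one {H : Type*} [Group H]
    [MulDistribMulAction (AbsGal F) H] (c : AbsGal F → H)
    (hmul : ∀ σ τ, c (σ * τ) = c σ * σ • c τ) (hc : ∀ᶠ σ in 𝓝 1, c σ = 1) :
    IsLocallyConstant c := by
  rw [IsLocallyConstant.iff_eventually_eq]
  intro σ
  have h1 : Filter.Tendsto (fun τ => σ⁻¹ * τ) (𝓝 σ) (𝓝 1) := by
    have := (continuous_const_mul σ⁻¹).tendsto σ
    rwa [inv_mul_cancel] at this
  filter_upwards [h1.eventually hc] with τ h2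
  have h3 := hmul σ (σ⁻¹ * τ)
  rwa [mul_inv_cancel_left, h2, smul_one, mul_one] at h3

/-- The cocycle attached to functions `u_σ` on `X` whose failure to be a cocycle is a family of
`m`-th roots of unity. -/
def cocycleOfFun (γ : AbsGal F →* G) (hγ : ∀ᶠ σ in 𝓝 1, γ σ = 1)
    (u : AbsGal F → X → (SeparableClosure F)ˣ) (a : AbsGal F → AbsGal F → (SeparableClosure F)ˣ)
    (ha : ∀ σ τ, a σ τ ^ m = 1) (hu : ∀ᶠ σ in 𝓝 1, u σ = 1)
    (hmul : ∀ σ τ x, u (σ * τ) x = a σ τ * (u σ x *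
      Units.map (σ : SeparableClosure F →* SeparableClosure F) (u τ ((γ σ)⁻¹ • x)))) :
    Cocycle (AbsGal F) (TorusSemidirect X m G (SeparableClosure F)) :=
  have h : ∀ σ τ, (⟨torusOfFun m (u (σ * τ)), γ (σ * τ)⟩ :
      TorusSemidirect X m G (SeparableClosure F)) =
      ⟨torusOfFun m (u σ), γ σ⟩ * σ • ⟨torusOfFun m (u τ), γ τ⟩ := fun σ τ => by
    refine SemidirectProduct.ext (MonoidHom.ext fun j => ?_) (map_mul γ σ τ)
    rw [SemidirectProduct.mul_left]
    change torusOfFun m (u (σ * τ)) (ofAdd j.toAdd) = torusOfFun m (u σ) (ofAdd j.toAdd) *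
      Units.map (σ : SeparableClosure F →* SeparableClosure F)
        (torusOfFun m (u τ) (ofAdd (J.act m (γ σ)⁻¹ j.toAdd)))
    rw [torusOfFun_act, torusOfFun_apply, torusOfFun_apply, map_prod, ← Finset.prod_mul_distrib]
    simp only [hmul, _root_.mul_zpow, Finset.prod_mul_distrib, map_zpow]
    -- The constant `a` contributes `a` to the power of the coefficient sum of `j`. That sum is
    -- divisible by `m`, so the contribution is `1`.
    rw [prod_zpow_eq, ← total_eq_sum, ← J.deg_mul, mul_comm (J.deg X m _), _root_.zpow_mul,
      zpow_natCast, ha, _root_.one_zpow, one_mul]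
  { toFun := fun σ => ⟨torusOfFun m (u σ), γ σ⟩
    map_mul' := h
    locConst := isLocallyConstant_of_eventually_eq_one _ h <| by
      filter_upwards [hγ, hu] with σ h1 h2
      rw [h1, h2]
      refine SemidirectProduct.ext (MonoidHom.ext fun j => ?_) rfl
      exact (torusOfFun_apply 1 j.toAdd).trans (by simp) }

variable (γ : AbsGal F →* G) in
/-- An algebra which is split by a twisted form of `F^X` and whose `m`-th tensor power is split is
Brauer equivalent to the twisted matrix algebra of a cocycle. -/
theorem exists_cocycle_of_isSplit (hm : (m : SeparableClosure F) ≠ 0) [Nonempty X]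
    (hγ : ∀ᶠ σ in 𝓝 1, γ σ = 1) (hA : IsSplit F (⨂[F] _ : Fin m, A))
    (hA' : IsSplit (twistFun X γ) (twistFun X γ ⊗[F] A)) :
    ∃ c : Cocycle (AbsGal F) (TorusSemidirect X m G (SeparableClosure F)), c.rightHom = γ ∧
      ∃ k l : ℕ, k ≠ 0 ∧ l ≠ 0 ∧ Nonempty (Matrix (Fin k) (Fin k) A ≃ₐ[F]
        Matrix (Fin l) (Fin l) (twistMatrix c)) := by
  obtain ⟨d, hd, f, p, a, u, hf, hp, hpf, ham, hpa, hu0, hu1, hu⟩ :=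
    exists_projective_of_isSplit γ hm hγ hA hA'
  have : NeZero d := ⟨hd⟩
  have hm0 : m ≠ 0 := by rintro rfl; exact hm (by simp)
  have ha0 : ∀ σ τ, a σ τ ≠ 0 := fun σ τ h => by
    have h1 := ham σ τ
    rw [h, zero_pow hm0] at h1
    exact zero_ne_one h1
  -- With `u⁻¹` as the torus part, `u` acts monomially on the opposite of the twisted algebra. Its
  -- factor set there is `a⁻¹`, opposite to that of `p`.
  let c : Cocycle (AbsGal F) (TorusSemidirect X m G (SeparableClosure F)) :=
    cocycleOfFun γ hγ (fun σ x => (Units.mk0 (u σ x) (hu0 σ x))⁻¹)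
      (fun σ τ => (Units.mk0 (a σ τ) (ha0 σ τ))⁻¹)
      (fun σ τ => by
        rw [_root_.inv_pow, inv_eq_one]
        exact Units.ext (ham σ τ))
      (by
        filter_upwards [hu1] with σ h
        funext x
        rw [Pi.one_apply, inv_eq_one]
        exact Units.ext (congrFun h x))
      (fun σ τ x => by
        rw [map_inv, ← mul_inv, ← mul_inv, _root_.inv_inj]
        exact Units.ext (hu σ τ x))
  have hc : ∀ σ x y, ((c σ).left (ofAdd (J.diff X m x y)) : SeparableClosure F) =
      (u σ x)⁻¹ * u σ y := by
    intro σ x y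
    have h1 : (c σ).left (ofAdd (J.diff X m x y)) =
        (Units.mk0 (u σ x) (hu0 σ x))⁻¹ / (Units.mk0 (u σ y) (hu0 σ y))⁻¹ := torusOfFun_diff _ x y
    rw [h1, div_inv_eq_mul, Units.val_mul, Units.val_inv_eq_inv_val, Units.val_mk0, Units.val_mk0]
  refine ⟨c, rfl, ?_⟩
  have hg := c.isTwist_val
  have hfin := c.finite_twistMatrix
  let g := (twistMatrix c).val
  have hgapp : ∀ σ s x y, g s x y = (u σ x)⁻¹ * u σ y * σ (g s ((γ σ)⁻¹ • x) ((γ σ)⁻¹ • y)) := by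
    intro σ s x y
    rw [← hc]
    exact hg.apply_eq σ s x y
  let q : AbsGal F → Matrix X X (SeparableClosure F) := fun σ => monomialMatrix (u σ) (γ σ)
  -- `q` and `q'` induce the Galois actions on the transposed and on the original twisted algebra,
  -- with factor sets `a⁻¹` and `a`.
  let q' : AbsGal F → Matrix X X (SeparableClosure F) := fun σ => monomialMatrix (u σ)⁻¹ (γ σ)
  have hq1 : ∀ᶠ σ in 𝓝 1, q σ = 1 := by
    filter_upwards [hγ, hu1] with σ h1 h2
    simp only [q]
    rw [h1, h2, monomialMatrix_one]
  have hq1' : ∀ᶠ σ in 𝓝 1, q' σ = 1 := by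
    filter_upwards [hγ, hu1] with σ h1 h2
    simp only [q']
    rw [h1, h2, inv_one, monomialMatrix_one]
  have hmap : ∀ (σ : AbsGal F) (w : X → SeparableClosure F) (b : G),
      (monomialMatrix w b).map σ = monomialMatrix (fun x => σ (w x)) b := fun σ w b =>
    map_monomialMatrix (σ : SeparableClosure F →+* SeparableClosure F) w b
  have hqa : ∀ σ τ, q σ * (q τ).map σ = (a σ τ)⁻¹ • q (σ * τ) := by
    intro σ τ
    simp only [q]
    rw [hmap, monomialMatrix_mul, map_mul]
    refine Matrix.ext fun x y => ?_
    rw [Matrix.smul_apply, monomialMatrix_apply, monomialMatrix_apply, hu]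
    split_ifs
    · rw [smul_eq_mul, inv_mul_cancel_left₀ (ha0 σ τ)]
    · rw [smul_zero]
  have hqa' : ∀ σ τ, q' σ * (q' τ).map σ = a σ τ • q' (σ * τ) := by
    intro σ τ
    simp only [q']
    rw [hmap, monomialMatrix_mul, map_mul]
    refine Matrix.ext fun x y => ?_
    rw [Matrix.smul_apply, monomialMatrix_apply, monomialMatrix_apply]
    simp only [Pi.inv_apply, hu]
    split_ifs
    · rw [smul_eq_mul, mul_inv, mul_inv_cancel_left₀ (ha0 σ τ), mul_inv, map_inv₀]
    · rw [smul_zero]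
  have hqg : ∀ σ s, q σ * (transposeHom g s).map σ = transposeHom g s * q σ := by
    intro σ s
    refine Matrix.ext fun x y => ?_
    rw [monomialMatrix_mul_apply, mul_monomialMatrix_apply, transposeHom_apply, Matrix.map_apply,
      Matrix.transpose_apply, Matrix.transpose_apply, hgapp σ _ (γ σ • y), inv_smul_smul]
    have := hu0 σ (γ σ • y)
    field_simp
  have hqg' : ∀ σ s, q' σ * (g s).map σ = g s * q' σ := by
    intro σ s
    refine Matrix.ext fun x y => ?_
    rw [monomialMatrix_mul_apply, mul_monomialMatrix_apply, Matrix.map_apply, hgapp σ s x,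
      inv_smul_smul, Pi.inv_apply, Pi.inv_apply]
    have := hu0 σ (γ σ • y)
    field_simp
  exact exists_matrix_equiv_of_isSplit
    (isSplit_tensor_of_projective hf hg.isForm.transposeHom p q a ha0 hpa hqa hp hq1 hpf hqg)
    (isSplit_tensor_of_projective hg.isForm hg.isForm.transposeHom q' q a ha0 hqa' hqa hq1' hq1
      hqg' hqg)

end Cocycles

end TorusBrauer
end

noncomputable section
namespace TorusBrauer

/-! ### The classification -/

section Classification

open Topology

variable {F : Type u} [Field F] {G : Type} [Group G] {X : Type v} [MulAction G X] {m : ℕ}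

namespace Cocycle

/-- Conjugation of a cocycle by an invariant element. -/
def conj (c : Cocycle (AbsGal F) (TorusSemidirect X m G (SeparableClosure F)))
    (a : TorusSemidirect X m G (SeparableClosure F)) (ha : ∀ σ : AbsGal F, σ • a = a) :
    Cocycle (AbsGal F) (TorusSemidirect X m G (SeparableClosure F)) where
  toFun σ := a⁻¹ * c σ * a
  map_mul' σ τ := by rw [c.map_mul', smul_mul', smul_mul', smul_inv', ha]; group
  locConst := c.locConst.comp fun x => a⁻¹ * x * a

theorem smul_inr (σ : AbsGal F) (g : G) :
    σ • (SemidirectProduct.inr g : TorusSemidirect X m G (SeparableClosure F)) =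
      SemidirectProduct.inr g := by
  refine SemidirectProduct.ext ?_ rfl
  rw [smul_left, SemidirectProduct.left_inr]
  exact MonoidHom.comp_one _

variable [Fintype X] [DecidableEq X] [Nonempty X]

variable (c : Cocycle (AbsGal F) (TorusSemidirect X m G (SeparableClosure F)))

/-- The matrices live in a universe that also depends on `X`; finite dimensionality over `F` allows
a copy in the universe of `F`. Simplicity and centrality descend from `M_X(F_sep)`. -/
theorem exists_csa : ∃ A : CSA.{u, u} F, Nonempty (A ≃ₐ[F] twistMatrix c) := by
  have hfin := c.finite_twistMatrix
  have hsmall : Small.{u} (twistMatrix c) :=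
    ⟨⟨_, ⟨(Module.finBasis F (twistMatrix c)).equivFun.toEquiv⟩⟩⟩
  let e := Shrink.algEquiv F (twistMatrix c)
  have hf := (c.isTwist_val.comp_algEquiv e).isForm
  have hA : Module.Finite F (Shrink.{u} (twistMatrix c)) :=
    Module.Finite.equiv e.symm.toLinearEquiv
  have hs : IsSimpleRing (Shrink.{u} (twistMatrix c)) := hf.isSimpleRing
  have hc : Algebra.IsCentral F (Shrink.{u} (twistMatrix c)) := hf.isCentral
  exact ⟨{
    toAlgCat := AlgCat.of F (Shrink.{u} (twistMatrix c))
    isCentral := hc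
    isSimple := hs
    fin_dim := hA }, ⟨e⟩⟩

/-- The central simple algebra attached to a cocycle. -/
def csa : CSA.{u, u} F := c.exists_csa.choose

/-- The identification of `csa` with the twisted matrix algebra. -/
def csaEquiv : c.csa ≃ₐ[F] twistMatrix c := c.exists_csa.choose_spec.some

theorem csa_mem_relBrauer :
    Quotient.mk (Brauer.CSA_Setoid F) c.csa ∈ relBrauer m F (twistFun X c.rightHom) :=
  have h := c.isTwist_val.comp_algEquiv c.csaEquiv
  ⟨c.csa, rfl, h.isSplit_tensorPower, h.isSplit_twistFun⟩

omit [Nonempty X] in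
theorem isBrauerEquivalent_of_equiv {A B : CSA.{u, u} F} (e : A ≃ₐ[F] B) :
    IsBrauerEquivalent A B :=
  ⟨1, 1, one_ne_zero, one_ne_zero, ⟨e.mapMatrix⟩⟩

theorem csa_isBrauerEquivalent {c c' : Cocycle (AbsGal F) (TorusSemidirect X m G (SeparableClosure F))}
    (a : TorusSemidirect X m G (SeparableClosure F)) (h : ∀ σ, c' σ = a⁻¹ * c σ * σ • a) :
    IsBrauerEquivalent c.csa c'.csa := by
  obtain ⟨e⟩ := nonempty_twistMatrix_equiv a h
  exact isBrauerEquivalent_of_equiv ((c.csaEquiv.trans e).trans c'.csaEquiv.symm)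

variable [Finite G]

/-- The Galois algebra attached to a cocycle. -/
abbrev galois : GaloisAlgebra G F := galoisAlgebraOfHom c.rightHom c.eventually_rightHom

-- Left translation by the `G`-component of `a` exchanges the two twisting conditions and commutes
-- with right translations.
omit [Fintype X] [DecidableEq X] [Nonempty X] in
theorem galois_equiv {c c' : Cocycle (AbsGal F) (TorusSemidirect X m G (SeparableClosure F))}
    (a : TorusSemidirect X m G (SeparableClosure F)) (h : ∀ σ, c' σ = a⁻¹ * c σ * σ • a) :
    GaloisClass.mk c.galois = GaloisClass.mk c'.galois := by
  have key : ∀ {c c' : Cocycle (AbsGal F) (TorusSemidirect X m G (SeparableClosure F))} (a : G),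
      (∀ σ, (c' σ).right = a⁻¹ * (c σ).right * a) → ∀ f ∈ twistFun G c.rightHom,
      (fun h => f (a * h)) ∈ twistFun G c'.rightHom := by
    intro c c' a h f hf σ b
    change f (a * ((c' σ).right * b)) = _
    rw [h, ← hf σ (a * b)]
    congr 1
    change _ = (c σ).right * (a * b)
    group
  have h1 : ∀ σ, (c' σ).right = a.right⁻¹ * (c σ).right * a.right := fun σ => by
    rw [h, SemidirectProduct.mul_right, SemidirectProduct.mul_right, SemidirectProduct.inv_right,
      smul_right]
  have h2 : ∀ σ, (c σ).right = a.right⁻¹⁻¹ * (c' σ).right * a.right⁻¹ := fun σ => by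
    rw [h1]; group
  let e : twistFun G c.rightHom ≃ₐ[F] twistFun G c'.rightHom :=
    { toFun := fun f => ⟨_, key a.right h1 f.1 f.2⟩
      invFun := fun f => ⟨_, key a.right⁻¹ h2 f.1 f.2⟩
      left_inv := fun f => Subtype.ext (funext fun b => by simp)
      right_inv := fun f => Subtype.ext (funext fun b => by simp)
      map_mul' := fun f f' => rfl
      map_add' := fun f f' => rfl
      commutes' := fun r => rfl }
  refine Quotient.sound ⟨e, fun g x => Subtype.ext (funext fun b => ?_)⟩
  exact congrArg x.1 (mul_assoc _ _ _)

omit [Fintype X] [DecidableEq X] [Nonempty X] in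
theorem relBrauerClass_galois :
    relBrauerClass X m (GaloisClass.mk c.galois) = relBrauer m F (twistFun X c.rightHom) :=
  relBrauer_congr m F (assocAlgebraTwistEquiv X c.rightHom c.eventually_rightHom)

/-- The Galois algebra and the Brauer class attached to a cocycle. -/
def classify : Σ ε : GaloisClass G F, relBrauerClass X m ε :=
  ⟨GaloisClass.mk c.galois, Quotient.mk (Brauer.CSA_Setoid F) c.csa,
    c.relBrauerClass_galois ▸ c.csa_mem_relBrauer⟩

/-- Conjugating by a constant element of `G` makes the two homomorphisms to `G` equal without
changing the Brauer class; the comparison of torus parts then applies. -/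
theorem cohomologous_of_classify_eq
    {c c' : Cocycle (AbsGal F) (TorusSemidirect X m G (SeparableClosure F))}
    (h : c.classify = c'.classify) : cohomologous _ _ c c' := by
  obtain ⟨e, he⟩ : galoisIso G F c.galois c'.galois := Quotient.exact (congrArg Sigma.fst h)
  obtain ⟨g, hg⟩ := isConj_of_twistFun_equiv c.rightHom c'.rightHom c.eventually_rightHom e he
  have hA : IsBrauerEquivalent c.csa c'.csa :=
    Quotient.exact (congrArg (fun x => (x.2 : BrauerGroup.{u, u} F)) h)
  let c₁ := c.conj (SemidirectProduct.inr g) fun σ => smul_inr σ g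
  have h₁ : cohomologous _ _ c c₁ := ⟨SemidirectProduct.inr g, fun σ => by rw [smul_inr]; rfl⟩
  obtain ⟨a, ha⟩ := h₁
  obtain ⟨k, l, hk, hl, ⟨i⟩⟩ := (csa_isBrauerEquivalent a ha).symm.trans hA
  have t₁ := c₁.isTwist_val.comp_algEquiv c₁.csaEquiv
  have t' := c'.isTwist_val.comp_algEquiv c'.csaEquiv
  -- Both twisted algebras have degree `|X|`, so the matrix sizes in the Brauer equivalence agree.
  have hkl : k = l := by
    have h2 := i.toLinearEquiv.finrank_eq
    rw [Module.finrank_matrix, Module.finrank_matrix, t₁.isForm.finrank_matrix,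
      t'.isForm.finrank_matrix, Fintype.card_fin, Fintype.card_fin] at h2
    have h3 := Nat.eq_of_mul_eq_mul_right (pow_pos Fintype.card_pos 2) h2
    exact Nat.mul_self_inj.1 h3
  subst hkl
  refine (cohomologous _ _).trans ⟨a, ha⟩ (exists_cohomologous (fun σ => ?_) t₁ t' hk i)
  refine (hg σ).trans ?_
  change _ = ((SemidirectProduct.inr g)⁻¹ * c σ * SemidirectProduct.inr g).right
  rw [SemidirectProduct.mul_right, SemidirectProduct.mul_right, SemidirectProduct.inv_right]
  rfl

omit c in
-- The Galois algebra supplies `γ`, which identifies `Map_G(X, E)` with the twisted form of `F^X`.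
-- The invertibility of `m` enters through the `m`-th roots of the multipliers.
theorem exists_classify_eq (hm : (m : SeparableClosure F) ≠ 0)
    (p : Σ ε : GaloisClass G F, relBrauerClass X m ε) :
    ∃ c : Cocycle (AbsGal F) (TorusSemidirect X m G (SeparableClosure F)), c.classify = p := by
  obtain ⟨ε, b, hb⟩ := p
  obtain ⟨E, rfl⟩ := Quotient.exists_rep ε
  obtain ⟨γ, hγ, e, he⟩ := exists_equiv_twistFun (L := SeparableClosure F) E
  have hE : (Quotient.mk (galoisIso G F) E : GaloisClass G F) =
      GaloisClass.mk (galoisAlgebraOfHom γ hγ) :=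
    Quotient.sound ⟨e, fun g x => Subtype.ext (funext fun h => he g x h)⟩
  have hb' : b ∈ relBrauer m F (twistFun X γ) := by
    rw [hE] at hb
    rw [← relBrauer_congr m F (assocAlgebraTwistEquiv X γ hγ)]
    exact hb
  obtain ⟨A, rfl, hA, hA'⟩ := hb'
  obtain ⟨c, rfl, k, l, hk, hl, ⟨i⟩⟩ := exists_cocycle_of_isSplit γ hm hγ hA hA'
  refine ⟨c, Sigma.subtype_ext hE.symm ?_⟩
  exact Quotient.sound (IsBrauerEquivalent.symm ⟨k, l, hk, hl, ⟨i.trans c.csaEquiv.symm.mapMatrix⟩⟩)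

end Cocycle

variable [Fintype X] [DecidableEq X] [Nonempty X] [Finite G]

/-- The Galois algebra and the Brauer class attached to a cohomology class. -/
def H1.classify : H1 (AbsGal F) (TorusSemidirect X m G (SeparableClosure F)) →
    Σ ε : GaloisClass G F, relBrauerClass X m ε :=
  Quotient.lift (fun c => c.classify) fun c c' h => by
    obtain ⟨a, ha⟩ := h
    refine Sigma.subtype_ext (Cocycle.galois_equiv a ha) ?_
    exact Quotient.sound (Cocycle.csa_isBrauerEquivalent a ha)

/-- The classification of `H¹(F, T ⋊ G)` by Galois algebras and relative Brauer classes. -/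
def h1Equiv (hm : (m : SeparableClosure F) ≠ 0) :
    H1 (AbsGal F) (TorusSemidirect X m G (SeparableClosure F)) ≃
      Σ ε : GaloisClass G F, relBrauerClass X m ε :=
  Equiv.ofBijective H1.classify
    ⟨fun x y => Quotient.inductionOn₂ x y fun _ _ h =>
        Quotient.sound (Cocycle.cohomologous_of_classify_eq h),
      fun p => by
        obtain ⟨c, hc⟩ := Cocycle.exists_classify_eq hm p
        exact ⟨H1.mk c, hc⟩⟩

omit [Fintype X] [DecidableEq X] [Nonempty X] [Finite G] in
/-- For a simply transitive action, evaluation at a point identifies `Map_G(X, E)` with `E`. -/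
def assocAlgebraEvalEquiv (h : ∀ x y : X, ∃! g : G, g • x = y) (x : X) (E : GaloisAlgebra G F) :
    assocAlgebra X E ≃ₐ[F] E :=
  AlgEquiv.ofBijective
    ((Pi.evalAlgHom F (fun _ : X => (E : Type u)) x).comp (assocAlgebra X E).val) <| by
    choose s hs hs' using h x
    refine ⟨fun φ ψ hφ => Subtype.ext (funext fun y => ?_), fun a => ?_⟩
    · rw [← hs y]
      have h1 : φ.1 x = ψ.1 x := hφ
      exact ((φ.2 (s y) x).trans (congrArg (s y • ·) h1)).trans (ψ.2 (s y) x).symm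
    · refine ⟨⟨fun y => s y • a, fun g y => ?_⟩, ?_⟩
      · have h1 : g * s y = s (g • y) := hs' (g • y) (g * s y)
          ((mul_smul g (s y) x).trans (congrArg (g • ·) (hs y)))
        beta_reduce
        rw [← h1, mul_smul]
      · change s x • a = a
        rw [← hs' x 1 (one_smul G x), one_smul]

end Classification

end TorusBrauer
end

theorem lemma5p1 (F : Type u) [Field F] (n m : ℕ) (hn : 2 ≤ n) (hm : m ∣ n)
    (hchar : ¬ ringChar F ∣ n) (G : Subgroup (Equiv.Perm (Fin n)))
    (X : Type v) [Fintype X] [DecidableEq X] [MulAction G X] (hX : Fintype.card X = n) :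
    (∃ Φ : H1 (AbsGal F) (TorusSemidirect X m G (SeparableClosure F)) ≃
        Σ ε : GaloisClass G F, relBrauerClass X m ε,
      ∀ c : Cocycle (AbsGal F) (TorusSemidirect X m G (SeparableClosure F)),
        (∃ (E : GaloisAlgebra G F) (e : E ≃ₐ[F] twistGalois c),
          (∀ (g : G) (x : E) (h : G), (e (g • x)).1 h = (e x).1 (h * g)) ∧
          (Φ (H1.mk c)).1 = GaloisClass.mk E) ∧
        (∃ A : CSA.{u, u} F, Nonempty (A ≃ₐ[F] twistMatrix c) ∧
          ((Φ (H1.mk c)).2 : BrauerGroup.{u, u} F) = Quotient.mk (Brauer.CSA_Setoid F) A)) ∧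
    ((∀ x y : X, ∃! g : G, g • x = y) → ∀ E : GaloisAlgebra G F,
      relBrauerClass X m (GaloisClass.mk E) = relBrauer m F E) := by
  have : Nonempty X := Fintype.card_pos_iff.1 (by omega)
  -- If `m` vanished in `F`, the characteristic would divide `m` and hence `n`.
  have hmF : (m : SeparableClosure F) ≠ 0 := by
    intro h
    apply hchar
    have h1 : (m : F) = 0 := by
      apply FaithfulSMul.algebraMap_injective F (SeparableClosure F)
      rw [map_natCast, map_zero, h]
    exact (ringChar.dvd h1).trans hm
  -- The explicit description holds by construction: `twistGalois c` unfolds to the twisted form of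
  -- `L^G` used for `c.galois`.
  refine ⟨⟨h1Equiv hmF, fun c => ⟨⟨c.galois, AlgEquiv.refl, fun _ _ _ => rfl, rfl⟩,
    c.csa, ⟨c.csaEquiv⟩, rfl⟩⟩, fun h E => ?_⟩
  obtain ⟨x⟩ := ‹Nonempty X›
  exact relBrauer_congr m F (assocAlgebraEvalEquiv h x E)
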